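/- Let $n\ge 7$ be an integer, and let $S^n\subset\mathbb R^{n+1}$ be the unit sphere with the standard round metric $g$ induced by $\mathbb R^{n+1}$. For a smooth Riemannian metric $\tilde g$ on $S^n$, let $$L_{\tilde g}=\frac{4(n-1)}{n-2}\,\Delta_{\tilde g}+S_{\tilde g}$$ be the Yamabe operator, where $\Delta_{\tilde g}$ is the nonnegative Laplacian and $S_{\tilde g}$ the scalar curvature of $\tilde g$, and let $\lambda_1(\tilde g)\le\lambda_2(\tilde g)\le\cdots$ be its eigenvalues, repeated according to multiplicity. Let $[g]$ be the conformal class of $g$, that is, the set of all metrics $f g$ with $f$ a positive smooth function on $S^n$, and for $k\ge 1$ let $$\mu_k(S^n)=\inf_{\tilde g\in[g]}\lambda_k(\tilde g)\,\mathrm{Vol}(S^n,\tilde g)^{2/n}$$ be the $k$-th Yamabe invariant of the round sphere. Then $$\mu_{n+2}(S^n)<(n+2)^{2/n}\,\mu_1(S^n).$$ -/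

import Mathlib

open scoped Manifold ContDiff Topology
open MeasureTheory Set

noncomputable section

namespace Yamabe

/-! ### Riemannian geometry in coordinates

`G` is a field of symmetric matrices (the components `g_ij` of a metric) on an open set
of `ℝⁿ`. -/

section Local

/-- The partial derivative `∂ᵢ f`. -/
def partialDeriv {n : ℕ} (i : Fin n) (f : EuclideanSpace ℝ (Fin n) → ℝ)
    (y : EuclideanSpace ℝ (Fin n)) : ℝ :=
  fderiv ℝ f y (EuclideanSpace.single i (1 : ℝ))

/-- The Christoffel symbol `Γᵏᵢⱼ = ½ gᵏˡ (∂ᵢ gⱼₗ + ∂ⱼ gᵢₗ - ∂ₗ gᵢⱼ)`. -/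
def christoffel {n : ℕ} (G : EuclideanSpace ℝ (Fin n) → Matrix (Fin n) (Fin n) ℝ)
    (k i j : Fin n) (y : EuclideanSpace ℝ (Fin n)) : ℝ :=
  (1 / 2 : ℝ) * ∑ l, (G y)⁻¹ k l *
    (partialDeriv i (fun z => G z j l) y + partialDeriv j (fun z => G z i l) y
      - partialDeriv l (fun z => G z i j) y)

/-- The Ricci tensor
`Rᵢⱼ = ∂ₖ Γᵏᵢⱼ - ∂ⱼ Γᵏᵢₖ + Γᵏₖₗ Γˡᵢⱼ - Γᵏⱼₗ Γˡᵢₖ`. -/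
def localRicci {n : ℕ} (G : EuclideanSpace ℝ (Fin n) → Matrix (Fin n) (Fin n) ℝ)
    (i j : Fin n) (y : EuclideanSpace ℝ (Fin n)) : ℝ :=
  ∑ k, (partialDeriv k (christoffel G k i j) y - partialDeriv j (christoffel G k i k) y
    + ∑ l, (christoffel G k k l y * christoffel G l i j y
        - christoffel G k j l y * christoffel G l i k y))

/-- The scalar curvature `gⁱʲ Rᵢⱼ`. -/
def localScalarCurvature {n : ℕ} (G : EuclideanSpace ℝ (Fin n) → Matrix (Fin n) (Fin n) ℝ)
    (y : EuclideanSpace ℝ (Fin n)) : ℝ :=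
  ∑ i, ∑ j, (G y)⁻¹ i j * localRicci G i j y

/-- The Laplacian with the geometers' sign (a nonnegative operator),
`Δ f = - gⁱʲ (∂ᵢ ∂ⱼ f - Γᵏᵢⱼ ∂ₖ f)`. -/
def localLaplacian {n : ℕ} (G : EuclideanSpace ℝ (Fin n) → Matrix (Fin n) (Fin n) ℝ)
    (f : EuclideanSpace ℝ (Fin n) → ℝ) (y : EuclideanSpace ℝ (Fin n)) : ℝ :=
  - ∑ i, ∑ j, (G y)⁻¹ i j *
      (partialDeriv i (partialDeriv j f) y - ∑ k, christoffel G k i j y * partialDeriv k f y)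

end Local

/-! ### Riemannian metrics on an `n`-dimensional manifold without boundary -/

section Manifold

/-- Smooth Riemannian metrics on a manifold `M` modelled on `ℝⁿ`. -/
abbrev RiemMetric (n : ℕ) (M : Type*) [TopologicalSpace M]
    [ChartedSpace (EuclideanSpace ℝ (Fin n)) M] [IsManifold (𝓡 n) ∞ M] :=
  Bundle.ContMDiffRiemannianMetric (𝓡 n) ∞ (EuclideanSpace ℝ (Fin n))
    (fun x : M => TangentSpace (𝓡 n) x)

variable {n : ℕ} {M : Type*} [TopologicalSpace M]
  [ChartedSpace (EuclideanSpace ℝ (Fin n)) M] [IsManifold (𝓡 n) ∞ M]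

/-- The components `g_ij` of the metric in the preferred chart around `p`, as functions on the
target of that chart. -/
def metricCoeff (g : RiemMetric n M) (p : M) (y : EuclideanSpace ℝ (Fin n)) :
    Matrix (Fin n) (Fin n) ℝ :=
  Matrix.of fun i j =>
    g.inner ((extChartAt (𝓡 n) p).symm y)
      (mfderiv (𝓡 n) (𝓡 n) (extChartAt (𝓡 n) p).symm y (EuclideanSpace.single i (1 : ℝ)))
      (mfderiv (𝓡 n) (𝓡 n) (extChartAt (𝓡 n) p).symm y (EuclideanSpace.single j (1 : ℝ)))

/-- The scalar curvature `S_g`, computed at `x` in the preferred chart around `x`. -/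
def scalarCurvature (g : RiemMetric n M) (x : M) : ℝ :=
  localScalarCurvature (metricCoeff g x) (extChartAt (𝓡 n) x x)

/-- The (nonnegative) Laplace-Beltrami operator `Δ_g`, computed at `x` in the preferred chart
around `x`. -/
def laplacian (g : RiemMetric n M) (f : M → ℝ) (x : M) : ℝ :=
  localLaplacian (metricCoeff g x) (f ∘ (extChartAt (𝓡 n) x).symm) (extChartAt (𝓡 n) x x)

/-- The Yamabe operator `L_g = (4 (n - 1) / (n - 2)) Δ_g + S_g`. -/
def yamabeOperator (g : RiemMetric n M) (f : M → ℝ) (x : M) : ℝ :=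
  (4 * ((n : ℝ) - 1) / ((n : ℝ) - 2)) * laplacian g f x + scalarCurvature g x * f x

/-- The Riemannian measure `dv_g`: the least measure which in the domain of every preferred chart
dominates (hence, since charts agree on overlaps, the one which there equals) the measure
`√(det g_ij) dy`. -/
def riemannianMeasure [MeasurableSpace M] (g : RiemMetric n M) : Measure M :=
  ⨆ p : M, ((volume.restrict (extChartAt (𝓡 n) p).target).withDensity
    (fun y => ENNReal.ofReal (Real.sqrt (metricCoeff g p y).det))).map (extChartAt (𝓡 n) p).symm

/-- The total volume `Vol(M, g)`. -/
def vol [MeasurableSpace M] (g : RiemMetric n M) : ℝ :=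
  (riemannianMeasure g univ).toReal

/-- The conformal class `[g]`: the smooth metrics `f g` with `f > 0`. -/
def conformalClass (g : RiemMetric n M) : Set (RiemMetric n M) :=
  {h | ∃ f : M → ℝ, ContMDiff (𝓡 n) 𝓘(ℝ, ℝ) ∞ f ∧ (∀ x, 0 < f x) ∧
    ∀ x, ∀ v w : TangentSpace (𝓡 n) x, h.inner x v w = f x * g.inner x v w}

/-- The `k`-th eigenvalue (`k ≥ 1`, counted with multiplicities, in increasing order) of the Yamabe
operator: the least `t` such that there are `k` linearly independent eigenfunctions belonging to
eigenvalues `≤ t`. -/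
def eigenvalue (k : ℕ) (g : RiemMetric n M) : EReal :=
  sInf {t : EReal | ∃ v : Fin k → M → ℝ, LinearIndependent ℝ v ∧
    ∀ i, ContMDiff (𝓡 n) 𝓘(ℝ, ℝ) ∞ (v i) ∧
      ∃ s : ℝ, (s : EReal) ≤ t ∧ ∀ x, yamabeOperator g (v i) x = s * v i x}

/-- The `k`-th Yamabe invariant
`μ_k(M, g) = inf {λ_k(h) Vol(M, h)^(2/n) | h ∈ [g]}` (it can be `-∞` in general). -/
def yamabeInvariant [MeasurableSpace M] (k : ℕ) (g : RiemMetric n M) : EReal :=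
  ⨅ h ∈ conformalClass g, eigenvalue k h * ((vol h ^ (2 / (n : ℝ)) : ℝ) : EReal)

end Manifold

/-! ### The standard sphere -/

section Sphere

/-- The unit sphere `Sⁿ` of `ℝⁿ⁺¹`. -/
abbrev Sph (n : ℕ) : Type := Metric.sphere (0 : EuclideanSpace ℝ (Fin (n + 1))) 1

/-- The differential at `x` of the inclusion of `Sⁿ` in `ℝⁿ⁺¹`. -/
def dIncl (n : ℕ) (x : Sph n) :
    TangentSpace (𝓡 n) x →L[ℝ] EuclideanSpace ℝ (Fin (n + 1)) :=
  mvfderiv (𝓡 n) (fun z : Sph n => (z : EuclideanSpace ℝ (Fin (n + 1)))) x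

lemma dIncl_injective (n : ℕ) (x : Sph n) : Function.Injective (dIncl n x) := by
  have := Fact.mk (@finrank_euclideanSpace_fin ℝ _ (n + 1))
  exact injective_mvfderiv_subtypeVal_sphere x

/-- The scalar product induced by `ℝⁿ⁺¹` on the tangent space of `Sⁿ` at `x`. -/
def roundInner (n : ℕ) (x : Sph n) :
    TangentSpace (𝓡 n) x →L[ℝ] TangentSpace (𝓡 n) x →L[ℝ] ℝ :=
  let A : EuclideanSpace ℝ (Fin n) →L[ℝ] EuclideanSpace ℝ (Fin (n + 1)) := dIncl n x
  ((innerSL ℝ (E := EuclideanSpace ℝ (Fin (n + 1)))).bilinearComp A A :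
    EuclideanSpace ℝ (Fin n) →L[ℝ] EuclideanSpace ℝ (Fin n) →L[ℝ] ℝ)

lemma roundInner_apply (n : ℕ) (x : Sph n) (v w : TangentSpace (𝓡 n) x) :
    roundInner n x v w = inner ℝ (dIncl n x v) (dIncl n x w) := by
  rfl

lemma roundInner_isVonNBounded (n : ℕ) (x : Sph n) :
    Bornology.IsVonNBounded ℝ {v : TangentSpace (𝓡 n) x | roundInner n x v v < 1} := by
  let A : EuclideanSpace ℝ (Fin n) →L[ℝ] EuclideanSpace ℝ (Fin (n + 1)) := dIncl n x
  change Bornology.IsVonNBounded ℝ {v : EuclideanSpace ℝ (Fin n) | inner ℝ (A v) (A v) < 1}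
  obtain ⟨K, -, hK⟩ := A.toLinearMap.exists_antilipschitzWith
    (LinearMap.ker_eq_bot.2 (dIncl_injective n x))
  rw [NormedSpace.isVonNBounded_iff]
  refine (Metric.isBounded_closedBall (x := (0 : EuclideanSpace ℝ (Fin n))) (r := K)).subset ?_
  intro v hv
  have h1 : ‖A v‖ ≤ 1 := by
    have : ‖A v‖ ^ 2 < 1 := by
      rw [← real_inner_self_eq_norm_sq]; exact hv
    nlinarith [norm_nonneg (A v)]
  have h2 := hK.le_mul_dist v 0
  simp only [dist_zero_right, map_zero] at h2
  rw [mem_closedBall_zero_iff]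
  exact h2.trans (mul_le_of_le_one_right K.2 h1)

lemma roundInner_contMDiff (n : ℕ) :
    ContMDiff (𝓡 n)
      ((𝓡 n).prod 𝓘(ℝ, EuclideanSpace ℝ (Fin n) →L[ℝ] EuclideanSpace ℝ (Fin n) →L[ℝ] ℝ)) ∞
      (fun x : Sph n => Bundle.TotalSpace.mk'
        (EuclideanSpace ℝ (Fin n) →L[ℝ] EuclideanSpace ℝ (Fin n) →L[ℝ] ℝ)
        (E := fun x : Sph n => TangentSpace (𝓡 n) x →L[ℝ] TangentSpace (𝓡 n) x →L[ℝ] ℝ)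
        x (roundInner n x)) := by
  have := Fact.mk (@finrank_euclideanSpace_fin ℝ _ (n + 1))
  intro x₀
  have hι : ContMDiffAt (𝓡 n) 𝓘(ℝ, EuclideanSpace ℝ (Fin (n + 1))) ∞
      (fun z : Sph n => (z : EuclideanSpace ℝ (Fin (n + 1)))) x₀ :=
    contMDiff_coe_sphere x₀
  have hA := hι.mfderiv_const (m := ∞) (by norm_num)
  rw [Bundle.contMDiffAt_section]
  let Φ : Sph n → EuclideanSpace ℝ (Fin n) →L[ℝ] EuclideanSpace ℝ (Fin (n + 1)) :=
    inTangentCoordinates (𝓡 n) 𝓘(ℝ, EuclideanSpace ℝ (Fin (n + 1))) id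
      (fun z : Sph n => (z : EuclideanSpace ℝ (Fin (n + 1))))
      (mfderiv (𝓡 n) 𝓘(ℝ, EuclideanSpace ℝ (Fin (n + 1)))
        (fun z : Sph n => (z : EuclideanSpace ℝ (Fin (n + 1))))) x₀
  let J : EuclideanSpace ℝ (Fin (n + 1)) →L[ℝ] EuclideanSpace ℝ (Fin (n + 1)) →L[ℝ] ℝ :=
    innerSL ℝ (E := EuclideanSpace ℝ (Fin (n + 1)))
  have hB : ContMDiffAt (𝓡 n)
      𝓘(ℝ, EuclideanSpace ℝ (Fin n) →L[ℝ] EuclideanSpace ℝ (Fin n) →L[ℝ] ℝ) ∞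
      (fun x => ((ContinuousLinearMap.compL ℝ (EuclideanSpace ℝ (Fin n))
        (EuclideanSpace ℝ (Fin (n + 1))) ℝ).flip (Φ x)).comp
          (J.comp (Φ x))) x₀ := by
    refine ContMDiffAt.clm_comp ?_ (ContMDiffAt.clm_comp contMDiffAt_const hA)
    exact (ContinuousLinearMap.contMDiff _).contMDiffAt.comp x₀ hA
  have hbase : ∀ᶠ x in 𝓝 x₀, x ∈ (trivializationAt (EuclideanSpace ℝ (Fin n) →L[ℝ] ℝ)
      (fun x : Sph n => TangentSpace (𝓡 n) x →L[ℝ] ℝ) x₀).baseSet :=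
    (trivializationAt (EuclideanSpace ℝ (Fin n) →L[ℝ] ℝ)
      (fun x : Sph n => TangentSpace (𝓡 n) x →L[ℝ] ℝ) x₀).open_baseSet.mem_nhds
        (FiberBundle.mem_baseSet_trivializationAt' x₀)
  refine hB.congr_of_eventuallyEq (hbase.mono fun x hx => ?_)
  ext v w
  simp only [hom_trivializationAt_apply, ContinuousLinearMap.inCoordinates,
    ContinuousLinearMap.comp_apply, Bundle.Trivialization.continuousLinearMapAt_apply]
  rw [Bundle.Trivialization.coe_linearMapAt_of_mem _ hx]
  simp only [hom_trivializationAt_apply, ContinuousLinearMap.inCoordinates,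
    ContinuousLinearMap.comp_apply, Bundle.Trivialization.continuousLinearMapAt_apply]
  simp [Φ, inTangentCoordinates, ContinuousLinearMap.inCoordinates]
  rfl

/-- The standard (round) metric of `Sⁿ`, induced by the Euclidean metric of `ℝⁿ⁺¹`. -/
def roundMetric (n : ℕ) : RiemMetric n (Sph n) where
  inner := roundInner n
  symm x v w := by
    rw [roundInner_apply, roundInner_apply, real_inner_comm]
  pos x v hv := by
    rw [roundInner_apply]
    exact real_inner_self_pos.2 fun h => hv (dIncl_injective n x (h.trans (map_zero _).symm))
  isVonNBounded := roundInner_isVonNBounded n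
  contMDiff := roundInner_contMDiff n

end Sphere

end Yamabe

end

/-! Write V for the volume of the round metric. On the round sphere the Yamabe operator has
eigenvalue n(n-1) on the constants and n(n-1)(n+2)/(n-2) on the n+1 coordinate functions. These n+2
functions are independent, so testing with the round metric alone gives μ_{n+2} ≤ n(n-1)(n+2)/(n-2)
· V^{2/n} (`yamabeInvariant_roundMetric_le`). On the other side μ_1 ≥ n(n-1) V^{2/n}
(`le_yamabeInvariant_one`). What remains is (n+2)/(n-2) < (n+2)^{2/n} for n ≥ 7
(`add_two_div_sub_two_lt_rpow`); at n = 6 its two sides are equal.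

The lower bound for μ_1 is the sharp Sobolev inequality of ℝⁿ in disguise. Let h = F g and L_h v = s
v. In a stereographic chart h = ρ δ, and by conformal covariance (`yamabe_conformal`,
`sum_partialDeriv_flatten`) the function ψ = ρ^{(n-2)/4} v satisfies -∑ ∂ᵢ²ψ = (s/c) ρ ψ with c =
4(n-1)/(n-2). Hence ∫ |∇ψ|² = (s/c) ∫ ρ ψ². Hölder's inequality bounds ∫ ρ ψ² by Vol(h)^{2/n} ‖ψ‖²
in the norm of L^{2n/(n-2)}, while Sobolev bounds ∫ |∇ψ|² below by n(n-2)/4 · V^{2/n} ‖ψ‖².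
Cancelling ‖ψ‖² and using c n(n-2)/4 = n(n-1) gives the bound, for every eigenvalue s
(`le_eigenvalue_mul_vol`).

The Sobolev inequality is proved by mass transport. A triangular map T with increasing diagonal (the
Knothe map, built from one-dimensional distribution functions) carries f^{2n/(n-2)} to a multiple G
of `bubble ^ n`. The arithmetic-geometric inequality for the diagonal derivatives of T, integration
by parts in one variable at a time and Young's inequality give `transport_inequality`; all of them
are equalities for the extremal f = `bubble ^ ((n - 2) / 2)`, where T is the identity, so the
constant is sharp (`sobolev_inequality`). Only the derivatives ∂ₖTₖ ever enter, so T need not be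
differentiable in the other variables. Sign-changing functions follow by regularizing |u|
(`sobolev_inequality_abs`). -/

namespace Yamabe
open Filter

/-! ### One-dimensional tools -/

section OneDim

/-- If T b > 0, then (φ b - φ c) T b = -∫ φ' T b over [b, c], which is at most ∫ |φ' T| because T
only grows. Letting c → ∞ bounds φ b T b by the tail of a convergent integral. -/
lemma tendsto_mul_atTop_zero_of_monotone {φ φ' T : ℝ → ℝ} (hφ : ∀ t, HasDerivAt φ (φ' t) t)
    (hc : Continuous φ') (h0 : ∀ t, 0 ≤ φ t) (hlim : Tendsto φ atTop (𝓝 0)) (hT : Monotone T)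
    (hint : Integrable fun t => φ' t * T t) :
    Tendsto (fun t => φ t * T t) atTop (𝓝 0) := by
  by_cases hpos : ∃ b, 0 < T b
  · obtain ⟨b₀, hb₀⟩ := hpos
    have key : ∀ b, b₀ ≤ b → φ b * T b ≤ ∫ x in Ioi b, ‖φ' x * T x‖ := by
      intro b hb
      have hTb : 0 < T b := hb₀.trans_le (hT hb)
      have h1 : ∀ᶠ c in atTop, φ b * T b ≤ φ c * T b + ∫ x in Ioi b, ‖φ' x * T x‖ := by
        filter_upwards [eventually_ge_atTop b] with c hbc
        have e : ∫ x in b..c, φ' x = φ c - φ b :=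
          intervalIntegral.integral_eq_sub_of_hasDerivAt (fun x _ => hφ x)
            (hc.intervalIntegrable _ _)
        have e2 : ∫ x in b..c, -(φ' x * T b) = (φ b - φ c) * T b := by
          rw [intervalIntegral.integral_neg, intervalIntegral.integral_mul_const, e]; ring
        have e3 : ∫ x in b..c, -(φ' x * T b) ≤ ∫ x in b..c, ‖φ' x * T x‖ := by
          refine intervalIntegral.integral_mono_on hbc
            ((hc.mul continuous_const).neg.intervalIntegrable _ _)
            hint.norm.intervalIntegrable fun x hx => ?_
          have : T b ≤ T x := hT hx.1
          rw [Real.norm_eq_abs, abs_mul, abs_of_pos (hTb.trans_le this)]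
          have h2 := neg_abs_le (φ' x)
          have h3 := abs_nonneg (φ' x)
          nlinarith
        have e4 : ∫ x in b..c, ‖φ' x * T x‖ ≤ ∫ x in Ioi b, ‖φ' x * T x‖ := by
          rw [intervalIntegral.integral_of_le hbc]
          exact setIntegral_mono_set hint.norm.integrableOn
            (Eventually.of_forall fun x => norm_nonneg _) Ioc_subset_Ioi_self.eventuallyLE
        nlinarith
      have h2 : Tendsto (fun c => φ c * T b + ∫ x in Ioi b, ‖φ' x * T x‖) atTop
          (𝓝 (0 * T b + ∫ x in Ioi b, ‖φ' x * T x‖)) :=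
        (hlim.mul_const _).add_const _
      simpa using ge_of_tendsto h2 h1
    refine squeeze_zero' ?_ ?_ (tendsto_integral_Ioi_zero (μ := volume)
      (f := fun x => ‖φ' x * T x‖) (b := fun x : ℝ => x)
      tendsto_id)
    · filter_upwards [eventually_ge_atTop b₀] with b hb
      exact mul_nonneg (h0 b) (hb₀.le.trans (hT hb))
    · filter_upwards [eventually_ge_atTop b₀] with b hb using key b hb
  -- Here T ≤ 0 everywhere, so monotonicity bounds |T| by |T 0| on the positive half-line.
  · push Not at hpos
    have h1 : Tendsto (fun t => φ t * |T 0|) atTop (𝓝 0) := by simpa using hlim.mul_const |T 0|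
    refine squeeze_zero_norm' ?_ h1
    filter_upwards [eventually_ge_atTop 0] with t ht
    rw [norm_mul, Real.norm_eq_abs, Real.norm_eq_abs, abs_of_nonneg (h0 t)]
    refine mul_le_mul_of_nonneg_left ?_ (h0 t)
    rw [abs_of_nonpos (hpos t), abs_of_nonpos (hpos 0)]
    linarith [hT ht]

/-- Integration by parts against a monotone function: the boundary terms vanish automatically. -/
lemma integral_mul_deriv_of_monotone {φ φ' T T' : ℝ → ℝ} (hφ : ∀ t, HasDerivAt φ (φ' t) t)
    (hc : Continuous φ') (h0 : ∀ t, 0 ≤ φ t) (htop : Tendsto φ atTop (𝓝 0))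
    (hbot : Tendsto φ atBot (𝓝 0)) (hT : ∀ t, HasDerivAt T (T' t) t) (hT' : ∀ t, 0 ≤ T' t)
    (hint : Integrable fun t => φ' t * T t) :
    Integrable (fun t => φ t * T' t) ∧ ∫ t, φ t * T' t = -∫ t, φ' t * T t := by
  have hmono : Monotone T := monotone_of_hasDerivAt_nonneg hT hT'
  have l1 := tendsto_mul_atTop_zero_of_monotone hφ hc h0 htop hmono hint
  -- The limit at -∞ is the limit at +∞ for the reflected pair φ(-t), -T(-t), the latter again
  -- increasing.
  have l2 : Tendsto (fun t => φ t * T t) atBot (𝓝 0) := by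
    have := tendsto_mul_atTop_zero_of_monotone (φ := fun t => φ (-t)) (φ' := fun t => -φ' (-t))
      (T := fun t => -T (-t)) (fun t => by simpa [Function.comp_def] using (hφ (-t)).scomp t (hasDerivAt_neg t))
      (by fun_prop) (fun t => h0 _) (hbot.comp tendsto_neg_atTop_atBot)
      (fun s t hst => by simpa using hmono (neg_le_neg hst)) (by simpa using hint.comp_neg)
    have h2 := (this.comp tendsto_neg_atBot_atTop).neg
    simpa [Function.comp_def] using h2
  have hTint : ∀ a b, IntervalIntegrable T' volume a b := fun a b => by
    refine intervalIntegral.intervalIntegrable_deriv_of_nonneg (g := T)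
      (fun x _ => (hT x).continuousAt.continuousWithinAt) (fun x _ => hT x) (fun x _ => hT' x)
  have hφc : Continuous φ := continuous_iff_continuousAt.2 fun t => (hφ t).continuousAt
  have hi : ∀ a b, IntervalIntegrable (fun t => φ t * T' t) volume a b := fun a b =>
    (hTint a b).continuousOn_mul hφc.continuousOn
  have hI : ∀ i : ℕ, ∫ t in (-(i : ℝ))..i, φ t * T' t =
      (φ i * T i - φ (-i) * T (-i)) - ∫ t in (-(i : ℝ))..i, φ' t * T t := by
    intro i
    rw [← intervalIntegral.integral_eq_sub_of_hasDerivAt (f := fun t => φ t * T t)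
      (f' := fun t => φ' t * T t + φ t * T' t) (fun x _ => (hφ x).mul (hT x))
      (hint.intervalIntegrable.add (hi _ _)),
      intervalIntegral.integral_add hint.intervalIntegrable (hi _ _)]
    ring
  have hn : Tendsto (fun i : ℕ => (i : ℝ)) atTop atTop := tendsto_natCast_atTop_atTop
  have hn' : Tendsto (fun i : ℕ => -(i : ℝ)) atTop atBot := tendsto_neg_atTop_atBot.comp hn
  have hlim : Tendsto (fun i : ℕ => ∫ t in (-(i : ℝ))..i, φ t * T' t) atTop
      (𝓝 (-∫ t, φ' t * T t)) := by
    simp_rw [hI]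
    have := ((l1.comp hn).sub (l2.comp hn')).sub
      (intervalIntegral_tendsto_integral hint hn' hn)
    simpa using this
  have hnn : ∀ t, ‖φ t * T' t‖ = φ t * T' t := fun t =>
    Real.norm_of_nonneg (mul_nonneg (h0 t) (hT' t))
  -- Since φ T' ≥ 0, convergence of its integrals over [-i, i] already gives integrability.
  have hInt : Integrable (fun t => φ t * T' t) := by
    refine integrable_of_intervalIntegral_norm_tendsto (a := fun i : ℕ => -(i : ℝ))
      (b := fun i : ℕ => (i : ℝ)) (l := atTop) (-∫ t, φ' t * T t) (fun i => ?_) hn' hn ?_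
    · exact (intervalIntegrable_iff_integrableOn_Ioc_of_le (by linarith [i.cast_nonneg (α := ℝ)])).1
        (hi _ _)
    · simpa only [hnn] using hlim
  exact ⟨hInt, tendsto_nhds_unique (intervalIntegral_tendsto_integral hInt hn' hn) hlim⟩

/-- The normalized distribution function of a density. -/
noncomputable def distr (f : ℝ → ℝ) (t : ℝ) : ℝ := (∫ u in Iic t, f u) / ∫ u, f u

variable {f : ℝ → ℝ}

lemma integral_pos_of_pos {α : Type*} [TopologicalSpace α] [MeasurableSpace α] [Nonempty α]
    {μ : Measure α} [μ.IsOpenPosMeasure] {f : α → ℝ}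
    (hpos : ∀ t, 0 < f t) (hi : Integrable f μ) : 0 < ∫ t, f t ∂μ := by
  rw [integral_pos_iff_support_of_nonneg (fun t => (hpos t).le) hi]
  have : Function.support f = univ := by ext t; simp [(hpos t).ne']
  rw [this]
  exact isOpen_univ.measure_pos μ univ_nonempty

/-- Strict differentiability is the form required by the inverse function theorem in
`hasDerivAt_monoTransport`. -/
lemma hasStrictDerivAt_distr (hc : Continuous f) (hi : Integrable f) (t : ℝ) :
    HasStrictDerivAt (distr f) (f t / ∫ u, f u) t := by
  have h1 : HasStrictDerivAt (fun s => ∫ u in (0 : ℝ)..s, f u) (f t) t :=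
    intervalIntegral.integral_hasStrictDerivAt_right hi.intervalIntegrable
      hc.aestronglyMeasurable.stronglyMeasurableAtFilter hc.continuousAt
  have h2 : distr f = fun s => ((∫ u in (0 : ℝ)..s, f u) + ∫ u in Iic 0, f u) / ∫ u, f u := by
    ext s
    rw [distr, ← intervalIntegral.integral_Iic_sub_Iic hi.integrableOn hi.integrableOn]
    ring
  rw [h2]
  exact (h1.add_const _).div_const _

lemma strictMono_distr (hc : Continuous f) (hpos : ∀ t, 0 < f t) (hi : Integrable f) :
    StrictMono (distr f) := by
  refine strictMono_of_hasDerivAt_pos (fun t => (hasStrictDerivAt_distr hc hi t).hasDerivAt)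
    fun t => div_pos (hpos t) (integral_pos_of_pos hpos hi)

lemma distr_surj (hc : Continuous f) (hpos : ∀ t, 0 < f t) (hi : Integrable f) :
    range (distr f) = Ioo 0 1 := by
  have hI := integral_pos_of_pos hpos hi
  have hm := strictMono_distr hc hpos hi
  have l1 : Tendsto (distr f) atTop (𝓝 1) := by
    have := (aecover_Iic (μ := volume) (b := fun t : ℝ => t) tendsto_id).integral_tendsto_of_countably_generated hi
    have := this.div_const (∫ u, f u)
    rwa [div_self hI.ne'] at this
  have l2 : Tendsto (distr f) atBot (𝓝 0) := by
    have := (tendsto_integral_Iic_zero (f := f) (μ := volume) (a := fun t : ℝ => t) tendsto_id)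
    have := this.div_const (∫ u, f u)
    rwa [zero_div] at this
  have hcont : Continuous (distr f) := continuous_iff_continuousAt.2 fun t =>
    (hasStrictDerivAt_distr hc hi t).hasDerivAt.continuousAt
  ext s
  constructor
  · rintro ⟨t, rfl⟩
    exact ⟨(hm.monotone.le_of_tendsto l2 (t - 1)).trans_lt (hm (by linarith)),
      (hm (by linarith : t < t + 1)).trans_le (hm.monotone.ge_of_tendsto l1 (t + 1))⟩
  · rintro ⟨h0, h1⟩
    obtain ⟨a, ha⟩ := (l2.eventually_lt_const h0).exists
    obtain ⟨b, hb⟩ := (l1.eventually_const_lt h1).exists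
    exact mem_range_of_exists_le_of_exists_ge hcont ⟨a, ha.le⟩ ⟨b, hb.le⟩

/-- The increasing map which transports the density `f` to the density `g`. -/
noncomputable def monoTransport (f g : ℝ → ℝ) (t : ℝ) : ℝ := Function.invFun (distr g) (distr f t)

variable {g : ℝ → ℝ}

lemma distr_monoTransport (hfc : Continuous f) (hf : ∀ t, 0 < f t) (hfi : Integrable f)
    (hgc : Continuous g) (hg : ∀ t, 0 < g t) (hgi : Integrable g) (t : ℝ) :
    distr g (monoTransport f g t) = distr f t := by
  refine Function.invFun_eq ?_
  have : distr f t ∈ range (distr g) := by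
    rw [distr_surj hgc hg hgi, ← distr_surj hfc hf hfi]; exact mem_range_self t
  exact this

lemma surjective_monoTransport (hfc : Continuous f) (hf : ∀ t, 0 < f t) (hfi : Integrable f)
    (hgc : Continuous g) (hg : ∀ t, 0 < g t) (hgi : Integrable g) :
    Function.Surjective (monoTransport f g) := by
  intro s
  have : distr g s ∈ range (distr f) := by
    rw [distr_surj hfc hf hfi, ← distr_surj hgc hg hgi]; exact mem_range_self s
  obtain ⟨t, ht⟩ := this
  refine ⟨t, (strictMono_distr hgc hg hgi).injective ?_⟩
  rw [distr_monoTransport hfc hf hfi hgc hg hgi, ht]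

lemma strictMono_monoTransport (hfc : Continuous f) (hf : ∀ t, 0 < f t) (hfi : Integrable f)
    (hgc : Continuous g) (hg : ∀ t, 0 < g t) (hgi : Integrable g) :
    StrictMono (monoTransport f g) := by
  intro s t hst
  rw [← (strictMono_distr hgc hg hgi).lt_iff_lt, distr_monoTransport hfc hf hfi hgc hg hgi,
    distr_monoTransport hfc hf hfi hgc hg hgi]
  exact strictMono_distr hfc hf hfi hst

/-- Differentiate `distr g ∘ T = distr f`. The inverse function theorem provides a local inverse of
`distr g`; it coincides with the globally defined one because T, monotone and onto, is continuous.
-/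
lemma hasDerivAt_monoTransport (hfc : Continuous f) (hf : ∀ t, 0 < f t) (hfi : Integrable f)
    (hgc : Continuous g) (hg : ∀ t, 0 < g t) (hgi : Integrable g) (t : ℝ) :
    HasDerivAt (monoTransport f g)
      ((f t / ∫ u, f u) / (g (monoTransport f g t) / ∫ u, g u)) t := by
  have hcont : Continuous (monoTransport f g) :=
    (strictMono_monoTransport hfc hf hfi hgc hg hgi).monotone.continuous_of_surjective
      (surjective_monoTransport hfc hf hfi hgc hg hgi)
  have hne : g (monoTransport f g t) / ∫ u, g u ≠ 0 :=
    (div_pos (hg _) (integral_pos_of_pos hg hgi)).ne'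
  have hG := hasStrictDerivAt_distr hgc hgi (monoTransport f g t)
  have h1 := (hG.to_localInverse hne).hasDerivAt
  rw [distr_monoTransport hfc hf hfi hgc hg hgi] at h1
  have h2 := h1.comp t (hasStrictDerivAt_distr hfc hfi t).hasDerivAt
  have h3 := (hG.hasStrictFDerivAt_equiv hne).eventually_left_inverse
  have h4 := hcont.continuousAt.eventually h3
  rw [inv_mul_eq_div] at h2
  refine h2.congr_of_eventuallyEq (h4.mono fun s hs => ?_)
  rw [distr_monoTransport hfc hf hfi hgc hg hgi] at hs
  exact hs.symm

/-- The substitution s = T t. As T is injective and differentiable, no measurability of `h` is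
needed. -/
lemma lintegral_monoTransport (hfc : Continuous f) (hf : ∀ t, 0 < f t) (hfi : Integrable f)
    (hgc : Continuous g) (hg : ∀ t, 0 < g t) (hgi : Integrable g) (h : ℝ → ENNReal) :
    ∫⁻ t, h (monoTransport f g t) * ENNReal.ofReal (f t / ∫ u, f u) =
      ∫⁻ s, h s * ENNReal.ofReal (g s / ∫ u, g u) := by
  have hm := strictMono_monoTransport hfc hf hfi hgc hg hgi
  have hs := surjective_monoTransport hfc hf hfi hgc hg hgi
  have := lintegral_image_eq_lintegral_abs_deriv_mul (s := univ) MeasurableSet.univ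
    (fun t _ => (hasDerivAt_monoTransport hfc hf hfi hgc hg hgi t).hasDerivWithinAt)
    hm.injective.injOn (fun s => h s * ENNReal.ofReal (g s / ∫ u, g u))
  rw [image_univ, hs.range_eq] at this
  simp only [Measure.restrict_univ] at this
  rw [this]
  refine lintegral_congr fun t => ?_
  have h1 := div_pos (hg (monoTransport f g t)) (integral_pos_of_pos hg hgi)
  have h2 := div_pos (hf t) (integral_pos_of_pos hf hfi)
  rw [abs_of_pos (div_pos h2 h1), mul_left_comm, ← ENNReal.ofReal_mul (div_pos h2 h1).le,
    div_mul_cancel₀ _ h1.ne']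

end OneDim

/-! ### The Knothe map -/

section Knothe

/-- Positive continuous densities dominated by a product of Cauchy densities. -/
structure IsTameDensity {n : ℕ} (F : (Fin n → ℝ) → ℝ) : Prop where
  continuous : Continuous F
  pos : ∀ y, 0 < F y
  bound : ∃ C, ∀ y, F y ≤ C * ∏ i, (1 + y i ^ 2)⁻¹

lemma measurePreserving_cons (n : ℕ) :
    MeasurePreserving (fun p : ℝ × (Fin n → ℝ) => (Fin.cons p.1 p.2 : Fin (n + 1) → ℝ)) := by
  have := (volume_preserving_piFinSuccAbove (fun _ : Fin (n + 1) => ℝ) 0).symm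
  convert this using 1
  funext p
  exact (Fin.insertNth_zero' (β := ℝ) p.1 p.2).symm

lemma measurableEmbedding_cons (n : ℕ) :
    MeasurableEmbedding (fun p : ℝ × (Fin n → ℝ) => (Fin.cons p.1 p.2 : Fin (n + 1) → ℝ)) := by
  have := (MeasurableEquiv.piFinSuccAbove (fun _ : Fin (n + 1) => ℝ) 0).symm.measurableEmbedding
  convert this using 1
  funext p
  exact (Fin.insertNth_zero' (β := ℝ) p.1 p.2).symm

lemma lintegral_cons {n : ℕ} {h : (Fin (n + 1) → ℝ) → ENNReal} (hh : Measurable h) :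
    ∫⁻ y, h y = ∫⁻ y : Fin n → ℝ, ∫⁻ t : ℝ, h (Fin.cons t y) := by
  rw [← (measurePreserving_cons n).lintegral_comp_emb (measurableEmbedding_cons n),
    Measure.volume_eq_prod, lintegral_prod_symm]
  exact (hh.comp (measurableEmbedding_cons n).measurable).aemeasurable

namespace IsTameDensity

variable {n : ℕ}

lemma const_nonneg {F : (Fin n → ℝ) → ℝ} (hF : IsTameDensity F) :
    ∃ C, 0 ≤ C ∧ ∀ y, F y ≤ C * ∏ i, (1 + y i ^ 2)⁻¹ := by
  obtain ⟨C, hC⟩ := hF.bound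
  refine ⟨C, ?_, hC⟩
  have := (hF.pos 0).trans_le (hC 0)
  simpa using this.le

lemma integrable {F : (Fin n → ℝ) → ℝ} (hF : IsTameDensity F) : Integrable F := by
  obtain ⟨C, hC⟩ := hF.bound
  have : Integrable fun y : Fin n → ℝ => C * ∏ i, (1 + y i ^ 2)⁻¹ :=
    (Integrable.fintype_prod (f := fun (_ : Fin n) (t : ℝ) => (1 + t ^ 2)⁻¹)
      fun _ => integrable_inv_one_add_sq).const_mul C
  exact this.mono' hF.continuous.aestronglyMeasurable
    (Eventually.of_forall fun y => by rw [Real.norm_of_nonneg (hF.pos y).le]; exact hC y)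

variable {F : (Fin (n + 1) → ℝ) → ℝ}

lemma slice_continuous (hF : IsTameDensity F) (y : Fin n → ℝ) :
    Continuous fun t : ℝ => F (Fin.cons t y) :=
  hF.continuous.comp (by fun_prop)

lemma slice_bound (hF : IsTameDensity F) : ∃ C, 0 ≤ C ∧ ∀ (y : Fin n → ℝ) (t : ℝ),
    F (Fin.cons t y) ≤ C * (∏ i, (1 + y i ^ 2)⁻¹) * (1 + t ^ 2)⁻¹ := by
  obtain ⟨C, hC0, hC⟩ := hF.const_nonneg
  refine ⟨C, hC0, fun y t => (hC _).trans_eq ?_⟩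
  rw [Fin.prod_univ_succ]
  simp only [Fin.cons_zero, Fin.cons_succ]
  ring

lemma slice_integrable (hF : IsTameDensity F) (y : Fin n → ℝ) :
    Integrable fun t : ℝ => F (Fin.cons t y) := by
  obtain ⟨C, -, hC⟩ := hF.slice_bound
  exact (integrable_inv_one_add_sq.const_mul _).mono' (hF.slice_continuous y).aestronglyMeasurable
    (Eventually.of_forall fun t => by rw [Real.norm_of_nonneg (hF.pos _).le]; exact hC y t)

/-- This stability drives the induction on the dimension: integrating out one Cauchy factor costs
the factor π. -/
lemma marginal (hF : IsTameDensity F) : IsTameDensity fun y => ∫ t : ℝ, F (Fin.cons t y) := by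
  obtain ⟨C, hC0, hC⟩ := hF.slice_bound
  refine ⟨?_, fun y => integral_pos_of_pos (fun t => hF.pos _) (hF.slice_integrable y),
    C * Real.pi, fun y => ?_⟩
  · refine continuous_of_dominated (bound := fun t => C * (1 + t ^ 2)⁻¹)
      (fun y => (hF.slice_continuous y).aestronglyMeasurable)
      (fun y => Eventually.of_forall fun t => ?_) (integrable_inv_one_add_sq.const_mul _)
      (Eventually.of_forall fun t => hF.continuous.comp (by fun_prop))
    rw [Real.norm_of_nonneg (hF.pos _).le]
    refine (hC y t).trans (mul_le_mul_of_nonneg_right ?_ (by positivity))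
    refine mul_le_of_le_one_right hC0 (Finset.prod_le_one (fun i _ => by positivity) fun i _ => ?_)
    exact inv_le_one_of_one_le₀ (by nlinarith [sq_nonneg (y i)])
  · refine (integral_mono (hF.slice_integrable y) (integrable_inv_one_add_sq.const_mul _)
      (hC y)).trans_eq ?_
    rw [integral_const_mul, integral_univ_inv_one_add_sq]
    ring

lemma integral_marginal (hF : IsTameDensity F) :
    ∫ y : Fin n → ℝ, ∫ t : ℝ, F (Fin.cons t y) = ∫ y, F y := by
  have hi : Integrable (fun p : ℝ × (Fin n → ℝ) => F (Fin.cons p.1 p.2)) :=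
    ((measurePreserving_cons n).integrable_comp_emb (measurableEmbedding_cons n)).2 hF.integrable
  rw [← (measurePreserving_cons n).integral_comp (measurableEmbedding_cons n)]
  exact (integral_prod_symm _ hi).symm

/-- Joint measurability in the endpoint and the parameter is obtained by writing the integral over a
half-line as the integral of an indicator function. -/
lemma measurable_distr (hF : IsTameDensity F) :
    Measurable fun p : ℝ × (Fin n → ℝ) => distr (fun t => F (Fin.cons t p.2)) p.1 := by
  refine Measurable.div ?_ (hF.marginal.continuous.measurable.comp measurable_snd)
  have : ∀ p : ℝ × (Fin n → ℝ), ∫ t in Iic p.1, F (Fin.cons t p.2) =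
      ∫ t, {q : (ℝ × (Fin n → ℝ)) × ℝ | q.2 ≤ q.1.1}.indicator
        (fun q => F (Fin.cons q.2 q.1.2)) (p, t) := by
    intro p
    rw [← integral_indicator measurableSet_Iic]
    rfl
  simp_rw [this]
  refine (StronglyMeasurable.integral_prod_right ?_).measurable
  refine StronglyMeasurable.indicator ?_
    (measurableSet_le measurable_snd measurable_fst.fst)
  exact (hF.continuous.comp (by fun_prop)).stronglyMeasurable

end IsTameDensity

/-- The triangular (Knothe) map between two densities of equal mass: its `k`-th component is
increasing in the `k`-th variable, with derivative `J · k`. -/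
structure IsKnotheMap {n : ℕ} (F G : (Fin n → ℝ) → ℝ) (T J : (Fin n → ℝ) → Fin n → ℝ) : Prop where
  measurable : Measurable T
  measurable_deriv : Measurable J
  hasDerivAt : ∀ y k, HasDerivAt (fun t => T (Function.update y k t) k) (J y k) (y k)
  deriv_pos : ∀ y k, 0 < J y k
  eq_mul : ∀ y, F y = G (T y) * ∏ k, J y k
  lintegral : ∀ h : (Fin n → ℝ) → ENNReal, Measurable h →
    ∫⁻ y, h (T y) * ENNReal.ofReal (F y) = ∫⁻ z, h z * ENNReal.ofReal (G z)

/-- Induction on the dimension. The marginals in the last n variables have equal mass and are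
matched by some T; then the line over y is mapped to the line over T y by the increasing transport
of the normalized slices. In dimension 0 equal integrals mean equal functions. -/
theorem exists_isKnotheMap : ∀ {n : ℕ} {F G : (Fin n → ℝ) → ℝ}, IsTameDensity F →
    IsTameDensity G → ∫ y, F y = ∫ y, G y → ∃ T J, IsKnotheMap F G T J
  | 0, F, G, hF, hG, h => by
    have hFG : F = G := by
      ext y
      have e : ∀ H : (Fin 0 → ℝ) → ℝ, ∫ y, H y = H y := fun H => by
        rw [volume_pi, Measure.pi_of_empty _ y, integral_dirac]
      rwa [e, e] at h
    subst hFG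
    exact ⟨id, fun _ _ => 1, measurable_id, measurable_const, fun y k => k.elim0,
      fun y k => k.elim0, fun y => by simp, fun h _ => rfl⟩
  | n + 1, F, G, hF, hG, h => by
    rw [← hF.integral_marginal, ← hG.integral_marginal] at h
    obtain ⟨T, J, hTJ⟩ := exists_isKnotheMap hF.marginal hG.marginal h
    let f : (Fin n → ℝ) → ℝ → ℝ := fun y t => F (Fin.cons t y)
    let g : (Fin n → ℝ) → ℝ → ℝ := fun y t => G (Fin.cons t y)
    have fc := hF.slice_continuous
    have gc := hG.slice_continuous
    have fp : ∀ y t, 0 < f y t := fun y t => hF.pos _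
    have gp : ∀ y t, 0 < g y t := fun y t => hG.pos _
    have fi := hF.slice_integrable
    have gi := hG.slice_integrable
    -- The slices over y and over T y may have different masses; the transport compares their
    -- normalized distribution functions.
    let σ : ℝ × (Fin n → ℝ) → ℝ := fun p => monoTransport (f p.2) (g (T p.2)) p.1
    have hσ : Measurable σ := by
      refine measurable_of_Iic fun s => ?_
      -- Measurability in the parameter does not pass through the inverse function: the sublevel
      -- sets of σ are described by distribution functions alone.
      have : σ ⁻¹' Iic s = {p | distr (f p.2) p.1 ≤ distr (g (T p.2)) s} := by
        ext p
        rw [mem_preimage, mem_Iic, mem_ofPred_eq,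
          ← distr_monoTransport (fc p.2) (fp p.2) (fi p.2) (gc (T p.2)) (gp _) (gi _),
          (strictMono_distr (gc (T p.2)) (gp _) (gi _)).le_iff_le]
      rw [this]
      refine measurableSet_le hF.measurable_distr ?_
      exact hG.measurable_distr.comp
        (measurable_const.prodMk (hTJ.measurable.comp measurable_snd))
    have hdec : Measurable fun y : Fin (n + 1) → ℝ => (y 0, Fin.tail y) :=
      (measurable_pi_apply 0).prodMk (measurable_pi_lambda _ fun i => measurable_pi_apply _)
    have hcons : ∀ y : Fin (n + 1) → ℝ, F y = f (Fin.tail y) (y 0) := fun y => by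
      simp only [f, Fin.cons_self_tail]
    have hmF : Measurable fun y : Fin n → ℝ => ∫ t, f y t := hF.marginal.continuous.measurable
    have hmG : Measurable fun y : Fin n → ℝ => ∫ t, g y t := hG.marginal.continuous.measurable
    have Fpos : ∀ y, 0 < ∫ t, f y t := hF.marginal.pos
    have Gpos : ∀ y, 0 < ∫ t, g y t := hG.marginal.pos
    let S : (Fin (n + 1) → ℝ) → Fin (n + 1) → ℝ := fun y =>
      Fin.cons (σ (y 0, Fin.tail y)) (T (Fin.tail y))
    have htail : Measurable fun y : Fin (n + 1) → ℝ => (Fin.tail y : Fin n → ℝ) := hdec.snd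
    have hS : Measurable S := by
      refine measurable_pi_lambda _ fun k => ?_
      refine Fin.cases ?_ (fun k => ?_) k
      · exact hσ.comp hdec
      · exact (measurable_pi_apply k).comp (hTJ.measurable.comp htail)
    refine ⟨S, fun y => Fin.cons ((F y / ∫ t, f (Fin.tail y) t) /
        (G (S y) / ∫ t, g (T (Fin.tail y)) t)) (J (Fin.tail y)), hS, ?_, ?_, ?_, ?_, ?_⟩
    · refine measurable_pi_lambda _ fun k => ?_
      refine Fin.cases ?_ (fun k => ?_) k
      · exact (hF.continuous.measurable.div (hmF.comp htail)).div
          ((hG.continuous.measurable.comp hS).div (hmG.comp (hTJ.measurable.comp htail)))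
      · exact (measurable_pi_apply k).comp (hTJ.measurable_deriv.comp htail)
    · intro y k
      refine Fin.cases ?_ (fun k => ?_) k
      · simp only [S, Fin.cons_zero, Fin.tail_update_zero, Function.update_self]
        rw [hcons]
        exact hasDerivAt_monoTransport (fc _) (fp _) (fi _) (gc (T (Fin.tail y))) (gp _) (gi _) _
      · simp only [S, Fin.cons_succ, Fin.tail_update_succ]
        exact hTJ.hasDerivAt (Fin.tail y) k
    · intro y k
      refine Fin.cases ?_ (fun k => ?_) k
      · exact div_pos (div_pos (hF.pos _) (Fpos _)) (div_pos (hG.pos _) (Gpos _))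
      · exact hTJ.deriv_pos _ k
    · intro y
      rw [Fin.prod_univ_succ]
      simp only [Fin.cons_zero, Fin.cons_succ]
      have e := hTJ.eq_mul (Fin.tail y)
      change ∫ t, f (Fin.tail y) t = (∫ t, g (T (Fin.tail y)) t) * _ at e
      have h1 := (Fpos (Fin.tail y)).ne'
      have h2 := (Gpos (T (Fin.tail y))).ne'
      have h3 := (hG.pos (S y)).ne'
      have h4 : ∏ k, J (Fin.tail y) k =
        (∫ t, f (Fin.tail y) t) / (∫ t, g (T (Fin.tail y)) t) := by
        rw [e]; field_simp
      rw [h4]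
      field_simp
    · intro h hh
      have m1 : Measurable fun y => h (S y) * ENNReal.ofReal (F y) :=
        (hh.comp hS).mul hF.continuous.measurable.ennreal_ofReal
      have m2 : Measurable fun y => h y * ENNReal.ofReal (G y) :=
        hh.mul hG.continuous.measurable.ennreal_ofReal
      rw [lintegral_cons m1,
        lintegral_cons m2]
      -- The mean of h over the line above z for the normalized slice of G. The first variable
      -- contributes exactly this mean on both sides, which reduces the claim to the transport of
      -- the marginals.
      let K : (Fin n → ℝ) → ENNReal := fun z =>
        ∫⁻ s, h (Fin.cons s z) * ENNReal.ofReal (g z s / ∫ t, g z t)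
      have hK : Measurable K := by
        refine Measurable.lintegral_prod_right'
          (f := fun q : (Fin n → ℝ) × ℝ => h (Fin.cons q.2 q.1) *
            ENNReal.ofReal (g q.1 q.2 / ∫ t, g q.1 t)) ?_
        have hc : Measurable fun q : (Fin n → ℝ) × ℝ => (Fin.cons q.2 q.1 : Fin (n + 1) → ℝ) :=
          (measurableEmbedding_cons n).measurable.comp measurable_swap
        exact (hh.comp hc).mul (((hG.continuous.measurable.comp hc).div
          (hmG.comp measurable_fst)).ennreal_ofReal)
      have hL : ∀ y : Fin n → ℝ, ∫⁻ t : ℝ, h (S (Fin.cons t y)) *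
          ENNReal.ofReal (F (Fin.cons t y)) = K (T y) * ENNReal.ofReal (∫ t, f y t) := by
        intro y
        have h1 := lintegral_monoTransport (fc y) (fp y) (fi y) (gc (T y)) (gp _) (gi _)
          (fun s => h (Fin.cons s (T y)))
        simp only [K]
        rw [← h1, ← lintegral_mul_const' _ _ ENNReal.ofReal_ne_top]
        refine lintegral_congr fun t => ?_
        rw [mul_assoc, ← ENNReal.ofReal_mul (div_pos (hF.pos _) (Fpos y)).le,
          div_mul_cancel₀ _ (Fpos y).ne']
        rfl
      have hR : ∀ z : Fin n → ℝ, ∫⁻ t : ℝ, h (Fin.cons t z) *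
          ENNReal.ofReal (G (Fin.cons t z)) = K z * ENNReal.ofReal (∫ t, g z t) := by
        intro z
        simp only [K]
        rw [← lintegral_mul_const' _ _ ENNReal.ofReal_ne_top]
        refine lintegral_congr fun t => ?_
        rw [mul_assoc, ← ENNReal.ofReal_mul (div_pos (gp z t) (Gpos z)).le,
          div_mul_cancel₀ _ (Gpos z).ne']
      simp_rw [hL, hR]
      exact hTJ.lintegral K hK

end Knothe

/-! ### The transport inequality -/

section Transport

/-- Fubini along the k-th axis, with `integral_mul_deriv_of_monotone` on almost every line. In the
other variables only measurability of J and integrability of φ' T are used, which is all that a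
Knothe map offers. -/
lemma integral_mul_deriv_pi {n : ℕ} (k : Fin n) {φ φ' T J : (Fin n → ℝ) → ℝ}
    (hφc : Continuous φ) (hφ'c : Continuous φ')
    (hφ : ∀ y, HasDerivAt (fun t => φ (Function.update y k t)) (φ' y) (y k))
    (h0 : ∀ y, 0 ≤ φ y) (hlim : ∀ y, Tendsto (fun t => φ (Function.update y k t)) (cocompact ℝ) (𝓝 0))
    (hJ : Measurable J)
    (hT : ∀ y, HasDerivAt (fun t => T (Function.update y k t)) (J y) (y k)) (hJ0 : ∀ y, 0 ≤ J y)
    (hint : Integrable fun y => φ' y * T y) :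
    Integrable (fun y => φ y * J y) ∧ ∫ y, φ y * J y = -∫ y, φ' y * T y := by
  obtain _ | n := n
  · exact k.elim0
  let e := MeasurableEquiv.piFinSuccAbove (fun _ : Fin (n + 1) => ℝ) k
  have he : MeasurePreserving e.symm := (volume_preserving_piFinSuccAbove (fun _ => ℝ) k).symm
  have hes : ∀ t y, e.symm (t, y) = k.insertNth (α := fun _ => ℝ) t y := fun t y => rfl
  have hsl : ∀ (H : (Fin (n + 1) → ℝ) → ℝ) (y : Fin n → ℝ) (s : ℝ),
      (fun t => H (Function.update (e.symm (s, y)) k t)) = fun t => H (e.symm (t, y)) := by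
    intro H y s
    ext t
    rw [hes, hes, Fin.update_insertNth]
  have hk : ∀ t y, e.symm (t, y) k = t := fun t y => by simp [hes]
  have hci : ∀ y, Continuous fun t => e.symm (t, y) := fun y => by
    simp_rw [hes]; fun_prop
  have hint' : Integrable fun p : ℝ × (Fin n → ℝ) => φ' (e.symm p) * T (e.symm p) :=
    (he.integrable_comp_emb e.symm.measurableEmbedding).2 hint
  have hfib := hint'.prod_left_ae
  have hloc : ∀ᵐ y : Fin n → ℝ, Integrable (fun t => φ (e.symm (t, y)) * J (e.symm (t, y))) ∧
      ∫ t, φ (e.symm (t, y)) * J (e.symm (t, y)) =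
        -∫ t, φ' (e.symm (t, y)) * T (e.symm (t, y)) := by
    filter_upwards [hfib] with y hy
    have hl : Tendsto (fun t => φ (e.symm (t, y))) (cocompact ℝ) (𝓝 0) := by
      have := hlim (e.symm (0, y)); rwa [hsl] at this
    refine integral_mul_deriv_of_monotone (fun t => ?_) (hφ'c.comp (hci y)) (fun t => h0 _)
      (hl.mono_left atTop_le_cocompact) (hl.mono_left atBot_le_cocompact) (fun t => ?_)
      (fun t => hJ0 _) hy
    · have := hφ (e.symm (t, y)); rwa [hsl, hk] at this
    · have := hT (e.symm (t, y)); rwa [hsl, hk] at this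
  -- As φ J ≥ 0, its norm integrates over each line to the line integral of -φ' T, which is
  -- integrable in the remaining variables.
  have hI : Integrable fun p : ℝ × (Fin n → ℝ) => φ (e.symm p) * J (e.symm p) := by
    refine (integrable_prod_iff' ?_).2 ⟨hloc.mono fun y hy => hy.1, ?_⟩
    · exact ((hφc.measurable.mul hJ).comp e.symm.measurable).aestronglyMeasurable
    · refine hint'.integral_prod_right.neg.congr ?_
      filter_upwards [hloc] with y hy
      simp only [Pi.neg_apply]
      rw [← hy.2]
      exact integral_congr_ae (Eventually.of_forall fun t =>
        (Real.norm_of_nonneg (mul_nonneg (h0 _) (hJ0 _))).symm)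
  refine ⟨(he.integrable_comp_emb e.symm.measurableEmbedding).1 hI, ?_⟩
  rw [← he.integral_comp e.symm.measurableEmbedding (fun y => φ y * J y),
    ← he.integral_comp e.symm.measurableEmbedding (fun y => φ' y * T y)]
  rw [Measure.volume_eq_prod, integral_prod_symm _ hI, integral_prod_symm _ hint', ← integral_neg]
  exact integral_congr_ae (hloc.mono fun y hy => hy.2)

lemma IsTameDensity.tendsto_cocompact {n : ℕ} {F : (Fin n → ℝ) → ℝ} (hF : IsTameDensity F)
    (k : Fin n) (y : Fin n → ℝ) :
    Tendsto (fun t => F (Function.update y k t)) (cocompact ℝ) (𝓝 0) := by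
  obtain ⟨C, hC0, hC⟩ := hF.const_nonneg
  have h1 : Tendsto (fun t : ℝ => C * (1 + t ^ 2)⁻¹) (cocompact ℝ) (𝓝 0) := by
    have h2 : Tendsto (fun t : ℝ => 1 + t ^ 2) (cocompact ℝ) atTop := by
      refine tendsto_atTop_add_const_left _ _ ?_
      have := (tendsto_pow_atTop (α := ℝ) two_ne_zero).comp (tendsto_norm_cocompact_atTop (E := ℝ))
      simpa [Function.comp_def] using this
    simpa using h2.inv_tendsto_atTop.const_mul C
  refine squeeze_zero (fun t => (hF.pos _).le) (fun t => (hC _).trans ?_) h1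
  refine mul_le_mul_of_nonneg_left ?_ hC0
  rw [← Finset.mul_prod_erase _ _ (Finset.mem_univ k), Function.update_self]
  refine mul_le_of_le_one_right (by positivity)
    (Finset.prod_le_one (fun i _ => by positivity) fun i _ => ?_)
  exact inv_le_one_of_one_le₀ (by nlinarith [sq_nonneg (Function.update y k t i)])

/-- The inequality obtained by transporting `f ^ (2n / (n - 2))` to the density `G`. -/
theorem transport_inequality {n : ℕ} (hn : 3 ≤ n) {f : (Fin n → ℝ) → ℝ}
    {f' : Fin n → (Fin n → ℝ) → ℝ} {G : (Fin n → ℝ) → ℝ} (hfc : Continuous f)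
    (hfpos : ∀ y, 0 < f y) (hf'c : ∀ k, Continuous (f' k))
    (hf : ∀ k y, HasDerivAt (fun t => f (Function.update y k t)) (f' k y) (y k))
    (hF : IsTameDensity fun y => f y ^ (2 * (n : ℝ) / (n - 2))) (hG : IsTameDensity G)
    (hFG : ∫ y, f y ^ (2 * (n : ℝ) / (n - 2)) = ∫ y, G y)
    (hf2 : ∀ k, Integrable fun y => f' k y ^ 2) (hG2 : ∀ k, Integrable fun z => z k ^ 2 * G z)
    {l : ℝ} (hl : 0 < l) :
    n * ∫ z, G z ^ (1 - 1 / (n : ℝ)) ≤ ((n - 1) / (n - 2)) *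
      (l * ∑ k, (∫ y, f' k y ^ 2) + l⁻¹ * ∑ k, ∫ z, z k ^ 2 * G z) := by
  obtain ⟨T, J, hK⟩ := exists_isKnotheMap hF hG hFG
  have hn' : (3 : ℝ) ≤ n := by exact_mod_cast hn
  have hn0 : (n : ℝ) ≠ 0 := by linarith
  have hn2 : (n : ℝ) - 2 ≠ 0 := by linarith
  -- p is the critical Sobolev exponent and m = p(1 - 1/n) is the power of f left over after the
  -- arithmetic-geometric inequality. The identity m - 1 = p/2 lets Young's inequality pair f' with
  -- f^{p/2} T, whose square integral is a second moment of G.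
  set p : ℝ := 2 * (n : ℝ) / (n - 2) with hp
  set m : ℝ := 2 * ((n : ℝ) - 1) / (n - 2) with hm
  have hmp : m - 1 = p / 2 := by rw [hm, hp]; field_simp; ring
  have hmp' : m = p * (1 - 1 / (n : ℝ)) := by rw [hm, hp]; field_simp
  have hmpos : 0 < m := div_pos (by linarith) (by linarith)
  have hTk : ∀ k, Measurable fun y => T y k := fun k => (measurable_pi_apply k).comp hK.measurable
  have hlin : ∀ k, ∫⁻ y, ENNReal.ofReal (T y k ^ 2 * f y ^ p) =
      ∫⁻ z, ENNReal.ofReal (z k ^ 2 * G z) := by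
    intro k
    have := hK.lintegral (fun z => ENNReal.ofReal (z k ^ 2))
      ((measurable_pi_apply k).pow_const 2).ennreal_ofReal
    simp_rw [← ENNReal.ofReal_mul (sq_nonneg _)] at this
    exact this
  have hmeas : ∀ k, AEStronglyMeasurable (fun y => T y k ^ 2 * f y ^ p) volume := fun k =>
    (((hTk k).pow_const 2).mul hF.continuous.measurable).aestronglyMeasurable
  have hTF0 : ∀ k y, 0 ≤ T y k ^ 2 * f y ^ p := fun k y =>
    mul_nonneg (sq_nonneg _) (hF.pos y).le
  have hTF : ∀ k, Integrable fun y => T y k ^ 2 * f y ^ p := by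
    intro k
    refine ⟨hmeas k, ?_⟩
    rw [hasFiniteIntegral_iff_ofReal (Eventually.of_forall (hTF0 k)), hlin,
      ← hasFiniteIntegral_iff_ofReal
        (Eventually.of_forall fun z => mul_nonneg (sq_nonneg _) (hG.pos z).le)]
    exact (hG2 k).2
  have hTFe : ∀ k, ∫ y, T y k ^ 2 * f y ^ p = ∫ z, z k ^ 2 * G z := by
    intro k
    rw [integral_eq_lintegral_of_nonneg_ae (Eventually.of_forall (hTF0 k)) (hmeas k), hlin,
      integral_eq_lintegral_of_nonneg_ae
        (Eventually.of_forall fun z => mul_nonneg (sq_nonneg _) (hG.pos z).le) (hG2 k).1]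
  have hfr : ∀ r : ℝ, Continuous fun y => f y ^ r := fun r =>
    hfc.rpow_const fun y => Or.inl (hfpos y).ne'
  -- pointwise Young inequality
  have hY : ∀ k y, |m * f y ^ (m - 1) * f' k y * T y k| ≤
      m / 2 * (l * f' k y ^ 2 + l⁻¹ * (T y k ^ 2 * f y ^ p)) := by
    intro k y
    have e1 : f y ^ p = (f y ^ (p / 2)) ^ 2 := by
      rw [← Real.rpow_natCast, ← Real.rpow_mul (hfpos y).le]; norm_num
    have h1 := Real.rpow_pos_of_pos (hfpos y) (p / 2)
    rw [hmp, e1, abs_mul, abs_mul, abs_of_pos (mul_pos hmpos h1)]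
    set A := |f' k y|
    set B := f y ^ (p / 2) * |T y k|
    have e2 : f' k y ^ 2 = A ^ 2 := (sq_abs _).symm
    have e3 : T y k ^ 2 * (f y ^ (p / 2)) ^ 2 = B ^ 2 := by
      rw [← sq_abs (T y k)]; simp only [B]; ring
    rw [e2, e3]
    have h2 : 0 ≤ l * (A - l⁻¹ * B) ^ 2 := by positivity
    have h3 : l * (A - l⁻¹ * B) ^ 2 = l * A ^ 2 + l⁻¹ * B ^ 2 - 2 * (A * B) := by
      field_simp; ring
    have h4 : m * f y ^ (p / 2) * A * |T y k| = m * (A * B) := by simp only [B]; ring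
    rw [h4]
    nlinarith
  have hYi : ∀ k, Integrable fun y =>
      m / 2 * (l * f' k y ^ 2 + l⁻¹ * (T y k ^ 2 * f y ^ p)) := fun k =>
    (((hf2 k).const_mul l).add ((hTF k).const_mul l⁻¹)).const_mul _
  have hφT : ∀ k, Integrable fun y => m * f y ^ (m - 1) * f' k y * T y k := by
    intro k
    refine (hYi k).mono' ?_ (Eventually.of_forall (hY k))
    exact ((((continuous_const.mul (hfr _)).mul (hf'c k)).measurable).mul (hTk k)).aestronglyMeasurable
  have hibp : ∀ k, Integrable (fun y => f y ^ m * J y k) ∧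
      ∫ y, f y ^ m * J y k = -∫ y, m * f y ^ (m - 1) * f' k y * T y k := by
    intro k
    refine integral_mul_deriv_pi k (φ := fun y => f y ^ m)
      (φ' := fun y => m * f y ^ (m - 1) * f' k y) (hfr m)
      ((continuous_const.mul (hfr _)).mul (hf'c k)) (fun y => ?_)
      (fun y => (Real.rpow_pos_of_pos (hfpos y) _).le) (fun y => ?_)
      ((measurable_pi_apply k).comp hK.measurable_deriv) (fun y => hK.hasDerivAt y k)
      (fun y => (hK.deriv_pos y k).le) (hφT k)
    · have := (hf k y).rpow_const (p := m) (Or.inl (hfpos _).ne')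
      rw [Function.update_eq_self] at this
      convert this using 1
      ring
    -- f^m is the power 1 - 1/n > 0 of the tame density f^p, so it inherits the decay.
    · have h1 := (hF.tendsto_cocompact k y).rpow_const (p := 1 - 1 / (n : ℝ))
        (Or.inr (by
          have : 1 / (n : ℝ) ≤ 1 := by rw [div_le_one (by linarith)]; linarith
          linarith))
      have hne : 1 - 1 / (n : ℝ) ≠ 0 := by
        have : 1 / (n : ℝ) < 1 := by rw [div_lt_one (by linarith)]; linarith
        linarith
      rw [Real.zero_rpow hne] at h1
      refine h1.congr fun t => ?_
      rw [← Real.rpow_mul (hfpos _).le, hmp']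
  -- the arithmetic-geometric inequality
  have hAG : ∀ y, G (T y) ^ (-(1 / (n : ℝ))) * f y ^ p ≤
      (1 / (n : ℝ)) * ∑ k, f y ^ m * J y k := by
    intro y
    have hP : 0 < ∏ k, J y k := Finset.prod_pos fun k _ => hK.deriv_pos y k
    have e1 : G (T y) = f y ^ p / ∏ k, J y k := by
      rw [eq_div_iff hP.ne']; exact (hK.eq_mul y).symm
    have hFp := hF.pos y
    have e2 : G (T y) ^ (-(1 / (n : ℝ))) * f y ^ p = f y ^ m * ∏ k, J y k ^ (1 / (n : ℝ)) := by
      rw [Real.finsetProd_rpow _ _ fun k _ => (hK.deriv_pos y k).le, e1,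
        Real.div_rpow hFp.le hP.le, Real.rpow_neg hP.le, div_inv_eq_mul, hmp',
        Real.rpow_mul (hfpos y).le, sub_eq_neg_add, Real.rpow_add hFp, Real.rpow_one]
      ring
    rw [e2, ← Finset.mul_sum, mul_left_comm]
    refine mul_le_mul_of_nonneg_left ?_ (Real.rpow_pos_of_pos (hfpos y) _).le
    refine (Real.geom_mean_le_arith_mean_weighted Finset.univ (fun _ => 1 / (n : ℝ)) (J y)
      (fun _ _ => by positivity) (by simp [hn0]) fun k _ => (hK.deriv_pos y k).le).trans_eq ?_
    rw [Finset.mul_sum]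
  have hSi : Integrable fun y => (1 / (n : ℝ)) * ∑ k, f y ^ m * J y k :=
    (integrable_finsetSum _ fun k _ => (hibp k).1).const_mul _
  -- Write G^{1 - 1/n} = G^{-1/n} · G and pull back by T, which replaces the density G by f^p.
  have hleft : ∫ z, G z ^ (1 - 1 / (n : ℝ)) ≤ ∫ y, (1 / (n : ℝ)) * ∑ k, f y ^ m * J y k := by
    have hGr : ∀ r : ℝ, Continuous fun z => G z ^ r := fun r =>
      hG.continuous.rpow_const fun z => Or.inl (hG.pos z).ne'
    rw [integral_eq_lintegral_of_nonneg_ae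
      (Eventually.of_forall fun z => (Real.rpow_pos_of_pos (hG.pos z) _).le)
      (hGr _).aestronglyMeasurable]
    refine ENNReal.toReal_le_of_le_ofReal (integral_nonneg fun y => mul_nonneg (by positivity)
      (Finset.sum_nonneg fun k _ => mul_nonneg (Real.rpow_pos_of_pos (hfpos y) _).le
        (hK.deriv_pos y k).le)) ?_
    rw [ofReal_integral_eq_lintegral_ofReal hSi (Eventually.of_forall fun y =>
      mul_nonneg (by positivity) (Finset.sum_nonneg fun k _ =>
        mul_nonneg (Real.rpow_pos_of_pos (hfpos y) _).le (hK.deriv_pos y k).le))]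
    have := hK.lintegral (fun z => ENNReal.ofReal (G z ^ (-(1 / (n : ℝ)))))
      (hGr _).measurable.ennreal_ofReal
    have e : ∀ z, ENNReal.ofReal (G z ^ (1 - 1 / (n : ℝ))) =
        ENNReal.ofReal (G z ^ (-(1 / (n : ℝ)))) * ENNReal.ofReal (G z) := by
      intro z
      rw [← ENNReal.ofReal_mul (Real.rpow_pos_of_pos (hG.pos z) _).le, sub_eq_neg_add,
        Real.rpow_add (hG.pos z), Real.rpow_one]
    simp_rw [e]
    rw [← this]
    refine lintegral_mono fun y => ?_
    rw [← ENNReal.ofReal_mul (Real.rpow_pos_of_pos (hG.pos _) _).le]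
    exact ENNReal.ofReal_le_ofReal (hAG y)
  rw [integral_const_mul, integral_finsetSum _ fun k _ => (hibp k).1] at hleft
  have hk : ∀ k, ∫ y, f y ^ m * J y k ≤
      m / 2 * (l * ∫ y, f' k y ^ 2) + m / 2 * (l⁻¹ * ∫ z, z k ^ 2 * G z) := by
    intro k
    rw [(hibp k).2, ← integral_neg, ← hTFe k]
    refine (integral_mono (hφT k).neg (hYi k) fun y =>
      (neg_le_abs _).trans (hY k y)).trans_eq ?_
    rw [integral_const_mul, integral_add ((hf2 k).const_mul l) ((hTF k).const_mul l⁻¹),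
      integral_const_mul, integral_const_mul, mul_add]
  have hsum := Finset.sum_le_sum fun k (_ : k ∈ Finset.univ) => hk k
  rw [Finset.sum_add_distrib, ← Finset.mul_sum, ← Finset.mul_sum, ← Finset.mul_sum,
    ← Finset.mul_sum] at hsum
  have hm2 : m / 2 = ((n : ℝ) - 1) / (n - 2) := by rw [hm]; ring
  rw [hm2, ← mul_add] at hsum
  refine le_trans ?_ hsum
  have hnpos : (0 : ℝ) < n := by linarith
  calc (n : ℝ) * ∫ z, G z ^ (1 - 1 / (n : ℝ)) ≤ n * _ :=
        mul_le_mul_of_nonneg_left hleft hnpos.le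
    _ = _ := by field_simp

end Transport

/-! ### The sharp Sobolev inequality -/

section Sobolev

variable {n : ℕ}

/-- The conformal factor `4 / (4 + |y|²)` of the stereographic projection. -/
noncomputable def bubble (y : EuclideanSpace ℝ (Fin n)) : ℝ := (1 + ‖y‖ ^ 2 / 4)⁻¹

lemma bubble_pos (y : EuclideanSpace ℝ (Fin n)) : 0 < bubble y := by
  unfold bubble; positivity

lemma bubble_le_one (y : EuclideanSpace ℝ (Fin n)) : bubble y ≤ 1 :=
  inv_le_one_of_one_le₀ (by nlinarith [sq_nonneg ‖y‖])

lemma bubble_mul (y : EuclideanSpace ℝ (Fin n)) : bubble y * (1 + ‖y‖ ^ 2 / 4) = 1 :=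
  inv_mul_cancel₀ (by positivity)

lemma contDiff_bubble : ContDiff ℝ ∞ (bubble (n := n)) := by
  unfold bubble
  refine ContDiff.inv ?_ fun y => by positivity
  exact contDiff_const.add ((contDiff_norm_sq ℝ).div_const _)

lemma contDiff_bubble_rpow (r : ℝ) : ContDiff ℝ ∞ fun y : EuclideanSpace ℝ (Fin n) => bubble y ^ r :=
  contDiff_bubble.rpow_const_of_ne fun y => (bubble_pos y).ne'

lemma continuous_bubble_rpow (r : ℝ) :
    Continuous fun y : EuclideanSpace ℝ (Fin n) => bubble y ^ r :=
  (contDiff_bubble_rpow r).continuous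

lemma norm_mul_bubble_le (y : EuclideanSpace ℝ (Fin n)) : ‖y‖ * bubble y ≤ 1 := by
  have := bubble_mul y
  nlinarith [bubble_pos y, sq_nonneg (‖y‖ - 2)]

lemma abs_apply_mul_bubble_le (y : EuclideanSpace ℝ (Fin n)) (i : Fin n) :
    |y i| * bubble y ≤ 1 :=
  (mul_le_mul_of_nonneg_right (PiLp.norm_apply_le y i) (bubble_pos y).le).trans
    (norm_mul_bubble_le y)

lemma integrable_bubble_rpow {r : ℝ} (hr : (n : ℝ) < 2 * r) :
    Integrable fun y : EuclideanSpace ℝ (Fin n) => bubble y ^ r := by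
  have h := (integrable_rpow_neg_one_add_norm_sq (E := EuclideanSpace ℝ (Fin n)) (μ := volume)
    (r := 2 * r) (by simpa using hr)).const_mul (4 ^ r)
  have hr0 : 0 ≤ r := by linarith [n.cast_nonneg (α := ℝ)]
  refine h.mono' (continuous_bubble_rpow r).aestronglyMeasurable (Eventually.of_forall fun y => ?_)
  rw [Real.norm_of_nonneg (Real.rpow_pos_of_pos (bubble_pos y) r).le,
    show -(2 * r) / 2 = -r by ring, Real.rpow_neg (by positivity),
    ← Real.inv_rpow (by positivity), ← Real.mul_rpow (by positivity) (by positivity)]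
  refine Real.rpow_le_rpow (bubble_pos y).le ?_ hr0
  rw [bubble, inv_le_comm₀ (by positivity) (by positivity), mul_inv, inv_inv]
  nlinarith [sq_nonneg ‖y‖]

lemma hasFDerivAt_bubble_rpow (r : ℝ) (y : EuclideanSpace ℝ (Fin n)) :
    HasFDerivAt (fun y : EuclideanSpace ℝ (Fin n) => bubble y ^ r)
      ((-(r / 2) * bubble y ^ (r + 1)) • innerSL ℝ y) y := by
  have h0 : HasFDerivAt (fun y : EuclideanSpace ℝ (Fin n) => 1 + ‖y‖ ^ 2 / 4)
      ((4 : ℝ)⁻¹ • (2 • innerSL ℝ y)) y := by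
    have := ((hasStrictFDerivAt_norm_sq y).hasFDerivAt.const_smul (4 : ℝ)⁻¹).const_add 1
    refine this.congr_of_eventuallyEq (Eventually.of_forall fun z => ?_)
    simp [div_eq_inv_mul]
  have hb : ∀ (s : ℝ) (z : EuclideanSpace ℝ (Fin n)), bubble z ^ s = (1 + ‖z‖ ^ 2 / 4) ^ (-s) :=
    fun s z => by rw [bubble, Real.inv_rpow (by positivity), Real.rpow_neg (by positivity)]
  have h2 := h0.rpow_const (p := -r) (Or.inl (by positivity))
  simp_rw [hb]
  refine h2.congr_fderiv ?_
  ext v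
  simp only [smul_apply, smul_eq_mul, nsmul_eq_mul, neg_add, innerSL_apply_apply, Nat.cast_ofNat,
    sub_eq_add_neg]
  ring

lemma partialDeriv_bubble_rpow (r : ℝ) (i : Fin n) (y : EuclideanSpace ℝ (Fin n)) :
    partialDeriv i (fun y => bubble y ^ r) y = -(r / 2) * y i * bubble y ^ (r + 1) := by
  rw [partialDeriv, (hasFDerivAt_bubble_rpow r y).fderiv]
  simp only [smul_apply, innerSL_apply_apply, smul_eq_mul,
    EuclideanSpace.inner_single_right, one_mul, conj_trivial]
  ring

/-- `∫ |y|² θⁿ / 4 = n / (n - 2) ∫ θⁿ`. -/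
lemma integral_norm_sq_mul_bubble (hn : 5 ≤ n) :
    (∀ i, Integrable fun y : EuclideanSpace ℝ (Fin n) => y i ^ 2 * bubble y ^ n) ∧
    ∑ i, ∫ y : EuclideanSpace ℝ (Fin n), y i ^ 2 * bubble y ^ n =
      4 * (n / (n - 2)) * ∫ y : EuclideanSpace ℝ (Fin n), bubble y ^ n ∧
    ∫ y : EuclideanSpace ℝ (Fin n), bubble y ^ ((n : ℝ) - 1) =
      2 * (n - 1) / (n - 2) * ∫ y : EuclideanSpace ℝ (Fin n), bubble y ^ n := by
  have hn' : (5 : ℝ) ≤ n := by exact_mod_cast hn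
  have hmeas : ∀ r : ℝ, Continuous fun y : EuclideanSpace ℝ (Fin n) => bubble y ^ r :=
    continuous_bubble_rpow
  have hpow : ∀ y : EuclideanSpace ℝ (Fin n), bubble y ^ n = bubble y ^ (n : ℝ) := fun y =>
    (Real.rpow_natCast _ _).symm
  simp_rw [hpow]
  have hci : ∀ i, Continuous fun y : EuclideanSpace ℝ (Fin n) => y i := fun i => by fun_prop
  have hr1 : ∀ (y : EuclideanSpace ℝ (Fin n)) (r : ℝ),
      bubble y ^ r = bubble y * bubble y ^ (r - 1) := fun y r => by
    rw [Real.rpow_sub_one (bubble_pos y).ne', mul_div_cancel₀ _ (bubble_pos y).ne']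
  have hp := fun (y : EuclideanSpace ℝ (Fin n)) (r : ℝ) => Real.rpow_pos_of_pos (bubble_pos y) r
  have i1 : Integrable fun y : EuclideanSpace ℝ (Fin n) => bubble y ^ ((n : ℝ) - 1) :=
    integrable_bubble_rpow (by linarith)
  have i0 : Integrable fun y : EuclideanSpace ℝ (Fin n) => bubble y ^ (n : ℝ) :=
    integrable_bubble_rpow (by linarith)
  have i2 : Integrable fun y : EuclideanSpace ℝ (Fin n) => bubble y ^ ((n : ℝ) - 2) :=
    integrable_bubble_rpow (by linarith)
  have iA : ∀ i, Integrable fun y : EuclideanSpace ℝ (Fin n) => y i ^ 2 * bubble y ^ (n : ℝ) := by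
    intro i
    refine (i1.const_mul 4).mono' (((hci i).pow 2).mul (hmeas _)).aestronglyMeasurable
      (Eventually.of_forall fun y => ?_)
    rw [Real.norm_of_nonneg (mul_nonneg (sq_nonneg _) (hp y _).le), hr1 y n, ← mul_assoc]
    refine mul_le_mul_of_nonneg_right ?_ (hp y _).le
    have h1 := bubble_mul y
    have h2 : y i ^ 2 ≤ ‖y‖ ^ 2 := by
      rw [← sq_abs]; exact pow_le_pow_left₀ (abs_nonneg _) (PiLp.norm_apply_le y i) 2
    nlinarith [bubble_pos y]
  have iB : ∀ i, Integrable fun y : EuclideanSpace ℝ (Fin n) => bubble y ^ ((n : ℝ) - 1) * y i := by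
    intro i
    refine i2.mono' ((hmeas _).mul (hci i)).aestronglyMeasurable (Eventually.of_forall fun y => ?_)
    rw [norm_mul, Real.norm_of_nonneg (hp y _).le, hr1 y, Real.norm_eq_abs,
      show (n : ℝ) - 1 - 1 = n - 2 by ring]
    nlinarith [abs_apply_mul_bubble_le y i, hp y ((n : ℝ) - 2)]
  -- Integrate by parts the product of bubble^{n-1} and y_i in the direction e_i.
  have key : ∀ i, ∫ y : EuclideanSpace ℝ (Fin n), bubble y ^ ((n : ℝ) - 1) =
      ((n : ℝ) - 1) / 2 * ∫ y : EuclideanSpace ℝ (Fin n), y i ^ 2 * bubble y ^ (n : ℝ) := by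
    intro i
    have hder : ∀ y : EuclideanSpace ℝ (Fin n),
        fderiv ℝ (fun y : EuclideanSpace ℝ (Fin n) => bubble y ^ ((n : ℝ) - 1)) y
          (EuclideanSpace.single i 1) = -(((n : ℝ) - 1) / 2) * y i * bubble y ^ (n : ℝ) := by
      intro y
      have := partialDeriv_bubble_rpow ((n : ℝ) - 1) i y
      rw [sub_add_cancel] at this
      exact this
    have hder2 : ∀ y : EuclideanSpace ℝ (Fin n),
        fderiv ℝ (fun y : EuclideanSpace ℝ (Fin n) => y i) y (EuclideanSpace.single i 1) = 1 := by
      intro y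
      have : (fun y : EuclideanSpace ℝ (Fin n) => y i) = EuclideanSpace.proj (𝕜 := ℝ) i := rfl
      rw [this, ContinuousLinearMap.fderiv]
      simp
    have e : ∀ y : EuclideanSpace ℝ (Fin n), -(((n : ℝ) - 1) / 2) * y i * bubble y ^ (n : ℝ) * y i =
        -(((n : ℝ) - 1) / 2) * (y i ^ 2 * bubble y ^ (n : ℝ)) := fun y => by ring
    have := integral_mul_fderiv_eq_neg_fderiv_mul_of_integrable (μ := volume)
      (f := fun y : EuclideanSpace ℝ (Fin n) => bubble y ^ ((n : ℝ) - 1))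
      (g := fun y : EuclideanSpace ℝ (Fin n) => y i) (v := EuclideanSpace.single i 1)
      (by simp_rw [hder, e]; exact (iA i).const_mul _) (by simpa only [hder2, mul_one] using i1)
      (iB i) (fun y _ => ((contDiff_bubble_rpow _).differentiable (by simp)).differentiableAt)
      (fun y _ => by fun_prop)
    simp_rw [hder, hder2, mul_one, e] at this
    rw [this, integral_const_mul]
    ring
  -- From |y|² bubble = 4(1 - bubble). Together with `key` summed over i this is a linear system for
  -- the second moment and the integral of bubble^{n-1}.
  have hsum : ∑ i : Fin n, ∫ y : EuclideanSpace ℝ (Fin n), y i ^ 2 * bubble y ^ (n : ℝ) =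
      4 * ((∫ y : EuclideanSpace ℝ (Fin n), bubble y ^ ((n : ℝ) - 1)) -
        ∫ y : EuclideanSpace ℝ (Fin n), bubble y ^ (n : ℝ)) := by
    rw [← integral_finsetSum _ fun i _ => iA i, ← integral_sub i1 i0, ← integral_const_mul]
    refine integral_congr_ae (Eventually.of_forall fun y => ?_)
    simp only
    rw [← Finset.sum_mul, ← EuclideanSpace.real_norm_sq_eq, hr1 y n]
    have := bubble_mul y
    linear_combination (4 * bubble y ^ ((n : ℝ) - 1)) * this
  have hk : (n : ℝ) * ∫ y : EuclideanSpace ℝ (Fin n), bubble y ^ ((n : ℝ) - 1) =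
      ((n : ℝ) - 1) / 2 *
        ∑ i : Fin n, ∫ y : EuclideanSpace ℝ (Fin n), y i ^ 2 * bubble y ^ (n : ℝ) := by
    rw [Finset.mul_sum, ← Finset.sum_congr rfl fun i _ => key i]
    simp
  have h2 : (n : ℝ) - 2 ≠ 0 := by linarith
  rw [hsum] at hk
  set X := ∫ y : EuclideanSpace ℝ (Fin n), bubble y ^ ((n : ℝ) - 1)
  set Y := ∫ y : EuclideanSpace ℝ (Fin n), bubble y ^ (n : ℝ)
  have hX : X = 2 * (n - 1) / (n - 2) * Y := by
    field_simp
    linarith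
  refine ⟨iA, ?_, hX⟩
  rw [hsum, hX]
  field_simp
  ring

/-- For each i the bubble is at most 4/(1 + y_i²), since |y|² ≥ y_i²; multiplying these n bounds
gives the product of Cauchy densities. -/
lemma isTameDensity_of_le_bubble {F : EuclideanSpace ℝ (Fin n) → ℝ} (hc : Continuous F)
    (hpos : ∀ y, 0 < F y) {C : ℝ} (hC : ∀ y, F y ≤ C * bubble y ^ n) :
    IsTameDensity fun y : Fin n → ℝ => F (WithLp.toLp 2 y) := by
  refine ⟨by fun_prop, fun y => hpos _, C * 4 ^ n, fun y => (hC _).trans ?_⟩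
  have hC0 : 0 ≤ C := by
    have h := (hpos 0).trans_le (hC 0)
    exact (pos_of_mul_pos_left h (pow_pos (bubble_pos _) n).le).le
  rw [mul_assoc]
  refine mul_le_mul_of_nonneg_left ?_ hC0
  have h4 : (4 : ℝ) ^ n * ∏ i, (1 + y i ^ 2)⁻¹ = ∏ i, 4 * (1 + y i ^ 2)⁻¹ := by
    rw [Finset.prod_mul_distrib]; simp
  have h5 : ∏ _i : Fin n, bubble (WithLp.toLp 2 y : EuclideanSpace ℝ (Fin n)) =
    bubble (WithLp.toLp 2 y : EuclideanSpace ℝ (Fin n)) ^ n := by simp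
  rw [h4, ← h5]
  refine Finset.prod_le_prod (fun i _ => (bubble_pos _).le) fun i _ => ?_
  rw [bubble, inv_le_comm₀ (by positivity) (by positivity), mul_inv, inv_inv]
  have h2 : y i ^ 2 ≤ ‖(WithLp.toLp 2 y : EuclideanSpace ℝ (Fin n))‖ ^ 2 := by
    rw [← sq_abs]
    exact pow_le_pow_left₀ (abs_nonneg _) (PiLp.norm_apply_le (WithLp.toLp 2 y) i) 2
  nlinarith

lemma hasDerivAt_update_toLp {f : EuclideanSpace ℝ (Fin n) → ℝ} (hf : Differentiable ℝ f)
    (k : Fin n) (y : Fin n → ℝ) :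
    HasDerivAt (fun t => f (WithLp.toLp 2 (Function.update y k t)))
      (partialDeriv k f (WithLp.toLp 2 y)) (y k) := by
  have h1 : HasDerivAt (fun t => (WithLp.toLp 2 (Function.update y k t) : EuclideanSpace ℝ (Fin n)))
      (EuclideanSpace.single k 1) (y k) := by
    have := (hasDerivAt_update y k (y k))
    have h2 := ((PiLp.continuousLinearEquiv 2 ℝ (fun _ : Fin n => ℝ)).symm :
      (Fin n → ℝ) →L[ℝ] EuclideanSpace ℝ (Fin n)).hasFDerivAt.comp_hasDerivAt (y k) this
    exact h2
  have h2 := (hf (WithLp.toLp 2 (Function.update y k (y k)))).hasFDerivAt.comp_hasDerivAt (y k) h1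
  rw [Function.update_eq_self] at h2
  exact h2

/-- The sharp Sobolev inequality, for positive functions with the decay of the extremals. -/
theorem sobolev_inequality (hn : 5 ≤ n) {f : EuclideanSpace ℝ (Fin n) → ℝ} (hf : ContDiff ℝ 1 f)
    (hpos : ∀ y, 0 < f y) {C : ℝ} (hC : ∀ y, f y ≤ C * bubble y ^ (((n : ℝ) - 2) / 2))
    (hf2 : ∀ i, Integrable fun y => partialDeriv i f y ^ 2) :
    (n * (n - 2) / 4 : ℝ) * (∫ y : EuclideanSpace ℝ (Fin n), bubble y ^ n) ^ (2 / (n : ℝ)) *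
        (∫ y, f y ^ (2 * (n : ℝ) / (n - 2))) ^ (((n : ℝ) - 2) / n) ≤
      ∑ i, ∫ y, partialDeriv i f y ^ 2 := by
  have hn' : (5 : ℝ) ≤ n := by exact_mod_cast hn
  have hn2 : (0 : ℝ) < (n : ℝ) - 2 := by linarith
  obtain ⟨hB1, hB2, hB3⟩ := integral_norm_sq_mul_bubble hn
  set p : ℝ := 2 * (n : ℝ) / (n - 2) with hp
  have hp0 : 0 < p := by positivity
  set V : ℝ := ∫ y : EuclideanSpace ℝ (Fin n), bubble y ^ n with hV
  have hmp := PiLp.volume_preserving_toLp (Fin n)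
  have hme : MeasurableEmbedding (@WithLp.toLp 2 (Fin n → ℝ)) :=
    (MeasurableEquiv.toLp 2 (Fin n → ℝ)).measurableEmbedding
  have hbp : ∀ y : EuclideanSpace ℝ (Fin n), 0 < bubble y ^ n := fun y => pow_pos (bubble_pos y) n
  have hbi : Integrable fun y : EuclideanSpace ℝ (Fin n) => bubble y ^ n := by
    simpa using integrable_bubble_rpow (n := n) (r := n) (by linarith)
  have hV0 : 0 < V := integral_pos_of_pos hbp hbi
  have hFp : ∀ y, 0 < f y ^ p := fun y => Real.rpow_pos_of_pos (hpos y) _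
  have hFc : Continuous fun y => f y ^ p :=
    hf.continuous.rpow_const fun y => Or.inl (hpos y).ne'
  have hC0 : 0 ≤ C := by
    have h := (hpos 0).trans_le (hC 0)
    exact (pos_of_mul_pos_left h (Real.rpow_pos_of_pos (bubble_pos _) _).le).le
  have hFb : ∀ y, f y ^ p ≤ C ^ p * bubble y ^ n := fun y => by
    refine (Real.rpow_le_rpow (hpos y).le (hC y) hp0.le).trans_eq ?_
    rw [Real.mul_rpow hC0 (Real.rpow_pos_of_pos (bubble_pos _) _).le, ← Real.rpow_mul (bubble_pos y).le,
      ← Real.rpow_natCast (bubble y) n]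
    congr 2
    rw [hp]; field_simp
  have hFi : Integrable fun y => f y ^ p :=
    (hbi.const_mul (C ^ p)).mono' hFc.aestronglyMeasurable
      (Eventually.of_forall fun y => by rw [Real.norm_of_nonneg (hFp y).le]; exact hFb y)
  set M : ℝ := ∫ y, f y ^ p with hM
  have hM0 : 0 < M := integral_pos_of_pos hFp hFi
  have hq : 0 < M / V := div_pos hM0 hV0
  set K : ℝ := (M / V) ^ (1 / (n : ℝ)) with hK
  have hK0 : 0 < K := Real.rpow_pos_of_pos hq _
  -- This is the weight l in Young's inequality. K is the n-th root of the mass ratio, and the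
  -- choice turns the second-moment term into n M / K, half of the left side; for the extremal f the
  -- gradient term is then the other half.
  have hl : 0 < 4 * K / (n - 2) := by positivity
  have hi : ∀ (H : EuclideanSpace ℝ (Fin n) → ℝ),
      ∫ y : Fin n → ℝ, H (WithLp.toLp 2 y) = ∫ y, H y := fun H => hmp.integral_comp hme H
  have hii : ∀ (H : EuclideanSpace ℝ (Fin n) → ℝ), Integrable H →
      Integrable fun y : Fin n → ℝ => H (WithLp.toLp 2 y) := fun H h =>
    (hmp.integrable_comp_emb hme).2 h
  have key := transport_inequality (n := n) (by lia) (f := fun y => f (WithLp.toLp 2 y))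
    (f' := fun k y => partialDeriv k f (WithLp.toLp 2 y))
    (G := fun y => M / V * bubble (WithLp.toLp 2 y) ^ n)
    (by have := hf.continuous; fun_prop) (fun y => hpos _)
    (fun k => by
      have h1 : Continuous (fderiv ℝ f) := hf.continuous_fderiv (by simp)
      unfold partialDeriv
      fun_prop)
    (fun k y => hasDerivAt_update_toLp (hf.differentiable (by simp)) k y)
    (isTameDensity_of_le_bubble hFc hFp hFb)
    (isTameDensity_of_le_bubble (F := fun y => M / V * bubble y ^ n)
      (continuous_const.mul (contDiff_bubble.continuous.pow n))
      (fun y => mul_pos hq (hbp y)) (fun y => le_rfl))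
    (by
      rw [hi fun y => f y ^ p, hi fun y => M / V * bubble y ^ n, integral_const_mul, ← hV,
        div_mul_cancel₀ _ hV0.ne'])
    (fun k => hii _ (hf2 k))
    (fun k => by
      have := (hii _ (hB1 k)).const_mul (M / V)
      refine this.congr (Eventually.of_forall fun y => ?_)
      simp only
      ring) hl
  have e1 : ∫ y : Fin n → ℝ, (M / V * bubble (WithLp.toLp 2 y : EuclideanSpace ℝ (Fin n)) ^ n) ^ (1 - 1 / (n : ℝ)) =
      (M / V) / K * (2 * (n - 1) / (n - 2) * V) := by
    rw [hi fun y => (M / V * bubble y ^ n) ^ (1 - 1 / (n : ℝ)), ← hB3, ← integral_const_mul]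
    refine integral_congr_ae (Eventually.of_forall fun y => ?_)
    simp only
    rw [Real.mul_rpow hq.le (hbp y).le, Real.rpow_sub hq, Real.rpow_one,
      ← Real.rpow_natCast (bubble y) n, ← Real.rpow_mul (bubble_pos y).le]
    congr 2
    field_simp
  have e2 : ∀ k : Fin n, ∫ z : Fin n → ℝ, z k ^ 2 * (M / V * bubble (WithLp.toLp 2 z : EuclideanSpace ℝ (Fin n)) ^ n) =
      M / V * ∫ y : EuclideanSpace ℝ (Fin n), y k ^ 2 * bubble y ^ n := by
    intro k
    rw [hi fun y => y k ^ 2 * (M / V * bubble y ^ n), ← integral_const_mul]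
    congr 1
    ext y
    ring
  have e3 : ∀ k : Fin n, ∫ y : Fin n → ℝ, partialDeriv k f (WithLp.toLp 2 y) ^ 2 =
      ∫ y, partialDeriv k f y ^ 2 := fun k => hi fun y => partialDeriv k f y ^ 2
  simp_rw [e1, e2, e3] at key
  rw [← Finset.mul_sum, hB2] at key
  set X := ∑ i, ∫ y, partialDeriv i f y ^ 2
  have hgoal : V ^ (2 / (n : ℝ)) * M ^ (((n : ℝ) - 2) / n) = M / K ^ 2 := by
    have h1 : K ^ 2 = (M / V) ^ (2 / (n : ℝ)) := by
      rw [hK, ← Real.rpow_natCast, ← Real.rpow_mul hq.le]; congr 1; push_cast; ring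
    have h2 : M ^ (((n : ℝ) - 2) / n) = M / M ^ (2 / (n : ℝ)) := by
      rw [sub_div, div_self (by linarith : (n : ℝ) ≠ 0), Real.rpow_sub hM0, Real.rpow_one]
    have h3 := Real.rpow_pos_of_pos hM0 (2 / (n : ℝ))
    have h4 := Real.rpow_pos_of_pos hV0 (2 / (n : ℝ))
    rw [h1, h2, Real.div_rpow hM0.le hV0.le]
    field_simp
  rw [mul_assoc, hgoal]
  have hn1 : (0 : ℝ) < (n : ℝ) - 1 := by linarith
  have hkey : 2 * n * M / K ≤ 4 * K / (n - 2) * X + n * M / K := by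
    have h5 : ((n : ℝ) - 1) / (n - 2) * (2 * n * M / K) ≤
        ((n : ℝ) - 1) / (n - 2) * (4 * K / (n - 2) * X + n * M / K) := by
      refine le_trans (le_of_eq ?_) (key.trans (le_of_eq ?_))
      · field_simp
      · field_simp
    exact le_of_mul_le_mul_left h5 (by positivity)
  have h6 : n * M / K ≤ 4 * K / (n - 2) * X := by
    have : 2 * n * M / K = n * M / K + n * M / K := by ring
    linarith
  have h7 : (n * (n - 2) / 4 : ℝ) * (M / K ^ 2) = n * M / K * ((n - 2) / (4 * K)) := by
    field_simp
  rw [h7]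
  refine (mul_le_mul_of_nonneg_right h6 (by positivity)).trans_eq ?_
  field_simp

end Sobolev

/-! ### Conformally flat metrics -/

section ConformallyFlat

variable {n : ℕ}

lemma contDiff_partialDeriv {f : EuclideanSpace ℝ (Fin n) → ℝ} (hf : ContDiff ℝ ∞ f) (i : Fin n) :
    ContDiff ℝ ∞ (partialDeriv i f) := by
  unfold partialDeriv
  exact (hf.fderiv_right (m := ∞) (by simp)).clm_apply contDiff_const

lemma partialDeriv_add {f g : EuclideanSpace ℝ (Fin n) → ℝ} (hf : Differentiable ℝ f)
    (hg : Differentiable ℝ g) (i : Fin n) (y : EuclideanSpace ℝ (Fin n)) :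
    partialDeriv i (fun z => f z + g z) y = partialDeriv i f y + partialDeriv i g y := by
  simp only [partialDeriv]
  rw [fderiv_fun_add (hf y) (hg y)]; rfl

lemma partialDeriv_mul {f g : EuclideanSpace ℝ (Fin n) → ℝ} (hf : Differentiable ℝ f)
    (hg : Differentiable ℝ g) (i : Fin n) (y : EuclideanSpace ℝ (Fin n)) :
    partialDeriv i (fun z => f z * g z) y = f y * partialDeriv i g y + partialDeriv i f y * g y := by
  simp only [partialDeriv]
  rw [fderiv_fun_mul (hf y) (hg y)]
  simp only [add_apply, smul_apply, smul_eq_mul]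
  ring

lemma partialDeriv_const_mul (c : ℝ) {f : EuclideanSpace ℝ (Fin n) → ℝ} (hf : Differentiable ℝ f)
    (i : Fin n) (y : EuclideanSpace ℝ (Fin n)) :
    partialDeriv i (fun z => c * f z) y = c * partialDeriv i f y := by
  simp only [partialDeriv]
  rw [fderiv_const_mul (hf y)]; rfl

lemma partialDeriv_const (c : ℝ) (i : Fin n) (y : EuclideanSpace ℝ (Fin n)) :
    partialDeriv i (fun _ => c) y = 0 := by
  simp [partialDeriv]

lemma partialDeriv_comp {f : EuclideanSpace ℝ (Fin n) → ℝ} {h : ℝ → ℝ} {h' : ℝ}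
    {y : EuclideanSpace ℝ (Fin n)} (hf : Differentiable ℝ f) (hh : HasDerivAt h h' (f y))
    (i : Fin n) :
    partialDeriv i (fun z => h (f z)) y = h' * partialDeriv i f y := by
  have := (hh.comp_hasFDerivAt y (hf y).hasFDerivAt).fderiv
  simp only [partialDeriv]
  change fderiv ℝ (h ∘ f) y _ = _
  rw [this]; rfl

/-- The Christoffel symbols of `e^{2φ} δ` in terms of `a = ∇φ`. -/
noncomputable def flatGamma (a : Fin n → ℝ) (k i j : Fin n) : ℝ :=
  (if j = k then a i else 0) + (if i = k then a j else 0) - (if i = j then a k else 0)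

/-- The traced quadratic part of the Ricci tensor of e^{2φ} δ; `sum_flatGamma_deriv` gives the part
with second derivatives of φ. -/
lemma sum_flatGamma_mul_sub (a : Fin n → ℝ) :
    ∑ i, ∑ k, ∑ l, (flatGamma a k k l * flatGamma a l i i - flatGamma a k i l * flatGamma a l i k) =
      ((n : ℝ) - 1) * (2 - n) * ∑ i, a i ^ 2 := by
  have h1 : ∀ k l, flatGamma a k k l = a l := by
    intro k l
    by_cases h : l = k
    · subst h; simp [flatGamma]
    · have h' : k ≠ l := fun e => h e.symm
      simp [flatGamma, h, h']
  have h2 : ∀ l i, flatGamma a l i i = 2 * (if i = l then a i else 0) - a l := by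
    intro l i
    by_cases h : i = l
    · subst h; simp [flatGamma]; ring
    · simp [flatGamma, h]
  have h3 : ∀ i k l, flatGamma a k i l * flatGamma a l i k =
      (if l = k then a i ^ 2 else 0) - (if i = k then a l ^ 2 else 0) -
        (if i = l then a k ^ 2 else 0) + 2 * (if i = k then (if i = l then a l * a k else 0) else 0) := by
    intro i k l
    simp only [flatGamma]
    by_cases h : l = k
    · subst h
      by_cases h' : i = l
      · subst h'; simp; ring
      · simp [h']; ring
    · have hs : k ≠ l := fun e => h e.symm
      by_cases h' : i = k
      · subst h'; simp [h, hs]; ring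
      · by_cases h'' : i = l
        · subst h''; simp [h, hs]; ring
        · simp [h, hs, h', h'']
  simp only [h1, h2, h3]
  simp only [Finset.sum_add_distrib, Finset.sum_sub_distrib, mul_sub, ← Finset.mul_sum, mul_ite,
    mul_zero, Finset.sum_ite_irrel, Finset.sum_const_zero, Finset.sum_ite_eq, Finset.sum_ite_eq',
    Finset.mem_univ, if_true, Finset.sum_const,
    Finset.card_univ, Fintype.card_fin, nsmul_eq_mul, ← pow_two, mul_left_comm _ (2 : ℝ)]
  ring

lemma sum_flatGamma_deriv (b : Fin n → Fin n → ℝ) :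
    ∑ i, ∑ k, (flatGamma (b k) k i i - flatGamma (b i) k i k) = 2 * (1 - (n : ℝ)) * ∑ i, b i i := by
  have h1 : ∀ i k, flatGamma (b k) k i i = 2 * (if i = k then b k i else 0) - b k k := by
    intro i k
    by_cases h : i = k
    · subst h; simp [flatGamma]; ring
    · simp [flatGamma, h]
  have h2 : ∀ i k, flatGamma (b i) k i k = b i i := by
    intro i k; simp [flatGamma]
  simp only [h1, h2, Finset.sum_sub_distrib, ← Finset.mul_sum, Finset.sum_ite_eq, Finset.mem_univ,
    if_true, Finset.sum_const, Finset.card_univ, Fintype.card_fin, nsmul_eq_mul]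
  ring

variable {φ V : EuclideanSpace ℝ (Fin n) → ℝ}
  {G : EuclideanSpace ℝ (Fin n) → Matrix (Fin n) (Fin n) ℝ}

lemma christoffel_conformal (hφ : ContDiff ℝ ∞ φ)
    (hG : ∀ y, G y = Real.exp (2 * φ y) • (1 : Matrix (Fin n) (Fin n) ℝ)) (k i j : Fin n) :
    christoffel G k i j = fun y => flatGamma (fun i => partialDeriv i φ y) k i j := by
  ext y
  have hd : Differentiable ℝ φ := hφ.differentiable (by simp)
  have hinv : (G y)⁻¹ = (Real.exp (2 * φ y))⁻¹ • (1 : Matrix (Fin n) (Fin n) ℝ) := by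
    refine Matrix.inv_eq_left_inv ?_
    rw [hG, smul_mul_smul_comm, inv_mul_cancel₀ (Real.exp_pos _).ne']; simp
  have hpd : ∀ a b c, partialDeriv a (fun z => G z b c) y =
      if b = c then 2 * Real.exp (2 * φ y) * partialDeriv a φ y else 0 := by
    intro a b c
    by_cases h : b = c
    · subst h
      simp only [hG, Matrix.smul_apply, Matrix.one_apply_eq, smul_eq_mul, mul_one, if_true]
      rw [partialDeriv_comp (h := fun t => Real.exp (2 * t)) (h' := Real.exp (2 * φ y) * 2) hd]
      · ring
      · have := ((hasDerivAt_id (φ y)).const_mul 2).exp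
        simpa using this
    · simp only [hG, Matrix.smul_apply, Matrix.one_apply_ne h, smul_zero, if_neg h]
      exact partialDeriv_const 0 a y
  have he := (Real.exp_pos (2 * φ y)).ne'
  simp only [christoffel, hinv, hpd, Matrix.smul_apply, Matrix.one_apply, smul_eq_mul, mul_ite,
    mul_one, mul_zero, ite_mul, zero_mul, Finset.sum_ite_eq, Finset.mem_univ, if_true, flatGamma]
  by_cases h1 : j = k
  · subst h1
    by_cases h2 : i = j
    · subst h2; simp; field_simp
    · simp [h2]; field_simp
  · by_cases h2 : i = k
    · subst h2; simp [h1, Ne.symm h1]; field_simp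
    · by_cases h3 : i = j
      · subst h3; simp [h2]; field_simp
      · simp [h1, h2, h3]

/-- The symbols are linear in ∇φ with constant coefficients, so differentiation passes to the
argument. -/
lemma partialDeriv_flatGamma (hφ : ContDiff ℝ ∞ φ) (m k i j : Fin n)
    (y : EuclideanSpace ℝ (Fin n)) :
    partialDeriv m (fun y => flatGamma (fun i => partialDeriv i φ y) k i j) y =
      flatGamma (fun i => partialDeriv m (partialDeriv i φ) y) k i j := by
  have hd : ∀ i, Differentiable ℝ (partialDeriv i φ) := fun i =>
    (contDiff_partialDeriv hφ i).differentiable (by simp)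
  have hite : ∀ (P : Prop) [Decidable P] (i : Fin n),
      Differentiable ℝ (fun y => if P then partialDeriv i φ y else 0) ∧
      partialDeriv m (fun y => if P then partialDeriv i φ y else 0) y =
        if P then partialDeriv m (partialDeriv i φ) y else 0 := by
    intro P _ i
    by_cases h : P
    · simp [h, hd i]
    · simp [h, partialDeriv_const]
  simp only [flatGamma, sub_eq_add_neg]
  have hneg : ∀ y, -(if i = j then partialDeriv k φ y else 0) =
    (-1) * (if i = j then partialDeriv k φ y else 0) := fun y => by ring
  simp only [hneg]
  rw [partialDeriv_add ((hite _ _).1.fun_add (hite _ _).1) ((hite _ _).1.const_mul _),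
    partialDeriv_add (hite _ _).1 (hite _ _).1, partialDeriv_const_mul _ (hite _ _).1, (hite _ _).2,
    (hite _ _).2, (hite _ _).2]
  ring

lemma localScalarCurvature_conformal (hφ : ContDiff ℝ ∞ φ)
    (hG : ∀ y, G y = Real.exp (2 * φ y) • (1 : Matrix (Fin n) (Fin n) ℝ))
    (y : EuclideanSpace ℝ (Fin n)) :
    localScalarCurvature G y = -((n : ℝ) - 1) * Real.exp (-(2 * φ y)) *
      ∑ i, (2 * partialDeriv i (partialDeriv i φ) y + (n - 2) * partialDeriv i φ y ^ 2) := by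
  have hinv : (G y)⁻¹ = Real.exp (-(2 * φ y)) • (1 : Matrix (Fin n) (Fin n) ℝ) := by
    refine Matrix.inv_eq_left_inv ?_
    rw [hG, smul_mul_smul_comm, ← Real.exp_add]; simp
  simp only [localScalarCurvature, hinv, Matrix.smul_apply, Matrix.one_apply, smul_eq_mul, mul_ite,
    mul_one, mul_zero, ite_mul, zero_mul, Finset.sum_ite_eq, Finset.mem_univ, if_true,
    ← Finset.mul_sum]
  simp only [localRicci, christoffel_conformal hφ hG, partialDeriv_flatGamma hφ,
    Finset.sum_add_distrib]
  rw [sum_flatGamma_deriv fun m i => partialDeriv m (partialDeriv i φ) y]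
  have := sum_flatGamma_mul_sub fun i => partialDeriv i φ y
  rw [this, ← Finset.mul_sum, ← Finset.mul_sum]
  ring

lemma localLaplacian_conformal (hφ : ContDiff ℝ ∞ φ)
    (hG : ∀ y, G y = Real.exp (2 * φ y) • (1 : Matrix (Fin n) (Fin n) ℝ))
    (y : EuclideanSpace ℝ (Fin n)) :
    localLaplacian G V y = -Real.exp (-(2 * φ y)) *
      ∑ i, (partialDeriv i (partialDeriv i V) y +
        (n - 2) * (partialDeriv i φ y * partialDeriv i V y)) := by
  have hinv : (G y)⁻¹ = Real.exp (-(2 * φ y)) • (1 : Matrix (Fin n) (Fin n) ℝ) := by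
    refine Matrix.inv_eq_left_inv ?_
    rw [hG, smul_mul_smul_comm, ← Real.exp_add]; simp
  simp only [localLaplacian, hinv, Matrix.smul_apply, Matrix.one_apply, smul_eq_mul, mul_ite,
    mul_one, mul_zero, ite_mul, zero_mul, Finset.sum_ite_eq, Finset.mem_univ, if_true,
    ← Finset.mul_sum]
  rw [neg_mul]
  congr 2
  have h2 : ∀ l i, flatGamma (fun i => partialDeriv i φ y) l i i =
      2 * (if i = l then partialDeriv l φ y else 0) - partialDeriv l φ y := by
    intro l i
    by_cases h : i = l
    · subst h; simp [flatGamma]; ring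
    · simp [flatGamma, h]
  simp only [christoffel_conformal hφ hG, h2, sub_mul, Finset.sum_sub_distrib, mul_assoc,
    ← Finset.mul_sum, ite_mul, zero_mul, Finset.sum_ite_eq, Finset.mem_univ, if_true,
    Finset.sum_const, Finset.card_univ, Fintype.card_fin, nsmul_eq_mul, Finset.sum_add_distrib]
  ring

/-- Conformal covariance of the Yamabe operator, for conformally flat metrics. -/
theorem yamabe_conformal (hn : 3 ≤ n) {ρ : EuclideanSpace ℝ (Fin n) → ℝ} (hρ : ContDiff ℝ ∞ ρ)
    (hpos : ∀ y, 0 < ρ y) (hV : ContDiff ℝ ∞ V)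
    (hG : ∀ y, G y = ρ y • (1 : Matrix (Fin n) (Fin n) ℝ)) (y : EuclideanSpace ℝ (Fin n)) :
    4 * ((n : ℝ) - 1) / (n - 2) * localLaplacian G V y + localScalarCurvature G y * V y =
      -(4 * ((n : ℝ) - 1) / (n - 2)) * ρ y ^ (-(((n : ℝ) + 2) / 4)) *
        ∑ i, partialDeriv i (partialDeriv i fun z => ρ z ^ (((n : ℝ) - 2) / 4) * V z) y := by
  have hn2 : (n : ℝ) - 2 ≠ 0 := by
    have : (3 : ℝ) ≤ n := by exact_mod_cast hn
    linarith
  let φ : EuclideanSpace ℝ (Fin n) → ℝ := fun y => (1 / 2) * Real.log (ρ y)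
  have hφ : ContDiff ℝ ∞ φ := contDiff_const.mul (hρ.log fun y => (hpos y).ne')
  have he : ∀ y, ρ y = Real.exp (2 * φ y) := fun y => by
    simp only [φ]
    rw [← mul_assoc]; norm_num [Real.exp_log (hpos y)]
  have hG' : ∀ y, G y = Real.exp (2 * φ y) • (1 : Matrix (Fin n) (Fin n) ℝ) := fun y => by
    rw [hG, ← he]
  have hr : ∀ (r : ℝ) y, ρ y ^ r = Real.exp (2 * r * φ y) := fun r y => by
    rw [he, ← Real.exp_mul]; congr 1; ring
  rw [localLaplacian_conformal hφ hG', localScalarCurvature_conformal hφ hG', hr]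
  -- With this exponent the cross term 2b ∂φ ∂V of ∂²(e^{bφ} V) is the first-order term (n-2) ∂φ ∂V
  -- of the Laplacian.
  set b : ℝ := ((n : ℝ) - 2) / 2 with hb
  have hψ : (fun z => ρ z ^ (((n : ℝ) - 2) / 4) * V z) = fun z => Real.exp (b * φ z) * V z := by
    ext z; rw [hr]; congr 3; rw [hb]; ring
  rw [hψ]
  have dφ : Differentiable ℝ φ := hφ.differentiable (by simp)
  have dV : Differentiable ℝ V := hV.differentiable (by simp)
  have dφi : ∀ i, Differentiable ℝ (partialDeriv i φ) := fun i =>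
    (contDiff_partialDeriv hφ i).differentiable (by simp)
  have dVi : ∀ i, Differentiable ℝ (partialDeriv i V) := fun i =>
    (contDiff_partialDeriv hV i).differentiable (by simp)
  have dE : Differentiable ℝ fun z => Real.exp (b * φ z) := (dφ.const_mul b).exp
  have pE : ∀ i y, partialDeriv i (fun z => Real.exp (b * φ z)) y =
      Real.exp (b * φ y) * (b * partialDeriv i φ y) := by
    intro i y
    rw [partialDeriv_comp (h := fun t => Real.exp (b * t)) (h' := Real.exp (b * φ y) * b) dφ]
    · ring
    · simpa using ((hasDerivAt_id (φ y)).const_mul b).exp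
  have p1 : ∀ i, partialDeriv i (fun z => Real.exp (b * φ z) * V z) = fun y =>
      Real.exp (b * φ y) * (partialDeriv i V y + b * partialDeriv i φ y * V y) := by
    intro i
    ext y
    rw [partialDeriv_mul dE dV, pE]; ring
  -- The zeroth-order part b ∂²φ + b² (∂φ)² equals (b/2)(2 ∂²φ + (n-2)(∂φ)²), the integrand of the
  -- scalar curvature; 4(n-1)/(n-2) · b/2 = n-1 matches its coefficient.
  have p2 : ∀ i, partialDeriv i (partialDeriv i (fun z => Real.exp (b * φ z) * V z)) y =
      Real.exp (b * φ y) * ((partialDeriv i (partialDeriv i V) y +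
        (n - 2) * (partialDeriv i φ y * partialDeriv i V y)) + (b / 2) *
        (2 * partialDeriv i (partialDeriv i φ) y + (n - 2) * partialDeriv i φ y ^ 2) * V y) := by
    intro i
    rw [p1, partialDeriv_mul dE ((dVi i).fun_add (((dφi i).const_mul b).fun_mul dV)), pE,
      partialDeriv_add (dVi i) (((dφi i).const_mul b).fun_mul dV),
      partialDeriv_mul ((dφi i).const_mul b) dV, partialDeriv_const_mul b (dφi i), hb]
    ring
  simp only [p2, ← Finset.mul_sum]
  have hexp : Real.exp (2 * -(((n : ℝ) + 2) / 4) * φ y) * Real.exp (b * φ y) =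
      Real.exp (-(2 * φ y)) := by
    rw [← Real.exp_add, hb]; congr 1; ring
  have hsum : ∀ A B : Fin n → ℝ, ∑ i, (A i + b / 2 * B i * V y) =
      ∑ i, A i + b / 2 * (∑ i, B i) * V y := fun A B => by
    rw [Finset.sum_add_distrib, ← Finset.sum_mul, ← Finset.mul_sum]
  rw [hsum, mul_assoc (-_) _ (_ * _), ← mul_assoc (Real.exp _) (Real.exp _), hexp, hb]
  field_simp
  ring

end ConformallyFlat

/-! ### Stereographic charts -/

section Stereographic

variable {n : ℕ}

/-- The isometry of `ℝⁿ` onto the tangent hyperplane at `p` used by the chart around `p`. -/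
noncomputable def stereoIso (p : Sph n) :
    EuclideanSpace ℝ (Fin n) →ₗᵢ[ℝ] EuclideanSpace ℝ (Fin (n + 1)) :=
  have := Fact.mk (@finrank_euclideanSpace_fin ℝ _ (n + 1))
  (ℝ ∙ ((-p : Sph n) : EuclideanSpace ℝ (Fin (n + 1))))ᗮ.subtypeₗᵢ.comp
    (OrthonormalBasis.fromOrthogonalSpanSingleton n
      (ne_zero_of_mem_unit_sphere (-p))).repr.symm.toLinearIsometry

/-- The inverse of the stereographic chart around `p`, with values in the ambient space. -/
noncomputable def stereoMap (p : Sph n) (y : EuclideanSpace ℝ (Fin n)) :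
    EuclideanSpace ℝ (Fin (n + 1)) :=
  bubble y • (stereoIso p y + (2 : ℝ) • (p : EuclideanSpace ℝ (Fin (n + 1)))) - p

lemma inner_stereoIso (p : Sph n) (y : EuclideanSpace ℝ (Fin n)) :
    inner ℝ (stereoIso p y) (p : EuclideanSpace ℝ (Fin (n + 1))) = 0 := by
  have := Fact.mk (@finrank_euclideanSpace_fin ℝ _ (n + 1))
  have h : stereoIso p y ∈ (ℝ ∙ ((-p : Sph n) : EuclideanSpace ℝ (Fin (n + 1))))ᗮ :=
    Subtype.mem _
  rw [Submodule.mem_orthogonal_singleton_iff_inner_left] at h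
  simpa using h

lemma norm_sphere_coe (p : Sph n) : ‖(p : EuclideanSpace ℝ (Fin (n + 1)))‖ = 1 :=
  norm_eq_of_mem_sphere p

lemma extChartAt_target_sphere (p : Sph n) : (extChartAt (𝓡 n) p).target = univ := by
  have := Fact.mk (@finrank_euclideanSpace_fin ℝ _ (n + 1))
  rw [extChartAt_target]
  simp only [modelWithCornersSelf_coe_symm, preimage_id, modelWithCornersSelf_coe, range_id,
    inter_univ]
  exact stereographic'_target (-p)

lemma extChartAt_source_sphere (p : Sph n) : (extChartAt (𝓡 n) p).source = {-p}ᶜ := by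
  have := Fact.mk (@finrank_euclideanSpace_fin ℝ _ (n + 1))
  rw [extChartAt_source]
  exact stereographic'_source (-p)

/-- The preferred chart at p is the stereographic projection from -p: p sits at the origin and the
target is all of ℝⁿ, so one explicit formula holds globally. -/
lemma coe_extChartAt_symm (p : Sph n) (y : EuclideanSpace ℝ (Fin n)) :
    ((extChartAt (𝓡 n) p).symm y : EuclideanSpace ℝ (Fin (n + 1))) = stereoMap p y := by
  have := Fact.mk (@finrank_euclideanSpace_fin ℝ _ (n + 1))
  have h : ((extChartAt (𝓡 n) p).symm y : EuclideanSpace ℝ (Fin (n + 1))) =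
      (‖stereoIso p y‖ ^ 2 + 4)⁻¹ • (4 : ℝ) • stereoIso p y +
        (‖stereoIso p y‖ ^ 2 + 4)⁻¹ • (‖stereoIso p y‖ ^ 2 - 4) •
          ((-p : Sph n) : EuclideanSpace ℝ (Fin (n + 1))) :=
    stereographic'_symm_apply (-p) y
  rw [h, (stereoIso p).norm_map, stereoMap]
  have hb : bubble y = 4 * (‖y‖ ^ 2 + 4)⁻¹ := by
    rw [bubble]; field_simp; ring
  have hq : (‖y‖ ^ 2 + 4)⁻¹ * (‖y‖ ^ 2 + 4) = 1 := inv_mul_cancel₀ (by positivity)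
  have hq' : (‖y‖ ^ 2 + 4)⁻¹ * (‖y‖ ^ 2 - 4) = 1 - 2 * (4 * (‖y‖ ^ 2 + 4)⁻¹) := by
    linear_combination hq
  have hneg : ((-p : Sph n) : EuclideanSpace ℝ (Fin (n + 1))) = -p := rfl
  rw [hb, smul_smul, smul_smul, hq', hneg]
  module

lemma extChartAt_symm_left (p : Sph n) (y : EuclideanSpace ℝ (Fin n)) :
    extChartAt (𝓡 n) p ((extChartAt (𝓡 n) p).symm y) = y :=
  (extChartAt (𝓡 n) p).right_inv (by rw [extChartAt_target_sphere]; trivial)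

lemma contMDiff_extChartAt_symm_sphere (p : Sph n) :
    ContMDiff (𝓡 n) (𝓡 n) ∞ (extChartAt (𝓡 n) p).symm := by
  have := contMDiffOn_extChartAt_symm (I := 𝓡 n) (n := ∞) p
  rwa [extChartAt_target_sphere, contMDiffOn_univ] at this

lemma continuous_extChartAt_symm_sphere (p : Sph n) : Continuous (extChartAt (𝓡 n) p).symm :=
  (contMDiff_extChartAt_symm_sphere p).continuous

lemma contDiff_stereoMap (p : Sph n) : ContDiff ℝ ∞ (stereoMap p) := by
  unfold stereoMap
  exact (contDiff_bubble.smul ((stereoIso p).contDiff.add contDiff_const)).sub contDiff_const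

lemma norm_stereoMap (p : Sph n) (y : EuclideanSpace ℝ (Fin n)) : ‖stereoMap p y‖ = 1 := by
  rw [← coe_extChartAt_symm]; exact norm_sphere_coe _

/-- The differential of `stereoMap`. -/
noncomputable def stereoDeriv (p : Sph n) (y v : EuclideanSpace ℝ (Fin n)) :
    EuclideanSpace ℝ (Fin (n + 1)) :=
  bubble y • stereoIso p v - (bubble y ^ 2 / 2 * inner ℝ y v) •
    (stereoIso p y + (2 : ℝ) • (p : EuclideanSpace ℝ (Fin (n + 1))))

lemma hasFDerivAt_bubble (y : EuclideanSpace ℝ (Fin n)) :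
    HasFDerivAt (bubble (n := n)) ((-(bubble y ^ 2 / 2)) • innerSL ℝ y) y := by
  have := hasFDerivAt_bubble_rpow 1 y
  simp only [Real.rpow_one] at this
  refine this.congr_fderiv ?_
  rw [show (1 : ℝ) + 1 = (2 : ℕ) by norm_num, Real.rpow_natCast]
  congr 1
  ring

lemma fderiv_stereoMap (p : Sph n) (y v : EuclideanSpace ℝ (Fin n)) :
    fderiv ℝ (stereoMap p) y v = stereoDeriv p y v := by
  have h := ((hasFDerivAt_bubble y).smul
    (((stereoIso p).toContinuousLinearMap.hasFDerivAt (x := y)).add_const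
      ((2 : ℝ) • (p : EuclideanSpace ℝ (Fin (n + 1)))))).sub_const
      (p : EuclideanSpace ℝ (Fin (n + 1)))
  have e : fderiv ℝ (stereoMap p) y = _ := h.fderiv
  rw [e, stereoDeriv]
  simp only [add_apply, smul_apply, ContinuousLinearMap.smulRight_apply, innerSL_apply_apply,
    smul_eq_mul, LinearIsometry.coe_toContinuousLinearMap]
  module

/-- Conformality of stereographic projection: the quadratic terms cancel because bubble · |y|² = 4 -
4 bubble. -/
lemma inner_stereoDeriv (p : Sph n) (y u v : EuclideanSpace ℝ (Fin n)) :
    inner ℝ (stereoDeriv p y u) (stereoDeriv p y v) = bubble y ^ 2 * inner ℝ u v := by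
  have hb : bubble y * ‖y‖ ^ 2 = 4 - 4 * bubble y := by linear_combination 4 * bubble_mul y
  have hp : inner ℝ (p : EuclideanSpace ℝ (Fin (n + 1))) (p : EuclideanSpace ℝ (Fin (n + 1))) =
      (1 : ℝ) := by
    rw [real_inner_self_eq_norm_sq, norm_sphere_coe]; norm_num
  have h0 := inner_stereoIso p
  have h0' : ∀ y, inner ℝ (p : EuclideanSpace ℝ (Fin (n + 1))) (stereoIso p y) = 0 := fun y => by
    rw [real_inner_comm]; exact h0 y
  simp only [stereoDeriv, inner_sub_left, inner_sub_right, inner_add_left, inner_add_right,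
    real_inner_smul_left, real_inner_smul_right, (stereoIso p).inner_map_map, h0, h0', hp,
    real_inner_self_eq_norm_sq y, real_inner_comm y u]
  rw [real_inner_comm u y]
  linear_combination (bubble y ^ 3 / 4 * inner ℝ u y * inner ℝ y v) * hb

lemma dIncl_mfderiv (p : Sph n) (y v : EuclideanSpace ℝ (Fin n)) :
    dIncl n ((extChartAt (𝓡 n) p).symm y) (mfderiv (𝓡 n) (𝓡 n) (extChartAt (𝓡 n) p).symm y v) =
      stereoDeriv p y v := by
  have := Fact.mk (@finrank_euclideanSpace_fin ℝ _ (n + 1))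
  have h1 : MDifferentiableAt (𝓡 n) (𝓡 n) (extChartAt (𝓡 n) p).symm y :=
    (contMDiff_extChartAt_symm_sphere p).mdifferentiable (by simp) y
  have h2 : MDifferentiableAt (𝓡 n) 𝓘(ℝ, EuclideanSpace ℝ (Fin (n + 1)))
      (fun z : Sph n => (z : EuclideanSpace ℝ (Fin (n + 1)))) ((extChartAt (𝓡 n) p).symm y) :=
    (contMDiff_coe_sphere (m := 1) _).mdifferentiableAt (by simp)
  have h3 := mfderiv_comp y h2 h1
  have h4 : (fun z : Sph n => (z : EuclideanSpace ℝ (Fin (n + 1)))) ∘ (extChartAt (𝓡 n) p).symm =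
      stereoMap p := funext fun y => coe_extChartAt_symm p y
  rw [h4, mfderiv_eq_fderiv] at h3
  rw [← fderiv_stereoMap, h3]
  rfl

variable {h : RiemMetric n (Sph n)} {F : Sph n → ℝ}

/-- Every metric in the round conformal class is thus conformally flat in each chart, and curvature
and Laplacian fall under `yamabe_conformal`. -/
lemma metricCoeff_conformal
    (hF : ∀ x, ∀ v w : TangentSpace (𝓡 n) x, h.inner x v w = F x * (roundMetric n).inner x v w)
    (p : Sph n) (y : EuclideanSpace ℝ (Fin n)) :
    metricCoeff h p y = (bubble y ^ 2 * F ((extChartAt (𝓡 n) p).symm y)) •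
      (1 : Matrix (Fin n) (Fin n) ℝ) := by
  ext i j
  rw [metricCoeff, Matrix.of_apply, hF]
  have : (roundMetric n).inner = roundInner n := rfl
  rw [this, roundInner_apply]
  erw [dIncl_mfderiv, dIncl_mfderiv]
  rw [inner_stereoDeriv, Matrix.smul_apply, Matrix.one_apply, EuclideanSpace.inner_single_left]
  simp
  split_ifs <;> ring

end Stereographic

/-! ### The flat Laplacian in stereographic coordinates -/

section SphereOperator

variable {n : ℕ}

/-- The expression `e_i e_i` of second derivatives of `stereoMap`. -/
noncomputable def stereoDeriv2 (p : Sph n) (i : Fin n) (y : EuclideanSpace ℝ (Fin n)) :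
    EuclideanSpace ℝ (Fin (n + 1)) :=
  -(bubble y ^ 2 * y i) • stereoIso p (EuclideanSpace.single i 1) +
    (bubble y ^ 3 * y i ^ 2 / 2 - bubble y ^ 2 / 2) •
      (stereoIso p y + (2 : ℝ) • (p : EuclideanSpace ℝ (Fin (n + 1))))

lemma fderiv_stereoDeriv (p : Sph n) (i : Fin n) (y : EuclideanSpace ℝ (Fin n)) :
    ∃ D : EuclideanSpace ℝ (Fin n) →L[ℝ] EuclideanSpace ℝ (Fin (n + 1)),
      HasFDerivAt (fun y => stereoDeriv p y (EuclideanSpace.single i 1)) D y ∧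
      D (EuclideanSpace.single i 1) = stereoDeriv2 p i y := by
  have hb := hasFDerivAt_bubble y
  have hη := ((stereoIso p).toContinuousLinearMap.hasFDerivAt (x := y)).add_const
      ((2 : ℝ) • (p : EuclideanSpace ℝ (Fin (n + 1))))
  have hi : HasFDerivAt (fun y : EuclideanSpace ℝ (Fin n) => y i)
      (EuclideanSpace.proj (𝕜 := ℝ) i) y := (EuclideanSpace.proj (𝕜 := ℝ) i).hasFDerivAt
  have h1 := hb.smul_const (stereoIso p (EuclideanSpace.single i 1))
  have h2 := (((hb.pow 2).const_mul (1 / 2)).mul hi).smul hη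
  refine ⟨_, (h1.sub h2).congr_of_eventuallyEq (Eventually.of_forall fun z => ?_), ?_⟩
  · simp only [stereoDeriv, EuclideanSpace.inner_single_right]
    simp
    module
  · simp only [sub_apply, add_apply, smul_apply, ContinuousLinearMap.smulRight_apply,
      innerSL_apply_apply, LinearIsometry.coe_toContinuousLinearMap, stereoDeriv2,
      EuclideanSpace.inner_single_right]
    simp
    module

variable {E : EuclideanSpace ℝ (Fin (n + 1)) → ℝ}

lemma contDiff_comp_stereoMap (hE : ∀ z, ‖z‖ = 1 → ContDiffAt ℝ ∞ E z) (p : Sph n) :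
    ContDiff ℝ ∞ fun y => E (stereoMap p y) :=
  contDiff_iff_contDiffAt.2 fun y =>
    (hE _ (norm_stereoMap p y)).comp y (contDiff_stereoMap p).contDiffAt

lemma partialDeriv_comp_stereoMap (hE : ∀ z, ‖z‖ = 1 → ContDiffAt ℝ ∞ E z) (p : Sph n)
    (i : Fin n) :
    partialDeriv i (fun y => E (stereoMap p y)) = fun y =>
      fderiv ℝ E (stereoMap p y) (stereoDeriv p y (EuclideanSpace.single i 1)) := by
  ext y
  have h1 : DifferentiableAt ℝ E (stereoMap p y) :=
    (hE _ (norm_stereoMap p y)).differentiableAt (by simp)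
  have h2 : DifferentiableAt ℝ (stereoMap p) y :=
    ((contDiff_stereoMap p).differentiable (by simp)) y
  have := fderiv_comp y h1 h2
  rw [partialDeriv]
  change fderiv ℝ (E ∘ stereoMap p) y _ = _
  rw [this, ContinuousLinearMap.comp_apply, fderiv_stereoMap]

lemma partialDeriv_partialDeriv_comp_stereoMap (hE : ∀ z, ‖z‖ = 1 → ContDiffAt ℝ ∞ E z)
    (p : Sph n) (i : Fin n) (y : EuclideanSpace ℝ (Fin n)) :
    partialDeriv i (partialDeriv i (fun y => E (stereoMap p y))) y =
      fderiv ℝ (fderiv ℝ E) (stereoMap p y) (stereoDeriv p y (EuclideanSpace.single i 1))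
        (stereoDeriv p y (EuclideanSpace.single i 1)) +
      fderiv ℝ E (stereoMap p y) (stereoDeriv2 p i y) := by
  obtain ⟨D, hD, hDe⟩ := fderiv_stereoDeriv p i y
  have h1 : DifferentiableAt ℝ (fderiv ℝ E) (stereoMap p y) :=
    ((hE _ (norm_stereoMap p y)).fderiv_right (m := ∞) (by simp)).differentiableAt (by simp)
  have h2 : DifferentiableAt ℝ (stereoMap p) y :=
    ((contDiff_stereoMap p).differentiable (by simp)) y
  have h3 := (h1.hasFDerivAt.comp y h2.hasFDerivAt).clm_apply hD
  rw [partialDeriv_comp_stereoMap hE, partialDeriv]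
  have h4 := h3.fderiv
  simp only [Function.comp_apply] at h4
  rw [h4]
  simp only [add_apply, ContinuousLinearMap.comp_apply, ContinuousLinearMap.flip_apply,
    fderiv_stereoMap, hDe]
  ring

/-- The function on `ℝⁿ` which corresponds to the function `E` on the sphere under the conformal
change from the round to the flat metric. -/
noncomputable def flatten (E : EuclideanSpace ℝ (Fin (n + 1)) → ℝ) (p : Sph n)
    (y : EuclideanSpace ℝ (Fin n)) : ℝ :=
  bubble y ^ (((n : ℝ) - 2) / 2) * E (stereoMap p y)

lemma contDiff_flatten (hE : ∀ z, ‖z‖ = 1 → ContDiffAt ℝ ∞ E z) (p : Sph n) :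
    ContDiff ℝ ∞ (flatten E p) :=
  (contDiff_bubble_rpow _).mul (contDiff_comp_stereoMap hE p)

lemma partialDeriv_flatten (hE : ∀ z, ‖z‖ = 1 → ContDiffAt ℝ ∞ E z) (p : Sph n) (i : Fin n)
    (y : EuclideanSpace ℝ (Fin n)) :
    partialDeriv i (flatten E p) y = bubble y ^ (((n : ℝ) - 2) / 2) *
      (fderiv ℝ E (stereoMap p y) (stereoDeriv p y (EuclideanSpace.single i 1)) -
        ((n : ℝ) - 2) / 4 * (y i * bubble y) * E (stereoMap p y)) := by
  unfold flatten
  rw [partialDeriv_mul ((contDiff_bubble_rpow _).differentiable (by simp))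
    ((contDiff_comp_stereoMap hE p).differentiable (by simp)), partialDeriv_comp_stereoMap hE,
    partialDeriv_bubble_rpow, Real.rpow_add_one (bubble_pos y).ne']
  ring

lemma partialDeriv_partialDeriv_flatten (hE : ∀ z, ‖z‖ = 1 → ContDiffAt ℝ ∞ E z) (p : Sph n)
    (i : Fin n) (y : EuclideanSpace ℝ (Fin n)) :
    partialDeriv i (partialDeriv i (flatten E p)) y = bubble y ^ (((n : ℝ) - 2) / 2) *
      (fderiv ℝ (fderiv ℝ E) (stereoMap p y) (stereoDeriv p y (EuclideanSpace.single i 1))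
        (stereoDeriv p y (EuclideanSpace.single i 1)) +
      fderiv ℝ E (stereoMap p y) (stereoDeriv2 p i y) -
        ((n : ℝ) - 2) / 2 * (y i * bubble y) *
          fderiv ℝ E (stereoMap p y) (stereoDeriv p y (EuclideanSpace.single i 1)) +
        (((n : ℝ) - 2) * n / 16 * (y i * bubble y) ^ 2 - ((n : ℝ) - 2) / 4 * bubble y) *
          E (stereoMap p y)) := by
  set a : ℝ := ((n : ℝ) - 2) / 2 with ha
  have db : ∀ r : ℝ, Differentiable ℝ fun y : EuclideanSpace ℝ (Fin n) => bubble y ^ r := fun r =>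
    (contDiff_bubble_rpow r).differentiable (by simp)
  have hf := contDiff_comp_stereoMap hE p
  have df : Differentiable ℝ fun y => E (stereoMap p y) := hf.differentiable (by simp)
  have dfi : Differentiable ℝ (partialDeriv i fun y => E (stereoMap p y)) :=
    (contDiff_partialDeriv hf i).differentiable (by simp)
  have dyi : Differentiable ℝ fun y : EuclideanSpace ℝ (Fin n) => y i := by fun_prop
  have pyi : partialDeriv i (fun y : EuclideanSpace ℝ (Fin n) => y i) y = 1 := by
    have : (fun y : EuclideanSpace ℝ (Fin n) => y i) = EuclideanSpace.proj (𝕜 := ℝ) i := rfl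
    rw [partialDeriv, this, ContinuousLinearMap.fderiv]
    simp
  have h1 : partialDeriv i (flatten E p) = fun y =>
      bubble y ^ a * partialDeriv i (fun y => E (stereoMap p y)) y +
        (-(a / 2) * y i) * bubble y ^ (a + 1) * E (stereoMap p y) := by
    ext y
    unfold flatten
    rw [partialDeriv_mul (db _) df, partialDeriv_bubble_rpow]
  have dm : Differentiable ℝ fun y : EuclideanSpace ℝ (Fin n) =>
      (-(a / 2) * y i) * bubble y ^ (a + 1) := (dyi.const_mul _).fun_mul (db _)
  have pm : partialDeriv i (fun y : EuclideanSpace ℝ (Fin n) =>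
      (-(a / 2) * y i) * bubble y ^ (a + 1)) y =
      bubble y ^ a * (a * (a + 1) / 4 * (y i * bubble y) ^ 2 - a / 2 * bubble y) := by
    rw [partialDeriv_mul (dyi.const_mul _) (db _), partialDeriv_const_mul _ dyi, pyi,
      partialDeriv_bubble_rpow, Real.rpow_add_one (bubble_pos y).ne',
      Real.rpow_add_one (bubble_pos y).ne']
    ring
  rw [h1, partialDeriv_add ((db _).fun_mul dfi) (dm.fun_mul df), partialDeriv_mul (db _) dfi,
    partialDeriv_mul dm df, pm, partialDeriv_partialDeriv_comp_stereoMap hE,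
    partialDeriv_comp_stereoMap hE, partialDeriv_bubble_rpow, Real.rpow_add_one (bubble_pos y).ne',
    ha]
  ring

/-- The images of the e_i span the hyperplane orthogonal to p, so with p they form an orthonormal
basis; the trace of B does not depend on the basis. -/
lemma trace_stereo (p : Sph n)
    (B : EuclideanSpace ℝ (Fin (n + 1)) →L[ℝ] EuclideanSpace ℝ (Fin (n + 1)) →L[ℝ] ℝ) :
    ∑ i, B (stereoIso p (EuclideanSpace.single i 1)) (stereoIso p (EuclideanSpace.single i 1)) +
      B p p = ∑ j, B (EuclideanSpace.single j 1) (EuclideanSpace.single j 1) := by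
  let A : EuclideanSpace ℝ (Fin (n + 1)) →ₗ[ℝ] EuclideanSpace ℝ (Fin (n + 1)) :=
    ((InnerProductSpace.toDual ℝ (EuclideanSpace ℝ (Fin (n + 1)))).symm.toLinearEquiv.toLinearMap).comp
      B.toLinearMap
  have hA : ∀ u, inner ℝ u (A u) = B u u := fun u => by
    rw [real_inner_comm]
    exact InnerProductSpace.toDual_symm_apply
  let v : Fin (n + 1) → EuclideanSpace ℝ (Fin (n + 1)) :=
    Fin.cons (p : EuclideanSpace ℝ (Fin (n + 1))) fun i => stereoIso p (EuclideanSpace.single i 1)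
  have hv : Orthonormal ℝ v := by
    rw [orthonormal_iff_ite]
    intro i j
    refine Fin.cases ?_ (fun i => ?_) i <;> refine Fin.cases ?_ (fun j => ?_) j
    · simp [v]
    · simp only [v, Fin.cons_zero, Fin.cons_succ]
      rw [real_inner_comm, inner_stereoIso, if_neg (Fin.succ_ne_zero j).symm]
    · simp only [v, Fin.cons_zero, Fin.cons_succ]
      rw [inner_stereoIso, if_neg (Fin.succ_ne_zero i)]
    · simp only [v, Fin.cons_succ, (stereoIso p).inner_map_map, Fin.succ_inj]
      rw [EuclideanSpace.inner_single_left]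
      simp
  have hcard : Fintype.card (Fin (n + 1)) = Module.finrank ℝ (EuclideanSpace ℝ (Fin (n + 1))) := by
    simp
  let b := (basisOfOrthonormalOfCardEqFinrank hv hcard).toOrthonormalBasis
    (by rw [coe_basisOfOrthonormalOfCardEqFinrank]; exact hv)
  have hb : ∀ j, b j = v j := fun j => by
    simp only [b, Module.Basis.coe_toOrthonormalBasis, coe_basisOfOrthonormalOfCardEqFinrank]
  have h1 := A.trace_eq_sum_inner b
  have h2 := A.trace_eq_sum_inner (EuclideanSpace.basisFun (Fin (n + 1)) ℝ)
  rw [h1, Fin.sum_univ_succ] at h2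
  simp only [hb, hA, v, Fin.cons_zero, Fin.cons_succ, EuclideanSpace.basisFun_apply] at h2
  rw [add_comm]
  exact h2

/-- The conformal Laplacian of the round sphere, up to a constant factor, expressed by the ambient
derivatives of `E`. -/
noncomputable def sphereOp (E : EuclideanSpace ℝ (Fin (n + 1)) → ℝ)
    (z : EuclideanSpace ℝ (Fin (n + 1))) : ℝ :=
  ∑ j, fderiv ℝ (fderiv ℝ E) z (EuclideanSpace.single j 1) (EuclideanSpace.single j 1) -
    fderiv ℝ (fderiv ℝ E) z z z - n * fderiv ℝ E z z - n * ((n : ℝ) - 2) / 4 * E z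

/-- Conformal covariance between the flat and the round Laplacian. In `sphereOp` the ambient
Laplacian minus second and n times first radial derivative is the spherical Laplacian, and n(n-2)/4
is the curvature term. -/
theorem sum_partialDeriv_flatten (hE : ∀ z, ‖z‖ = 1 → ContDiffAt ℝ ∞ E z) (p : Sph n)
    (y : EuclideanSpace ℝ (Fin n)) :
    ∑ i, partialDeriv i (partialDeriv i (flatten E p)) y =
      bubble y ^ (((n : ℝ) + 2) / 2) * sphereOp E (stereoMap p y) := by
  set z := stereoMap p y with hz
  set B := fderiv ℝ (fderiv ℝ E) z with hB
  set d := fderiv ℝ E z with hd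
  set P : EuclideanSpace ℝ (Fin (n + 1)) := p.val with hP
  set η := stereoIso p y + (2 : ℝ) • P with hη
  set θ := bubble y with hθ
  let e : Fin n → EuclideanSpace ℝ (Fin (n + 1)) := fun i =>
    stereoIso p (EuclideanSpace.single i 1)
  have hι : stereoIso p y = η - (2 : ℝ) • P := by rw [hη]; abel
  have hsum : ∑ i, y i • e i = stereoIso p y := by
    have : y = ∑ i, y i • EuclideanSpace.single i (1 : ℝ) := by
      have := (EuclideanSpace.basisFun (Fin n) ℝ).sum_repr y
      simpa using this.symm
    conv_rhs => rw [this]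
    simp [e, map_sum]
  have hsd : ∀ i, stereoDeriv p y (EuclideanSpace.single i 1) =
      θ • e i - (θ ^ 2 / 2 * y i) • η := fun i => by
    simp only [stereoDeriv, e]
    rw [EuclideanSpace.inner_single_right]
    simp [hη, hθ, hP]
  have hsd2 : ∀ i, stereoDeriv2 p i y = -(θ ^ 2 * y i) • e i +
      (θ ^ 3 * y i ^ 2 / 2 - θ ^ 2 / 2) • η := fun i => rfl
  have hzη : z = θ • η - P := rfl
  have hsq : ∑ i, y i ^ 2 = ‖y‖ ^ 2 := (EuclideanSpace.real_norm_sq_eq y).symm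
  -- All sums over i are expressed by η and P, where z = θ η - P; this relation then eliminates |y|²
  -- and is the only one needed.
  have hb : θ * ‖y‖ ^ 2 = 4 - 4 * θ := by linear_combination 4 * bubble_mul y
  have s1 : ∑ i, y i * B (e i) η = B η η - 2 * B P η := by
    have : ∑ i, y i * B (e i) η = B (∑ i, y i • e i) η := by simp [map_sum, sum_apply]
    rw [this, hsum, hι]; simp
  have s2 : ∑ i, y i * B η (e i) = B η η - 2 * B η P := by
    have : ∑ i, y i * B η (e i) = B η (∑ i, y i • e i) := by simp [map_sum]
    rw [this, hsum, hι]; simp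
  have s3 : ∑ i, y i * d (e i) = d η - 2 * d P := by
    have : ∑ i, y i * d (e i) = d (∑ i, y i • e i) := by simp [map_sum]
    rw [this, hsum, hι]; simp
  have htr : ∑ i, B (e i) (e i) = ∑ j, B (EuclideanSpace.single j 1) (EuclideanSpace.single j 1) -
      B P P := by rw [← trace_stereo p B]; simp [e, hP]
  have hterm : ∀ i, partialDeriv i (partialDeriv i (flatten E p)) y = θ ^ (((n : ℝ) - 2) / 2) *
      (θ ^ 2 * B (e i) (e i) - θ ^ 3 / 2 * (y i * B (e i) η) - θ ^ 3 / 2 * (y i * B η (e i)) +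
        θ ^ 4 / 4 * B η η * y i ^ 2 - n / 2 * θ ^ 2 * (y i * d (e i)) +
        n / 4 * θ ^ 3 * d η * y i ^ 2 - θ ^ 2 / 2 * d η +
        ((n : ℝ) - 2) * n / 16 * θ ^ 2 * E z * y i ^ 2 - ((n : ℝ) - 2) / 4 * θ * E z) := by
    intro i
    rw [partialDeriv_partialDeriv_flatten hE, ← hz, ← hB, ← hd, hsd, hsd2, ← hθ]
    simp only [map_sub, map_add, map_smul, sub_apply, smul_apply, smul_eq_mul]
    ring
  have h2 : θ ^ (((n : ℝ) + 2) / 2) = θ ^ (((n : ℝ) - 2) / 2) * θ ^ 2 := by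
    rw [← Real.rpow_natCast, ← Real.rpow_add (bubble_pos y)]; congr 1; push_cast; ring
  simp only [hterm, ← Finset.mul_sum, Finset.sum_add_distrib, Finset.sum_sub_distrib, s1, s2, s3,
    hsq, htr, Finset.sum_const, Finset.card_univ, Fintype.card_fin, nsmul_eq_mul]
  rw [h2, sphereOp, ← hB, ← hd, mul_assoc (θ ^ (((n : ℝ) - 2) / 2))]
  congr 1
  have e1 : B z z = θ ^ 2 * B η η - θ * B η P - θ * B P η + B P P := by
    rw [hzη]; simp only [map_sub, map_smul, sub_apply, smul_apply, smul_eq_mul]; ring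
  have e2 : d z = θ * d η - d P := by
    rw [hzη]; simp only [map_sub, map_smul, smul_eq_mul]
  rw [e1, e2]
  linear_combination (θ ^ 3 / 4 * B η η + n / 4 * θ ^ 2 * d η +
    ((n : ℝ) - 2) * n / 16 * θ * E z) * hb

end SphereOperator

/-! ### The Riemannian measure of a conformal metric -/

section Measure

variable {n : ℕ}

/-- L/c is a linear isometry, of determinant ±1. -/
lemma abs_det_of_inner_eq {c : ℝ} (hc : 0 < c)
    {L : EuclideanSpace ℝ (Fin n) →L[ℝ] EuclideanSpace ℝ (Fin n)}
    (hL : ∀ u v, inner ℝ (L u) (L v) = c ^ 2 * inner ℝ u v) : |L.det| = c ^ n := by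
  let I : EuclideanSpace ℝ (Fin n) →ₗᵢ[ℝ] EuclideanSpace ℝ (Fin n) :=
    { toLinearMap := c⁻¹ • L.toLinearMap
      norm_map' := fun v => by
        have h1 : ‖L v‖ = c * ‖v‖ := by
          have := hL v v
          rw [real_inner_self_eq_norm_sq, real_inner_self_eq_norm_sq, ← mul_pow] at this
          exact (pow_left_inj₀ (norm_nonneg _) (by positivity) two_ne_zero).1 this
        simp only [LinearMap.smul_apply, ContinuousLinearMap.coe_coe]
        rw [norm_smul, h1, Real.norm_of_nonneg (by positivity), inv_mul_cancel_left₀ hc.ne'] }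
  have h2 : L.toLinearMap = c • I.toLinearMap := by
    ext v : 1
    simp [I, hc.ne']
  have h3 : L.det = L.toLinearMap.det := rfl
  rw [h3, ← LinearMap.normDet_eq_abs_det, h2, LinearMap.normDet_smul, I.normDet_eq_one]
  simp [abs_of_pos hc]

lemma norm_stereoDeriv (p : Sph n) (y v : EuclideanSpace ℝ (Fin n)) :
    ‖stereoDeriv p y v‖ = bubble y * ‖v‖ := by
  have := inner_stereoDeriv p y v v
  rw [real_inner_self_eq_norm_sq, real_inner_self_eq_norm_sq, ← mul_pow] at this
  exact (pow_left_inj₀ (norm_nonneg _) (mul_nonneg (bubble_pos y).le (norm_nonneg _))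
    two_ne_zero).1 this

/-- The chart transition between stereographic charts is conformal. -/
lemma exists_transition_deriv (p q : Sph n) {y : EuclideanSpace ℝ (Fin n)}
    (hy : (extChartAt (𝓡 n) p).symm y ≠ -q) :
    ∃ L : EuclideanSpace ℝ (Fin n) →L[ℝ] EuclideanSpace ℝ (Fin n),
      HasFDerivAt (fun y => extChartAt (𝓡 n) q ((extChartAt (𝓡 n) p).symm y)) L y ∧
      |L.det| = (bubble y / bubble (extChartAt (𝓡 n) q ((extChartAt (𝓡 n) p).symm y))) ^ n := by
  set τ : EuclideanSpace ℝ (Fin n) → EuclideanSpace ℝ (Fin n) :=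
    fun y => extChartAt (𝓡 n) q ((extChartAt (𝓡 n) p).symm y) with hτ
  have hsrc : (extChartAt (𝓡 n) p).symm y ∈ (extChartAt (𝓡 n) q).source := by
    rw [extChartAt_source_sphere]; exact hy
  have hsrc' := hsrc
  rw [extChartAt_source] at hsrc'
  have h1 : MDifferentiableAt (𝓡 n) 𝓘(ℝ, EuclideanSpace ℝ (Fin n)) τ y := by
    have h2 := (contMDiffAt_extChartAt' (I := 𝓡 n) (n := ∞) hsrc').mdifferentiableAt (by simp)
    exact h2.comp y ((contMDiff_extChartAt_symm_sphere p).mdifferentiable (by simp) y)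
  have h3 : DifferentiableAt ℝ τ y := mdifferentiableAt_iff_differentiableAt.1 h1
  refine ⟨fderiv ℝ τ y, h3.hasFDerivAt, ?_⟩
  -- Near y both parametrizations describe the same points. Differentiating, and comparing their
  -- conformal factors, gives the factor of the transition map.
  have hev : (fun z => stereoMap q (τ z)) =ᶠ[𝓝 y] stereoMap p := by
    have hopen : IsOpen (extChartAt (𝓡 n) q).source := isOpen_extChartAt_source q
    have := (continuous_extChartAt_symm_sphere p).continuousAt.preimage_mem_nhds
      (hopen.mem_nhds hsrc)
    filter_upwards [this] with z hz
    rw [← coe_extChartAt_symm, ← coe_extChartAt_symm, hτ]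
    simp only
    rw [(extChartAt (𝓡 n) q).left_inv hz]
  have hd : ∀ v, stereoDeriv q (τ y) (fderiv ℝ τ y v) = stereoDeriv p y v := by
    intro v
    have h4 : DifferentiableAt ℝ (stereoMap q) (τ y) :=
      (contDiff_stereoMap q).differentiable (by simp) _
    have h5 := fderiv_comp y h4 h3
    have h6 := hev.fderiv_eq (𝕜 := ℝ)
    rw [← fderiv_stereoMap, ← fderiv_stereoMap, ← h6]
    change fderiv ℝ (stereoMap q) (τ y) (fderiv ℝ τ y v) = fderiv ℝ (stereoMap q ∘ τ) y v
    rw [h5]; rfl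
  refine abs_det_of_inner_eq (div_pos (bubble_pos y) (bubble_pos _)) fun u v => ?_
  have h7 := inner_stereoDeriv q (τ y) (fderiv ℝ τ y u) (fderiv ℝ τ y v)
  rw [hd, hd, inner_stereoDeriv] at h7
  have h8 := (bubble_pos (τ y)).ne'
  change inner ℝ (fderiv ℝ τ y u) (fderiv ℝ τ y v) = (bubble y / bubble (τ y)) ^ 2 * inner ℝ u v
  rw [div_pow, div_mul_eq_mul_div, h7]
  field_simp

variable {h : RiemMetric n (Sph n)} {F : Sph n → ℝ}

/-- The Riemannian measure in one chart. -/
noncomputable def chartMeasure (h : RiemMetric n (Sph n)) (p : Sph n) : Measure (Sph n) :=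
  ((volume.restrict (extChartAt (𝓡 n) p).target).withDensity
    (fun y => ENNReal.ofReal (Real.sqrt (metricCoeff h p y).det))).map (extChartAt (𝓡 n) p).symm

lemma sqrt_det_metricCoeff
    (hF : ∀ x, ∀ v w : TangentSpace (𝓡 n) x, h.inner x v w = F x * (roundMetric n).inner x v w)
    (p : Sph n) (y : EuclideanSpace ℝ (Fin n)) :
    Real.sqrt (metricCoeff h p y).det =
      bubble y ^ n * Real.sqrt (F ((extChartAt (𝓡 n) p).symm y) ^ n) := by
  rw [metricCoeff_conformal hF, Matrix.det_smul, Matrix.det_one, Fintype.card_fin, mul_one, mul_pow,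
    ← pow_mul, mul_comm 2 n, pow_mul, Real.sqrt_mul (sq_nonneg _),
    Real.sqrt_sq (pow_nonneg (bubble_pos y).le n)]

lemma chartMeasure_apply
    (hF : ∀ x, ∀ v w : TangentSpace (𝓡 n) x, h.inner x v w = F x * (roundMetric n).inner x v w)
    (p : Sph n) {s : Set (Sph n)} (hs : MeasurableSet s) :
    chartMeasure h p s = ∫⁻ y in (extChartAt (𝓡 n) p).symm ⁻¹' s,
      ENNReal.ofReal (bubble y ^ n * Real.sqrt (F ((extChartAt (𝓡 n) p).symm y) ^ n)) := by
  have hm := (continuous_extChartAt_symm_sphere p).measurable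
  rw [chartMeasure, Measure.map_apply hm hs, withDensity_apply _ (hm hs),
    extChartAt_target_sphere, Measure.restrict_univ]
  simp_rw [sqrt_det_metricCoeff hF]

/-- By symmetry in p and q all chart measures agree, so their supremum is any one of them. The
transition map has Jacobian (bubble y / bubble (τ y))^n, which exactly exchanges the densities, and
each chart omits a single point. -/
lemma chartMeasure_le (hn : 0 < n)
    (hF : ∀ x, ∀ v w : TangentSpace (𝓡 n) x, h.inner x v w = F x * (roundMetric n).inner x v w)
    (p q : Sph n) : chartMeasure h q ≤ chartMeasure h p := by
  refine Measure.le_iff.2 fun s hs => ?_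
  rw [chartMeasure_apply hF q hs, chartMeasure_apply hF p hs]
  set Φp := (extChartAt (𝓡 n) p).symm with hΦp
  set Φq := (extChartAt (𝓡 n) q).symm with hΦq
  let τ : EuclideanSpace ℝ (Fin n) → EuclideanSpace ℝ (Fin n) := fun y => extChartAt (𝓡 n) q (Φp y)
  let A : Set (EuclideanSpace ℝ (Fin n)) := Φp ⁻¹' (s \ {-q})
  have hmp : Measurable Φp := (continuous_extChartAt_symm_sphere p).measurable
  have hA : MeasurableSet A := hmp (hs.diff (measurableSet_singleton _))
  have hsource : ∀ q x : Sph n, x ≠ -q → x ∈ (extChartAt (𝓡 n) q).source := fun q x hx => by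
    rw [extChartAt_source_sphere]; exact hx
  choose! L hL using fun (y : EuclideanSpace ℝ (Fin n)) (hy : y ∈ A) =>
    exists_transition_deriv p q (y := y) hy.2
  have hqτ : ∀ y ∈ A, Φq (τ y) = Φp y := fun y hy =>
    (extChartAt (𝓡 n) q).left_inv (hsource q _ hy.2)
  have hinj : InjOn τ A := by
    intro y hy z hz hyz
    have h1 : Φp y = Φp z := by rw [← hqτ y hy, ← hqτ z hz, hyz]
    rw [← extChartAt_symm_left p y, ← extChartAt_symm_left p z]
    exact congrArg _ h1
  have hcv := lintegral_image_eq_lintegral_abs_det_fderiv_mul volume hA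
    (fun y hy => (hL y hy).1.hasFDerivWithinAt) hinj
    (fun y => ENNReal.ofReal (bubble y ^ n * Real.sqrt (F (Φq y) ^ n)))
  have hae : (Φq ⁻¹' s : Set (EuclideanSpace ℝ (Fin n))) ≤ᵐ[volume] (τ '' A : Set _) := by
    -- The only point of chart q outside the range of chart p is the one over -p; it is null because
    -- n > 0.
    have hnull : volume (Φq ⁻¹' {-p} : Set (EuclideanSpace ℝ (Fin n))) = 0 := by
      have : Nonempty (Fin n) := ⟨⟨0, hn⟩⟩
      refine Set.Subsingleton.measure_zero (fun y hy z hz => ?_) _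
      rw [← extChartAt_symm_left q y, ← extChartAt_symm_left q z]
      exact congrArg _ ((show Φq y = -p from hy).trans (show Φq z = -p from hz).symm)
    refine (ae_le_set.2 (measure_mono_null ?_ hnull))
    rintro y ⟨hy, hyA⟩
    by_contra hne
    refine hyA ⟨extChartAt (𝓡 n) p (Φq y), ?_, ?_⟩
    · have h1 : Φp (extChartAt (𝓡 n) p (Φq y)) = Φq y :=
        (extChartAt (𝓡 n) p).left_inv (hsource p _ hne)
      have h2 : Φq y ∈ (extChartAt (𝓡 n) q).source :=
        (extChartAt (𝓡 n) q).map_target (by rw [extChartAt_target_sphere]; trivial)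
      rw [extChartAt_source_sphere] at h2
      change Φp _ ∈ s \ {-q}
      rw [h1]
      exact ⟨hy, h2⟩
    · change extChartAt (𝓡 n) q (Φp (extChartAt (𝓡 n) p (Φq y))) = y
      rw [hΦp, (extChartAt (𝓡 n) p).left_inv (hsource p _ hne)]
      exact extChartAt_symm_left q y
  refine (lintegral_mono_set' hae).trans ?_
  rw [hcv]
  refine le_trans (le_of_eq ?_) (lintegral_mono_set (fun y hy => hy.1 : A ⊆ Φp ⁻¹' s))
  refine setLIntegral_congr_fun hA fun y hy => ?_
  rw [(hL y hy).2, ← ENNReal.ofReal_mul (pow_nonneg (div_pos (bubble_pos _) (bubble_pos _)).le _)]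
  change ENNReal.ofReal ((bubble y / bubble (τ y)) ^ n *
    (bubble (τ y) ^ n * Real.sqrt (F (Φq (τ y)) ^ n))) = _
  rw [hqτ y hy, ← mul_assoc, ← mul_pow, div_mul_cancel₀ _ (bubble_pos _).ne']

/-- The volume of a conformal metric, computed in a stereographic chart. -/
lemma vol_conformal (hn : 0 < n)
    (hF : ∀ x, ∀ v w : TangentSpace (𝓡 n) x, h.inner x v w = F x * (roundMetric n).inner x v w)
    (hFc : Continuous F) (hFpos : ∀ x, 0 < F x) (p : Sph n) :
    vol h = ∫ y, (bubble y ^ 2 * F ((extChartAt (𝓡 n) p).symm y)) ^ ((n : ℝ) / 2) := by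
  have h1 : riemannianMeasure h = chartMeasure h p := by
    refine le_antisymm (iSup_le fun q => chartMeasure_le hn hF p q) (le_iSup (chartMeasure h) p)
  have hc : Continuous fun y => F ((extChartAt (𝓡 n) p).symm y) :=
    hFc.comp (continuous_extChartAt_symm_sphere p)
  have hpos : ∀ y, 0 < bubble y ^ 2 * F ((extChartAt (𝓡 n) p).symm y) := fun y =>
    mul_pos (pow_pos (bubble_pos y) 2) (hFpos _)
  rw [vol, h1, chartMeasure_apply hF p MeasurableSet.univ, preimage_univ, Measure.restrict_univ,
    integral_eq_lintegral_of_nonneg_ae (Eventually.of_forall fun y => by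
      exact (Real.rpow_pos_of_pos (hpos y) _).le) ?_]
  · congr 1
    refine lintegral_congr fun y => ?_
    congr 1
    rw [Real.mul_rpow (sq_nonneg _) (hFpos _).le, Real.sqrt_eq_rpow, ← Real.rpow_natCast (F _),
      ← Real.rpow_mul (hFpos _).le, ← Real.rpow_natCast (bubble y) 2,
      ← Real.rpow_mul (bubble_pos y).le, ← Real.rpow_natCast (bubble y) n]
    congr 2 <;> push_cast <;> ring
  · exact (((contDiff_bubble.continuous.pow 2).mul hc).rpow_const fun y =>
      Or.inl (hpos y).ne').aestronglyMeasurable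

end Measure

/-! ### The Yamabe operator of a conformal metric -/

section Operator

variable {n : ℕ}

/-- The extension of a function on the sphere which is constant along rays. -/
noncomputable def sphereExt (W : Sph n → ℝ) (z : EuclideanSpace ℝ (Fin (n + 1))) : ℝ :=
  Function.extend Subtype.val W 0 (‖z‖⁻¹ • z)

lemma sphereExt_coe (W : Sph n → ℝ) (x : Sph n) : sphereExt W x = W x := by
  rw [sphereExt, norm_sphere_coe, inv_one, one_smul]
  exact Subtype.val_injective.extend_apply W 0 x

lemma contDiff_comp_extChartAt_symm {W : Sph n → ℝ} (hW : ContMDiff (𝓡 n) 𝓘(ℝ, ℝ) ∞ W)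
    (p : Sph n) : ContDiff ℝ ∞ fun y => W ((extChartAt (𝓡 n) p).symm y) :=
  (hW.comp (contMDiff_extChartAt_symm_sphere p)).contDiff

/-- Near z the extension is a composition of smooth maps: the radial projection, the chart centred
at z (given by the ambient formula `stereoToFun`), and W read in that chart. -/
lemma contDiffAt_sphereExt {W : Sph n → ℝ} (hW : ContMDiff (𝓡 n) 𝓘(ℝ, ℝ) ∞ W)
    (z : EuclideanSpace ℝ (Fin (n + 1))) (hz : ‖z‖ = 1) : ContDiffAt ℝ ∞ (sphereExt W) z := by
  have := Fact.mk (@finrank_euclideanSpace_fin ℝ _ (n + 1))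
  let p : Sph n := ⟨z, by simpa using hz⟩
  let U := (OrthonormalBasis.fromOrthogonalSpanSingleton (𝕜 := ℝ) n
    (ne_zero_of_mem_unit_sphere (-p))).repr
  let P : EuclideanSpace ℝ (Fin (n + 1)) := ((-p : Sph n) : EuclideanSpace ℝ (Fin (n + 1)))
  have hPz : P = -z := rfl
  have hz0 : z ≠ 0 := by rintro rfl; simp at hz
  let r : EuclideanSpace ℝ (Fin (n + 1)) → EuclideanSpace ℝ (Fin (n + 1)) := fun z => ‖z‖⁻¹ • z
  have hr : ContDiffAt ℝ ∞ r z :=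
    ((contDiffAt_norm ℝ hz0).inv (by simpa using hz0)).smul contDiffAt_id
  have hrz : r z = z := by simp [r, hz]
  have hne : innerSL ℝ P z ≠ (1 : ℝ) := by
    rw [innerSL_apply_apply, hPz, inner_neg_left, real_inner_self_eq_norm_sq, hz]; norm_num
  have hopen : IsOpen {x : EuclideanSpace ℝ (Fin (n + 1)) | innerSL ℝ P x ≠ (1 : ℝ)} :=
    isOpen_ne_fun (innerSL ℝ P).continuous continuous_const
  have hst : ContDiffAt ℝ ∞ (stereoToFun P) (r z) := by
    rw [hrz]
    exact (contDiffOn_stereoToFun z hne).contDiffAt (hopen.mem_nhds hne)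
  have hcomp : ContDiffAt ℝ ∞
      (fun z => (fun y => W ((extChartAt (𝓡 n) p).symm y)) (U (stereoToFun P (r z)))) z := by
    have h1 : ContDiffAt ℝ ∞ (fun z => stereoToFun P (r z)) z := hst.comp z hr
    have h2 : ContDiffAt ℝ ∞ (fun z => U (stereoToFun P (r z))) z :=
      U.contDiff.contDiffAt.comp z h1
    exact (contDiff_comp_extChartAt_symm hW p).contDiffAt.comp z h2
  refine hcomp.congr_of_eventuallyEq ?_
  have hev : ∀ᶠ w in 𝓝 z, innerSL ℝ P (r w) ≠ (1 : ℝ) :=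
    hr.continuousAt.eventually (by rw [hrz]; exact hopen.mem_nhds hne)
  filter_upwards [hev, isOpen_ne.mem_nhds hz0] with w hw hw0
  have hnw : ‖r w‖ = 1 := by
    simp only [r]
    rw [norm_smul, norm_inv, norm_norm, inv_mul_cancel₀ (by simpa using hw0)]
  let x : Sph n := ⟨r w, by simpa using hnw⟩
  have hx : x ≠ -p := by
    rintro h
    apply hw
    have h2 : r w = P := congrArg Subtype.val h
    rw [h2, innerSL_apply_apply, real_inner_self_eq_norm_sq, hPz, norm_neg, hz]; norm_num
  have hchart : extChartAt (𝓡 n) p x = U (stereoToFun P (r w)) := rfl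
  rw [← hchart, (extChartAt (𝓡 n) p).left_inv (by rw [extChartAt_source_sphere]; exact hx)]
  exact Subtype.val_injective.extend_apply W 0 x

variable {h : RiemMetric n (Sph n)} {F v : Sph n → ℝ} {E : EuclideanSpace ℝ (Fin (n + 1)) → ℝ}

/-- The conformal changes from h to the round metric and from there to the flat one compose to the
change from h = ρ δ to δ, with ρ = bubble² F. -/
lemma flatten_eq_conformal (hpos : ∀ x, 0 < F x) (hEv : ∀ x : Sph n, E x = F x ^ (((n : ℝ) - 2) / 4) * v x)
    (p : Sph n) (y : EuclideanSpace ℝ (Fin n)) :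
    flatten E p y = (bubble y ^ 2 * F ((extChartAt (𝓡 n) p).symm y)) ^ (((n : ℝ) - 2) / 4) *
      v ((extChartAt (𝓡 n) p).symm y) := by
  rw [flatten, ← coe_extChartAt_symm, hEv, Real.mul_rpow (sq_nonneg _) (hpos _).le,
    ← Real.rpow_natCast, ← Real.rpow_mul (bubble_pos y).le, mul_assoc]
  congr 2
  push_cast
  ring

/-- The Yamabe operator of `F g`, in terms of the conformal Laplacian of the round metric. -/
theorem yamabeOperator_conformal (hn : 3 ≤ n)
    (hF : ∀ x, ∀ v w : TangentSpace (𝓡 n) x, h.inner x v w = F x * (roundMetric n).inner x v w)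
    (hFs : ContMDiff (𝓡 n) 𝓘(ℝ, ℝ) ∞ F) (hpos : ∀ x, 0 < F x)
    (hv : ContMDiff (𝓡 n) 𝓘(ℝ, ℝ) ∞ v) (hE : ∀ z, ‖z‖ = 1 → ContDiffAt ℝ ∞ E z)
    (hEv : ∀ x : Sph n, E x = F x ^ (((n : ℝ) - 2) / 4) * v x) (x : Sph n) :
    yamabeOperator h v x = -(4 * ((n : ℝ) - 1) / (n - 2)) * F x ^ (-(((n : ℝ) + 2) / 4)) *
      sphereOp E x := by
  set y := extChartAt (𝓡 n) x x with hy
  have hyx : (extChartAt (𝓡 n) x).symm y = x := extChartAt_to_inv x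
  have hs : stereoMap x y = x := by rw [← coe_extChartAt_symm, hyx]
  have hfl : (fun z => (bubble z ^ 2 * F ((extChartAt (𝓡 n) x).symm z)) ^ (((n : ℝ) - 2) / 4) *
      (v ∘ (extChartAt (𝓡 n) x).symm) z) = flatten E x :=
    funext fun z => (flatten_eq_conformal hpos hEv x z).symm
  have key := yamabe_conformal hn (ρ := fun y => bubble y ^ 2 * F ((extChartAt (𝓡 n) x).symm y))
    (V := v ∘ (extChartAt (𝓡 n) x).symm) (G := metricCoeff h x)
    ((contDiff_bubble.pow 2).mul (contDiff_comp_extChartAt_symm hFs x))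
    (fun y => mul_pos (pow_pos (bubble_pos y) 2) (hpos _))
    (contDiff_comp_extChartAt_symm hv x) (metricCoeff_conformal hF x) y
  rw [hfl, sum_partialDeriv_flatten hE, hs] at key
  have hvx : (v ∘ (extChartAt (𝓡 n) x).symm) y = v x := by rw [Function.comp_apply, hyx]
  rw [hvx] at key
  rw [yamabeOperator, laplacian, scalarCurvature, ← hy, key]
  have hb := bubble_pos y
  rw [hyx, Real.mul_rpow (sq_nonneg _) (hpos x).le, ← Real.rpow_natCast, ← Real.rpow_mul hb.le]
  have h1 : bubble y ^ (((2 : ℕ) : ℝ) * -(((n : ℝ) + 2) / 4)) * bubble y ^ (((n : ℝ) + 2) / 2) = 1 := by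
    rw [← Real.rpow_add hb]
    have : ((2 : ℕ) : ℝ) * -(((n : ℝ) + 2) / 4) + ((n : ℝ) + 2) / 2 = 0 := by push_cast; ring
    rw [this, Real.rpow_zero]
  linear_combination (-(4 * ((n : ℝ) - 1) / (n - 2)) * F x ^ (-(((n : ℝ) + 2) / 4)) *
    sphereOp E x) * h1

end Operator

/-! ### Decay of flattened functions -/

section Energy

variable {n : ℕ} {E : EuclideanSpace ℝ (Fin (n + 1)) → ℝ}

lemma exists_bound_sphere {X : Type*} [NormedAddCommGroup X]
    {f : EuclideanSpace ℝ (Fin (n + 1)) → X} (hf : ∀ z, ‖z‖ = 1 → ContinuousAt f z) :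
    ∃ K, 0 ≤ K ∧ ∀ z, ‖z‖ = 1 → ‖f z‖ ≤ K := by
  obtain ⟨K, hK⟩ := (isCompact_sphere (0 : EuclideanSpace ℝ (Fin (n + 1))) 1).exists_bound_of_continuousOn
    (f := f) fun z hz => (hf z (by simpa using hz)).continuousWithinAt
  exact ⟨max K 0, le_max_right _ _, fun z hz => (hK z (by simpa using hz)).trans (le_max_left _ _)⟩

lemma norm_stereoDeriv_single_le (p : Sph n) (y : EuclideanSpace ℝ (Fin n)) (i : Fin n) :
    ‖stereoDeriv p y (EuclideanSpace.single i 1)‖ ≤ 1 := by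
  rw [norm_stereoDeriv]
  simpa using bubble_le_one y

/-- The first term contributes at most 1, the second at most bubble · (|y| + 2) ≤ 3. -/
lemma norm_stereoDeriv2_le (p : Sph n) (y : EuclideanSpace ℝ (Fin n)) (i : Fin n) :
    ‖stereoDeriv2 p i y‖ ≤ 4 := by
  have hb := bubble_pos y
  have hb1 := bubble_le_one y
  have h1 := abs_apply_mul_bubble_le y i
  have h2 : ‖stereoIso p y + (2 : ℝ) • (p : EuclideanSpace ℝ (Fin (n + 1)))‖ ≤ ‖y‖ + 2 := by
    refine (norm_add_le _ _).trans ?_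
    rw [(stereoIso p).norm_map, norm_smul, norm_sphere_coe]
    norm_num
  have h3 := norm_mul_bubble_le y
  have h4 : (y i * bubble y) ^ 2 ≤ 1 := by
    rw [← sq_abs, abs_mul, abs_of_pos hb]
    exact pow_le_one₀ (by positivity) h1
  have h5 : |bubble y ^ 3 * y i ^ 2 / 2 - bubble y ^ 2 / 2| ≤ bubble y := by
    rw [abs_le]
    constructor <;> nlinarith [sq_nonneg (y i * bubble y)]
  have h6 : |-(bubble y ^ 2 * y i)| ≤ 1 := by
    rw [abs_neg, abs_mul, abs_of_pos (pow_pos hb 2)]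
    nlinarith [abs_nonneg (y i)]
  rw [stereoDeriv2]
  refine (norm_add_le _ _).trans ?_
  rw [norm_smul, norm_smul, (stereoIso p).norm_map, Real.norm_eq_abs, Real.norm_eq_abs]
  have h7 : ‖(EuclideanSpace.single i (1 : ℝ) : EuclideanSpace ℝ (Fin n))‖ = 1 := by simp
  rw [h7]
  have h8 := mul_le_mul h5 h2 (norm_nonneg _) hb.le
  nlinarith

/-- A flattened function and its derivatives decay like the extremals. -/
lemma exists_bound_flatten (hE : ∀ z, ‖z‖ = 1 → ContDiffAt ℝ ∞ E z) (p : Sph n) :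
    ∃ C, 0 ≤ C ∧ ∀ y, |flatten E p y| ≤ C * bubble y ^ (((n : ℝ) - 2) / 2) ∧
      ∀ i, |partialDeriv i (flatten E p) y| ≤ C * bubble y ^ (((n : ℝ) - 2) / 2) ∧
        |partialDeriv i (partialDeriv i (flatten E p)) y| ≤ C * bubble y ^ (((n : ℝ) - 2) / 2) := by
  obtain ⟨K0, hK0, h0⟩ := exists_bound_sphere (f := E) fun z hz => (hE z hz).continuousAt
  obtain ⟨K1, hK1, h1⟩ := exists_bound_sphere (f := fderiv ℝ E) fun z hz =>
    ((hE z hz).fderiv_right (m := ∞) (by simp)).continuousAt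
  obtain ⟨K2, hK2, h2⟩ := exists_bound_sphere (f := fderiv ℝ (fderiv ℝ E)) fun z hz =>
    (((hE z hz).fderiv_right (m := ∞) (by simp)).fderiv_right (m := ∞) (by simp)).continuousAt
  set m : ℝ := |(n : ℝ) - 2| * (n + 2) with hm
  have hm0 : 0 ≤ m := by positivity
  -- The sum of the bounds for all terms of the second derivative; m dominates every coefficient
  -- depending on n, and 4 is the bound for `stereoDeriv2`.
  refine ⟨K2 + (4 + m) * K1 + (1 + m) * K0, by positivity, fun y => ?_⟩
  have hz := norm_stereoMap p y
  set z := stereoMap p y with hzd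
  have hb := bubble_pos y
  have hb1 := bubble_le_one y
  have hbp := Real.rpow_pos_of_pos hb (((n : ℝ) - 2) / 2)
  have hE0 : |E z| ≤ K0 := h0 z hz
  have hn0 : (0 : ℝ) ≤ n := n.cast_nonneg
  refine ⟨?_, fun i => ⟨?_, ?_⟩⟩
  · rw [flatten, abs_mul, abs_of_pos hbp, mul_comm]
    refine mul_le_mul_of_nonneg_right ?_ hbp.le
    nlinarith [mul_nonneg (add_nonneg zero_le_four hm0) hK1, mul_nonneg hm0 hK0]
  all_goals
    set u := stereoDeriv p y (EuclideanSpace.single i 1) with hu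
    have hu1 : ‖u‖ ≤ 1 := norm_stereoDeriv_single_le p y i
    have hD1 : |fderiv ℝ E z u| ≤ K1 := by
      refine ((fderiv ℝ E z).le_opNorm u).trans ?_
      nlinarith [h1 z hz, norm_nonneg u]
    have hyb : |y i * bubble y| ≤ 1 := by
      rw [abs_mul, abs_of_pos hb]; exact abs_apply_mul_bubble_le y i
  · rw [partialDeriv_flatten hE, abs_mul, abs_of_pos hbp, mul_comm]
    refine mul_le_mul_of_nonneg_right ?_ hbp.le
    have e1 : |((n : ℝ) - 2) / 4 * (y i * bubble y) * E z| ≤ m * K0 := by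
      rw [abs_mul, abs_mul]
      refine mul_le_mul ?_ hE0 (abs_nonneg _) hm0
      rw [abs_div, hm, abs_of_pos (by norm_num : (0 : ℝ) < 4)]
      have hle := mul_le_mul_of_nonneg_left hyb (show 0 ≤ |(n : ℝ) - 2| / 4 by positivity)
      nlinarith [abs_nonneg ((n : ℝ) - 2), mul_nonneg (abs_nonneg ((n : ℝ) - 2)) hn0]
    refine (abs_sub _ _).trans ?_
    nlinarith [mul_nonneg hm0 hK1]
  · rw [partialDeriv_partialDeriv_flatten hE, abs_mul, abs_of_pos hbp, mul_comm]
    refine mul_le_mul_of_nonneg_right ?_ hbp.le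
    have e1 : |fderiv ℝ (fderiv ℝ E) z u u| ≤ K2 := by
      refine ((fderiv ℝ (fderiv ℝ E) z).le_opNorm₂ u u).trans ?_
      have := mul_le_one₀ hu1 (norm_nonneg u) hu1
      rw [mul_assoc]
      nlinarith [h2 z hz, norm_nonneg u, norm_nonneg (fderiv ℝ (fderiv ℝ E) z)]
    have e2 : |fderiv ℝ E z (stereoDeriv2 p i y)| ≤ 4 * K1 := by
      refine ((fderiv ℝ E z).le_opNorm _).trans ?_
      nlinarith [h1 z hz, norm_stereoDeriv2_le p y i, norm_nonneg (stereoDeriv2 p i y)]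
    have e3 : |((n : ℝ) - 2) / 2 * (y i * bubble y) * fderiv ℝ E z u| ≤ m * K1 := by
      rw [abs_mul, abs_mul]
      refine mul_le_mul ?_ hD1 (abs_nonneg _) hm0
      rw [abs_div, hm, abs_of_pos (by norm_num : (0 : ℝ) < 2)]
      have hle := mul_le_mul_of_nonneg_left hyb (show 0 ≤ |(n : ℝ) - 2| / 2 by positivity)
      nlinarith [abs_nonneg ((n : ℝ) - 2), mul_nonneg (abs_nonneg ((n : ℝ) - 2)) hn0]
    have e4 : |(((n : ℝ) - 2) * n / 16 * (y i * bubble y) ^ 2 - ((n : ℝ) - 2) / 4 * bubble y) * E z| ≤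
        m * K0 := by
      rw [abs_mul]
      refine mul_le_mul ?_ hE0 (abs_nonneg _) hm0
      have h6 : (y i * bubble y) ^ 2 ≤ 1 := by
        rw [← sq_abs]; exact pow_le_one₀ (abs_nonneg _) hyb
      have h7 : ((n : ℝ) - 2) * n / 16 * (y i * bubble y) ^ 2 - ((n : ℝ) - 2) / 4 * bubble y =
        ((n : ℝ) - 2) * (n / 16 * (y i * bubble y) ^ 2 - bubble y / 4) := by ring
      rw [h7, abs_mul, hm]
      refine mul_le_mul_of_nonneg_left ?_ (abs_nonneg _)
      rw [abs_le]
      constructor <;> nlinarith [sq_nonneg (y i * bubble y)]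
    refine (abs_add_le _ _).trans ?_
    have := abs_sub (fderiv ℝ (fderiv ℝ E) z u u + fderiv ℝ E z (stereoDeriv2 p i y))
      (((n : ℝ) - 2) / 2 * (y i * bubble y) * fderiv ℝ E z u)
    have := abs_add_le (fderiv ℝ (fderiv ℝ E) z u u) (fderiv ℝ E z (stereoDeriv2 p i y))
    nlinarith

end Energy

/-! ### The Sobolev inequality without sign condition -/

section SignChanging

variable {n : ℕ} {u w : EuclideanSpace ℝ (Fin n) → ℝ} {C D : ℝ}

/-- The product decays like bubble^{n-2}, hence like |y|^{-2(n-2)}, integrable exactly when n > 4.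
This is where the dimension restriction n ≥ 5 originates. -/
lemma integrable_mul_of_le_bubble (hn : 5 ≤ n) (hu : Continuous u) (hw : Continuous w)
    (hC : ∀ y, |u y| ≤ C * bubble y ^ (((n : ℝ) - 2) / 2))
    (hD : ∀ y, |w y| ≤ D * bubble y ^ (((n : ℝ) - 2) / 2)) : Integrable fun y => u y * w y := by
  have hn' : (5 : ℝ) ≤ n := by exact_mod_cast hn
  refine ((integrable_bubble_rpow (n := n) (r := (n : ℝ) - 2) (by linarith)).const_mul (C * D)).mono'
    (hu.mul hw).aestronglyMeasurable (Eventually.of_forall fun y => ?_)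
  have h1 := mul_le_mul (hC y) (hD y) (abs_nonneg _) ((abs_nonneg _).trans (hC y))
  rw [Real.norm_eq_abs, abs_mul]
  refine h1.trans_eq ?_
  have : (n : ℝ) - 2 = ((n : ℝ) - 2) / 2 + ((n : ℝ) - 2) / 2 := by ring
  conv_rhs => rw [this, Real.rpow_add (bubble_pos y)]
  ring

/-- The critical power of bubble^{(n-2)/2} is bubble^n. -/
lemma integrable_rpow_of_le_bubble (hn : 5 ≤ n) (hu : Continuous u)
    (hC : ∀ y, |u y| ≤ C * bubble y ^ (((n : ℝ) - 2) / 2)) :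
    Integrable fun y => |u y| ^ (2 * (n : ℝ) / (n - 2)) := by
  have hn' : (5 : ℝ) ≤ n := by exact_mod_cast hn
  have hn2 : (0 : ℝ) < (n : ℝ) - 2 := by linarith
  have hp : 0 < 2 * (n : ℝ) / (n - 2) := by positivity
  refine ((integrable_bubble_rpow (n := n) (r := n) (by linarith)).const_mul
    (C ^ (2 * (n : ℝ) / (n - 2)))).mono'
    (hu.abs.rpow_const fun y => Or.inr hp.le).aestronglyMeasurable (Eventually.of_forall fun y => ?_)
  have hb := Real.rpow_pos_of_pos (bubble_pos y) (((n : ℝ) - 2) / 2)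
  have hC0 : 0 ≤ C := nonneg_of_mul_nonneg_left ((abs_nonneg _).trans (hC y)) hb
  rw [Real.norm_of_nonneg (Real.rpow_nonneg (abs_nonneg _) _)]
  refine (Real.rpow_le_rpow (abs_nonneg _) (hC y) hp.le).trans_eq ?_
  rw [Real.mul_rpow hC0 hb.le, ← Real.rpow_mul (bubble_pos y).le]
  congr 2
  field_simp

lemma abs_partialDeriv_bubble_rpow_le {r : ℝ} (hr : 0 ≤ r) (i : Fin n)
    (y : EuclideanSpace ℝ (Fin n)) :
    |partialDeriv i (fun y => bubble y ^ r) y| ≤ r / 2 * bubble y ^ r := by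
  have hb := bubble_pos y
  have hbr := Real.rpow_pos_of_pos hb r
  rw [partialDeriv_bubble_rpow, Real.rpow_add hb, Real.rpow_one, abs_mul, abs_mul, abs_neg,
    abs_of_nonneg (by positivity : 0 ≤ r / 2), abs_of_pos (mul_pos hbr hb)]
  have := mul_le_mul_of_nonneg_left (abs_apply_mul_bubble_le y i)
    (by positivity : 0 ≤ r / 2 * bubble y ^ r)
  linarith

/-- The Sobolev inequality for functions which may change sign. -/
theorem sobolev_inequality_abs (hn : 5 ≤ n) (hu : ContDiff ℝ 1 u)
    (hC : ∀ y, |u y| ≤ C * bubble y ^ (((n : ℝ) - 2) / 2))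
    (hD : ∀ i y, |partialDeriv i u y| ≤ D * bubble y ^ (((n : ℝ) - 2) / 2)) :
    (n * (n - 2) / 4 : ℝ) * (∫ y : EuclideanSpace ℝ (Fin n), bubble y ^ n) ^ (2 / (n : ℝ)) *
        (∫ y, |u y| ^ (2 * (n : ℝ) / (n - 2))) ^ (((n : ℝ) - 2) / n) ≤
      ∑ i, ∫ y, partialDeriv i u y ^ 2 := by
  have hn' : (5 : ℝ) ≤ n := by exact_mod_cast hn
  have hn2 : (0 : ℝ) < (n : ℝ) - 2 := by linarith
  set a : ℝ := ((n : ℝ) - 2) / 2 with ha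
  have ha0 : 0 < a := by positivity
  let κ : EuclideanSpace ℝ (Fin n) → ℝ := fun y => bubble y ^ a
  have hκ : ContDiff ℝ 1 κ := (contDiff_bubble_rpow a).of_le (by simp)
  have hκ0 : ∀ y, 0 < κ y := fun y => Real.rpow_pos_of_pos (bubble_pos y) a
  have hdc : ∀ {f : EuclideanSpace ℝ (Fin n) → ℝ}, ContDiff ℝ 1 f → ∀ i,
      Continuous (partialDeriv i f) := fun hf i =>
    (hf.continuous_fderiv (by simp)).clm_apply continuous_const
  have hui : ∀ i, Integrable fun y => partialDeriv i u y ^ 2 := fun i => by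
    simpa only [sq] using integrable_mul_of_le_bubble hn (hdc hu i) (hdc hu i) (hD i) (hD i)
  have hκi : ∀ i, Integrable fun y => partialDeriv i κ y ^ 2 := fun i => by
    simpa only [sq] using integrable_mul_of_le_bubble hn (hdc hκ i) (hdc hκ i)
      (abs_partialDeriv_bubble_rpow_le ha0.le i) (abs_partialDeriv_bubble_rpow_le ha0.le i)
  set B : ℝ := ∑ i, ∫ y, partialDeriv i κ y ^ 2 with hB
  have hB0 : 0 ≤ B := Finset.sum_nonneg fun i _ => integral_nonneg fun y => sq_nonneg _
  have main : ∀ δ : ℝ, 0 < δ → (n * (n - 2) / 4 : ℝ) *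
      (∫ y : EuclideanSpace ℝ (Fin n), bubble y ^ n) ^ (2 / (n : ℝ)) *
        (∫ y, |u y| ^ (2 * (n : ℝ) / (n - 2))) ^ (((n : ℝ) - 2) / n) ≤
      (∑ i, ∫ y, partialDeriv i u y ^ 2) + δ * B := by
    intro δ hδ
    -- Replace |u| by f = √(u² + δ κ²): positive, C¹, at least |u|, and with the decay of the
    -- extremal κ.
    let q : EuclideanSpace ℝ (Fin n) → ℝ := fun y => u y ^ 2 + δ * κ y ^ 2
    have hq0 : ∀ y, 0 < q y := fun y =>
      add_pos_of_nonneg_of_pos (sq_nonneg _) (mul_pos hδ (pow_pos (hκ0 y) 2))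
    have hq : ContDiff ℝ 1 q := (hu.pow 2).add (contDiff_const.mul (hκ.pow 2))
    let f : EuclideanSpace ℝ (Fin n) → ℝ := fun y => Real.sqrt (q y)
    have hf : ContDiff ℝ 1 f := hq.sqrt fun y => (hq0 y).ne'
    have hf0 : ∀ y, 0 < f y := fun y => Real.sqrt_pos.2 (hq0 y)
    have huf : ∀ y, |u y| ≤ f y := fun y =>
      Real.abs_le_sqrt (le_add_of_nonneg_right (mul_pos hδ (pow_pos (hκ0 y) 2)).le)
    have hfC : ∀ y, f y ≤ Real.sqrt (C ^ 2 + δ) * bubble y ^ a := by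
      intro y
      rw [show bubble y ^ a = Real.sqrt (κ y ^ 2) from (Real.sqrt_sq (hκ0 y).le).symm,
        ← Real.sqrt_mul (by positivity)]
      refine Real.sqrt_le_sqrt ?_
      have := pow_le_pow_left₀ (abs_nonneg _) (hC y) 2
      rw [sq_abs, mul_pow] at this
      change u y ^ 2 + δ * κ y ^ 2 ≤ (C ^ 2 + δ) * κ y ^ 2
      change u y ^ 2 ≤ C ^ 2 * κ y ^ 2 at this
      linarith
    have hud := hu.differentiable one_ne_zero
    have hκd := hκ.differentiable one_ne_zero
    have hfd : ∀ i y, partialDeriv i f y ^ 2 ≤ partialDeriv i u y ^ 2 + δ * partialDeriv i κ y ^ 2 := by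
      intro i y
      have h1 : partialDeriv i f y = 1 / (2 * f y) * partialDeriv i q y :=
        partialDeriv_comp (hq.differentiable one_ne_zero) (Real.hasDerivAt_sqrt (hq0 y).ne') i
      have h2 : partialDeriv i q y = 2 * (u y * partialDeriv i u y + δ * (κ y * partialDeriv i κ y)) := by
        have h3 : q = fun y => u y * u y + δ * (κ y * κ y) := by
          funext y; simp only [q]; ring
        rw [h3, partialDeriv_add (f := fun y => u y * u y) (g := fun y => δ * (κ y * κ y))
            (hud.mul hud) ((hκd.mul hκd).const_mul δ),
          partialDeriv_const_mul (f := fun y => κ y * κ y) δ (hκd.mul hκd), partialDeriv_mul hud hud,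
          partialDeriv_mul hκd hκd]
        ring
      have h4 : f y ^ 2 = u y ^ 2 + δ * κ y ^ 2 := Real.sq_sqrt (hq0 y).le
      have h5 : partialDeriv i f y ^ 2 * f y ^ 2 =
          (u y * partialDeriv i u y + δ * (κ y * partialDeriv i κ y)) ^ 2 := by
        rw [h1, h2]
        have := (hf0 y).ne'
        field_simp
      refine le_of_mul_le_mul_right (a := f y ^ 2) ?_ (pow_pos (hf0 y) 2)
      rw [h5, h4]
      -- Cauchy–Schwarz for (u, √δ κ) and its derivative; the defect is δ (u ∂κ - κ ∂u)².
      nlinarith [mul_nonneg hδ.le (sq_nonneg (u y * partialDeriv i κ y - κ y * partialDeriv i u y))]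
    have hdom : ∀ i, Integrable fun y => partialDeriv i u y ^ 2 + δ * partialDeriv i κ y ^ 2 :=
      fun i => (hui i).add ((hκi i).const_mul δ)
    have hfi : ∀ i, Integrable fun y => partialDeriv i f y ^ 2 := fun i =>
      (hdom i).mono' ((hdc hf i).pow 2).aestronglyMeasurable (Eventually.of_forall fun y => by
        rw [Real.norm_of_nonneg (sq_nonneg _)]; exact hfd i y)
    have hS := sobolev_inequality hn hf hf0 hfC hfi
    have hfp := integrable_rpow_of_le_bubble hn hf.continuous fun y => by
      rw [abs_of_pos (hf0 y)]; exact hfC y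
    simp_rw [abs_of_pos (hf0 _)] at hfp
    have hp : 0 < 2 * (n : ℝ) / (n - 2) := by positivity
    refine le_trans ?_ (hS.trans ?_)
    · refine mul_le_mul_of_nonneg_left ?_ ?_
      · refine Real.rpow_le_rpow (integral_nonneg fun y => Real.rpow_nonneg (abs_nonneg _) _) ?_
          (by positivity)
        exact integral_mono_of_nonneg (Eventually.of_forall fun y => Real.rpow_nonneg (abs_nonneg _) _)
          hfp (Eventually.of_forall fun y => Real.rpow_le_rpow (abs_nonneg _) (huf y) hp.le)
      · have : 0 ≤ ∫ y : EuclideanSpace ℝ (Fin n), bubble y ^ n :=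
          integral_nonneg fun y => pow_nonneg (bubble_pos y).le n
        positivity
    · rw [hB, Finset.mul_sum, ← Finset.sum_add_distrib]
      refine Finset.sum_le_sum fun i _ => ?_
      rw [← integral_const_mul, ← integral_add (hui i) ((hκi i).const_mul δ)]
      exact integral_mono (hfi i) (hdom i) (hfd i)
  -- Let δ → 0; the denominator B + 1 avoids a case distinction on B = 0.
  refine le_of_forall_pos_le_add fun ε hε => (main (ε / (B + 1)) (by positivity)).trans ?_
  have : ε / (B + 1) * B ≤ ε := by
    rw [div_mul_eq_mul_div, div_le_iff₀ (by positivity)]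
    nlinarith
  linarith

end SignChanging

/-! ### The energy of flattened functions -/

section Energy

variable {n : ℕ} {E : EuclideanSpace ℝ (Fin (n + 1)) → ℝ}

/-- The decay of the flattened function and its derivatives makes all products integrable, so no
boundary term survives. -/
lemma integral_partialDeriv_flatten_sq (hn : 5 ≤ n)
    (hE : ∀ z, ‖z‖ = 1 → ContDiffAt ℝ ∞ E z) (p : Sph n) (i : Fin n) :
    ∫ y, partialDeriv i (flatten E p) y ^ 2 =
      -∫ y, flatten E p y * partialDeriv i (partialDeriv i (flatten E p)) y := by
  obtain ⟨C, -, hC⟩ := exists_bound_flatten hE p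
  have h0 := contDiff_flatten hE p
  have h1 := contDiff_partialDeriv h0 i
  have h2 := contDiff_partialDeriv h1 i
  have key := integral_mul_fderiv_eq_neg_fderiv_mul_of_integrable (μ := volume)
    (f := flatten E p) (g := partialDeriv i (flatten E p)) (v := EuclideanSpace.single i (1 : ℝ))
    (integrable_mul_of_le_bubble hn h1.continuous h1.continuous
      (fun y => ((hC y).2 i).1) (fun y => ((hC y).2 i).1))
    (integrable_mul_of_le_bubble hn h0.continuous h2.continuous
      (fun y => (hC y).1) (fun y => ((hC y).2 i).2))
    (integrable_mul_of_le_bubble hn h0.continuous h1.continuous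
      (fun y => (hC y).1) (fun y => ((hC y).2 i).1))
    (fun y _ => h0.differentiable (by simp) y) (fun y _ => h1.differentiable (by simp) y)
  have h3 : ∫ y, flatten E p y * partialDeriv i (partialDeriv i (flatten E p)) y =
    -∫ y, partialDeriv i (flatten E p) y * partialDeriv i (flatten E p) y := key
  rw [h3, neg_neg]
  simp_rw [sq]

/-- The energy of a flattened function. -/
lemma sum_integral_partialDeriv_flatten_sq (hn : 5 ≤ n)
    (hE : ∀ z, ‖z‖ = 1 → ContDiffAt ℝ ∞ E z) (p : Sph n) :
    ∑ i, ∫ y, partialDeriv i (flatten E p) y ^ 2 = -∫ y, flatten E p y *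
      (bubble y ^ (((n : ℝ) + 2) / 2) * sphereOp E (stereoMap p y)) := by
  obtain ⟨C, -, hC⟩ := exists_bound_flatten hE p
  have h0 := contDiff_flatten hE p
  simp_rw [integral_partialDeriv_flatten_sq hn hE p, Finset.sum_neg_distrib,
    ← sum_partialDeriv_flatten hE, Finset.mul_sum]
  rw [integral_finsetSum _ fun i _ => integrable_mul_of_le_bubble hn h0.continuous
    (contDiff_partialDeriv (contDiff_partialDeriv h0 i) i).continuous
      (fun y => (hC y).1) (fun y => ((hC y).2 i).2)]

end Energy

/-! ### The lower bound for the first eigenvalue -/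

section LowerBound

variable {n : ℕ} {h : RiemMetric n (Sph n)} {F v : Sph n → ℝ}

lemma integrable_vol (hn : 0 < n) (hFc : Continuous F) (hpos : ∀ x, 0 < F x) (p : Sph n) :
    Integrable fun y => (bubble y ^ 2 * F ((extChartAt (𝓡 n) p).symm y)) ^ ((n : ℝ) / 2) := by
  have hn' : (0 : ℝ) < n := by exact_mod_cast hn
  obtain ⟨M, hM⟩ := isCompact_univ.exists_bound_of_continuousOn (f := F) hFc.continuousOn
  have hc := hFc.comp (continuous_extChartAt_symm_sphere p)
  have hρ : ∀ y, 0 < bubble y ^ 2 * F ((extChartAt (𝓡 n) p).symm y) := fun y =>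
    mul_pos (pow_pos (bubble_pos y) 2) (hpos _)
  refine ((integrable_bubble_rpow (n := n) (r := n) (by linarith)).const_mul
    (M ^ ((n : ℝ) / 2))).mono' (((contDiff_bubble.continuous.pow 2).mul hc).rpow_const fun y =>
      Or.inl (hρ y).ne').aestronglyMeasurable (Eventually.of_forall fun y => ?_)
  have hFM : F ((extChartAt (𝓡 n) p).symm y) ≤ M := (le_abs_self _).trans (hM _ trivial)
  rw [Real.norm_of_nonneg (Real.rpow_nonneg (hρ y).le _),
    Real.mul_rpow (sq_nonneg _) (hpos _).le, ← Real.rpow_natCast (bubble y) 2,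
    ← Real.rpow_mul (bubble_pos y).le, mul_comm, show ((2 : ℕ) : ℝ) * ((n : ℝ) / 2) = n by
      push_cast; ring]
  exact mul_le_mul_of_nonneg_right (Real.rpow_le_rpow (hpos _).le hFM (by positivity))
    (Real.rpow_pos_of_pos (bubble_pos y) _).le

lemma vol_pos (hn : 0 < n)
    (hF : ∀ x, ∀ v w : TangentSpace (𝓡 n) x, h.inner x v w = F x * (roundMetric n).inner x v w)
    (hFc : Continuous F) (hpos : ∀ x, 0 < F x) (p : Sph n) : 0 < vol h := by
  rw [vol_conformal hn hF hFc hpos p]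
  exact integral_pos_of_pos (fun y => Real.rpow_pos_of_pos
    (mul_pos (pow_pos (bubble_pos y) 2) (hpos _)) _) (integrable_vol hn hFc hpos p)

lemma integral_bubble_pow_pos (hn : 0 < n) : 0 < ∫ y : EuclideanSpace ℝ (Fin n), bubble y ^ n := by
  have hn' : (0 : ℝ) < n := by exact_mod_cast hn
  have := integrable_bubble_rpow (n := n) (r := n) (by linarith)
  simp_rw [Real.rpow_natCast] at this
  exact integral_pos_of_pos (fun y => pow_pos (bubble_pos y) n) this

/-- Energy identity for the flattened eigenfunction, Hölder with exponents n/2 and n/(n-2), and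
Sobolev. The eigenfunction may change sign, so no theory of first eigenfunctions is needed. -/
theorem le_eigenvalue_mul_vol (hn : 5 ≤ n)
    (hF : ∀ x, ∀ v w : TangentSpace (𝓡 n) x, h.inner x v w = F x * (roundMetric n).inner x v w)
    (hFs : ContMDiff (𝓡 n) 𝓘(ℝ, ℝ) ∞ F) (hpos : ∀ x, 0 < F x)
    (hv : ContMDiff (𝓡 n) 𝓘(ℝ, ℝ) ∞ v) {s : ℝ} (hs : ∀ x, yamabeOperator h v x = s * v x)
    {p : Sph n} (hp : v p ≠ 0) :
    n * ((n : ℝ) - 1) * (∫ y : EuclideanSpace ℝ (Fin n), bubble y ^ n) ^ (2 / (n : ℝ)) ≤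
      s * vol h ^ (2 / (n : ℝ)) := by
  have hn' : (5 : ℝ) ≤ n := by exact_mod_cast hn
  have hn1 : (0 : ℝ) < (n : ℝ) - 1 := by linarith
  have hn2 : (0 : ℝ) < (n : ℝ) - 2 := by linarith
  have hFc : Continuous F := hFs.continuous
  let W : Sph n → ℝ := fun x => F x ^ (((n : ℝ) - 2) / 4) * v x
  have hW : ContMDiff (𝓡 n) 𝓘(ℝ, ℝ) ∞ W := by
    refine ContMDiff.mul (fun x => ?_) hv
    exact (Real.contDiffAt_rpow_const_of_ne (hpos x).ne').contMDiffAt.comp x (hFs x)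
  set E := sphereExt W with hEdef
  have hE : ∀ z, ‖z‖ = 1 → ContDiffAt ℝ ∞ E z := contDiffAt_sphereExt hW
  have hEv : ∀ x : Sph n, E x = F x ^ (((n : ℝ) - 2) / 4) * v x := sphereExt_coe W
  set c : ℝ := 4 * ((n : ℝ) - 1) / (n - 2) with hc
  have hc0 : 0 < c := by positivity
  -- The eigenvalue equation rewritten for E = F^{(n-2)/4} v: the powers of F combine to (n+2)/4 -
  -- (n-2)/4 = 1.
  have hop : ∀ x : Sph n, sphereOp E x = -(s / c) * (F x * E x) := by
    intro x
    have h1 := yamabeOperator_conformal (by omega) hF hFs hpos hv hE hEv x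
    rw [hs x, ← hc, Real.rpow_neg (hpos x).le] at h1
    have h2 : F x ^ (((n : ℝ) + 2) / 4) = F x * F x ^ (((n : ℝ) - 2) / 4) := by
      rw [show ((n : ℝ) + 2) / 4 = 1 + ((n : ℝ) - 2) / 4 by ring, Real.rpow_add (hpos x),
        Real.rpow_one]
    have h3 := Real.rpow_pos_of_pos (hpos x) (((n : ℝ) + 2) / 4)
    rw [hEv, ← mul_assoc (F x), ← h2]
    field_simp at h1 ⊢
    linarith
  set ψ := flatten E p with hψ
  set ρ : EuclideanSpace ℝ (Fin n) → ℝ :=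
    fun y => bubble y ^ 2 * F ((extChartAt (𝓡 n) p).symm y) with hρ
  have hρ0 : ∀ y, 0 < ρ y := fun y => mul_pos (pow_pos (bubble_pos y) 2) (hpos _)
  obtain ⟨C, -, hC⟩ := exists_bound_flatten hE p
  have hψs : ContDiff ℝ ∞ ψ := contDiff_flatten hE p
  have henergy : ∑ i, ∫ y, partialDeriv i ψ y ^ 2 = s / c * ∫ y, ρ y * ψ y ^ 2 := by
    rw [sum_integral_partialDeriv_flatten_sq hn hE p, ← integral_const_mul, ← integral_neg]
    refine integral_congr_ae (Eventually.of_forall fun y => ?_)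
    have hb : bubble y ^ (((n : ℝ) + 2) / 2) = bubble y ^ 2 * bubble y ^ (((n : ℝ) - 2) / 2) := by
      rw [show ((n : ℝ) + 2) / 2 = ((2 : ℕ) : ℝ) + ((n : ℝ) - 2) / 2 by push_cast; ring,
        Real.rpow_add (bubble_pos y), Real.rpow_natCast]
    have hE2 : ψ y = bubble y ^ (((n : ℝ) - 2) / 2) * E ((extChartAt (𝓡 n) p).symm y) := by
      rw [hψ, flatten, coe_extChartAt_symm]
    change -(ψ y * _) = _
    rw [← coe_extChartAt_symm, hop, hb, hρ]
    simp only [hE2]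
    ring
  set I : ℝ := ∫ y, |ψ y| ^ (2 * (n : ℝ) / (n - 2)) with hI
  have hpexp : 0 < 2 * (n : ℝ) / (n - 2) := by positivity
  have hIi := integrable_rpow_of_le_bubble hn hψs.continuous fun y => (hC y).1
  -- The chart is centred at p, where v does not vanish, so ψ is nonzero at the origin and its
  -- critical norm can be cancelled later.
  have hI0 : 0 < I := by
    refine integral_pos_of_integrable_nonneg_nonzero (x := extChartAt (𝓡 n) p p)
      (hψs.continuous.abs.rpow_const fun y => Or.inr hpexp.le) hIi
      (fun y => Real.rpow_nonneg (abs_nonneg _) _) ?_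
    refine (Real.rpow_pos_of_pos (abs_pos.2 ?_) _).ne'
    rw [hψ, flatten, ← coe_extChartAt_symm, extChartAt_to_inv, hEv]
    exact mul_ne_zero (Real.rpow_pos_of_pos (bubble_pos _) _).ne'
      (mul_ne_zero (Real.rpow_pos_of_pos (hpos p) _).ne' hp)
  set J : ℝ := I ^ (((n : ℝ) - 2) / n) with hJ
  have hJ0 : 0 < J := Real.rpow_pos_of_pos hI0 _
  have hρi := integrable_vol (by omega) hFc hpos p
  have hρc : Continuous ρ := (contDiff_bubble.continuous.pow 2).mul
    (hFc.comp (continuous_extChartAt_symm_sphere p))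
  have hsq : ∀ y, (ψ y ^ 2) ^ ((n : ℝ) / (n - 2)) = |ψ y| ^ (2 * (n : ℝ) / (n - 2)) := fun y => by
    rw [← sq_abs, ← Real.rpow_natCast, ← Real.rpow_mul (abs_nonneg _)]
    congr 1
    push_cast
    ring
  have hholder : ∫ y, ρ y * ψ y ^ 2 ≤ vol h ^ (2 / (n : ℝ)) * J := by
    have hq1 : 0 < (n : ℝ) / 2 := by positivity
    have hq2 : 0 < (n : ℝ) / (n - 2) := by positivity
    have hpq : ((n : ℝ) / 2).HolderConjugate ((n : ℝ) / (n - 2)) := by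
      rw [Real.holderConjugate_iff]
      refine ⟨by linarith, ?_⟩
      field_simp
      ring
    have hLp : MemLp ρ (ENNReal.ofReal ((n : ℝ) / 2)) := by
      rw [← integrable_norm_rpow_iff hρc.aestronglyMeasurable (by simpa using hq1) (by simp),
        ENNReal.toReal_ofReal hq1.le]
      simp_rw [Real.norm_of_nonneg (hρ0 _).le]
      exact hρi
    have hLq : MemLp (fun y => ψ y ^ 2) (ENNReal.ofReal ((n : ℝ) / (n - 2))) := by
      rw [← integrable_norm_rpow_iff (f := fun y => ψ y ^ 2)
        (hψs.continuous.pow 2).aestronglyMeasurable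
        (by simpa using hq2) (by simp), ENNReal.toReal_ofReal hq2.le]
      simp_rw [Real.norm_of_nonneg (sq_nonneg _), hsq]
      exact hIi
    have := integral_mul_le_Lp_mul_Lq_of_nonneg hpq (μ := volume)
      (Eventually.of_forall fun y => (hρ0 y).le) (Eventually.of_forall fun y => sq_nonneg (ψ y))
      hLp hLq
    simp_rw [hsq, one_div_div] at this
    rwa [vol_conformal (by omega) hF hFc hpos p]
  have hsob := sobolev_inequality_abs hn (hψs.of_le (by simp)) (fun y => (hC y).1)
    fun i y => ((hC y).2 i).1
  rw [henergy, ← hI, ← hJ] at hsob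
  set V : ℝ := (∫ y : EuclideanSpace ℝ (Fin n), bubble y ^ n) ^ (2 / (n : ℝ)) with hV
  have hV0 : 0 < V := Real.rpow_pos_of_pos (integral_bubble_pow_pos (by omega)) _
  have hX0 : 0 ≤ ∫ y, ρ y * ψ y ^ 2 :=
    integral_nonneg fun y => mul_nonneg (hρ0 y).le (sq_nonneg _)
  -- Positivity of s comes from the Sobolev inequality itself; it is needed before Hölder's bound
  -- may be multiplied by s/c.
  have hs0 : 0 < s / c := by
    have : 0 < s / c * ∫ y, ρ y * ψ y ^ 2 := lt_of_lt_of_le (by positivity) hsob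
    exact pos_of_mul_pos_left this hX0
  have h1 : (n * (n - 2) / 4 : ℝ) * V * J ≤ s / c * vol h ^ (2 / (n : ℝ)) * J := by
    refine hsob.trans ?_
    rw [mul_assoc]
    exact mul_le_mul_of_nonneg_left hholder hs0.le
  have h2 := mul_le_mul_of_nonneg_left (le_of_mul_le_mul_right h1 hJ0) hc0.le
  have h3 : c * (s / c * vol h ^ (2 / (n : ℝ))) = s * vol h ^ (2 / (n : ℝ)) := by
    field_simp
  have h4 : c * (n * (n - 2) / 4 * V) = n * ((n : ℝ) - 1) * V := by
    rw [hc]; field_simp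
  rwa [h3, h4] at h2

/-- A linearly independent family of length one is a nonzero eigenfunction, so the previous bound
holds for every competitor in the infimum. -/
theorem le_yamabeInvariant_one (hn : 5 ≤ n) :
    ((n * ((n : ℝ) - 1) * (∫ y : EuclideanSpace ℝ (Fin n), bubble y ^ n) ^ (2 / (n : ℝ)) : ℝ) :
      EReal) ≤ yamabeInvariant 1 (roundMetric n) := by
  refine le_iInf₂ fun h ⟨F, hFs, hpos, hF⟩ => ?_
  have p : Sph n := ⟨EuclideanSpace.single 0 1, by simp⟩
  have hv := Real.rpow_pos_of_pos (vol_pos (by omega) hF hFs.continuous hpos p) (2 / (n : ℝ))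
  set w : ℝ := vol h ^ (2 / (n : ℝ)) with hw
  set K : ℝ := n * ((n : ℝ) - 1) *
    (∫ y : EuclideanSpace ℝ (Fin n), bubble y ^ n) ^ (2 / (n : ℝ)) with hK
  have key : ((K / w : ℝ) : EReal) ≤ eigenvalue 1 h := by
    refine le_sInf fun t ⟨v, hli, hvt⟩ => ?_
    obtain ⟨hvs, s, hst, hs⟩ := hvt 0
    obtain ⟨x, hx⟩ := Function.ne_iff.1 (hli.ne_zero 0)
    refine le_trans (EReal.coe_le_coe_iff.2 ?_) hst
    rw [div_le_iff₀ hv]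
    exact le_eigenvalue_mul_vol hn hF hFs hpos hvs hs hx
  calc (K : EReal) = ((K / w : ℝ) : EReal) * (w : EReal) := by
        rw [← EReal.coe_mul, div_mul_cancel₀ _ hv.ne']
    _ ≤ _ := mul_le_mul_of_nonneg_right key (EReal.coe_nonneg.2 hv.le)

end LowerBound

/-! ### The spectrum of the round sphere -/

section Round

variable {n : ℕ}

lemma sphereOp_affine (c : ℝ) (L : EuclideanSpace ℝ (Fin (n + 1)) →L[ℝ] ℝ)
    (z : EuclideanSpace ℝ (Fin (n + 1))) :
    sphereOp (fun z => c + L z) z = -n * L z - n * ((n : ℝ) - 2) / 4 * (c + L z) := by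
  have h1 : fderiv ℝ (fun z => c + L z) = fun _ => L := by
    ext1 z
    exact (L.hasFDerivAt.const_add c).fderiv
  have h2 : fderiv ℝ (fun _ : EuclideanSpace ℝ (Fin (n + 1)) => L) = 0 := by
    ext1 z
    simp
  rw [sphereOp, h1, h2]
  simp

lemma roundMetric_conformal (x : Sph n) (v w : TangentSpace (𝓡 n) x) :
    (roundMetric n).inner x v w = (1 : ℝ) * (roundMetric n).inner x v w := (one_mul _).symm

lemma roundMetric_mem_conformalClass : roundMetric n ∈ conformalClass (roundMetric n) :=
  ⟨fun _ => 1, contMDiff_const, fun _ => one_pos, roundMetric_conformal⟩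

lemma vol_roundMetric (hn : 0 < n) :
    vol (roundMetric n) = ∫ y : EuclideanSpace ℝ (Fin n), bubble y ^ n := by
  rw [vol_conformal (F := fun _ => 1) hn roundMetric_conformal continuous_const
    (fun _ => one_pos) ⟨EuclideanSpace.single 0 1, by simp⟩]
  refine integral_congr_ae (Eventually.of_forall fun y => ?_)
  change (bubble y ^ 2 * 1) ^ ((n : ℝ) / 2) = bubble y ^ n
  rw [mul_one, ← Real.rpow_natCast (bubble y) 2, ← Real.rpow_mul (bubble_pos y).le,
    ← Real.rpow_natCast (bubble y) n]
  congr 1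
  push_cast
  ring

lemma contMDiff_affine (c : ℝ) (L : EuclideanSpace ℝ (Fin (n + 1)) →L[ℝ] ℝ) :
    ContMDiff (𝓡 n) 𝓘(ℝ, ℝ) ∞ fun x : Sph n => c + L x := by
  have := Fact.mk (@finrank_euclideanSpace_fin ℝ _ (n + 1))
  exact (contDiff_const.add L.contDiff).contMDiff.comp (contMDiff_coe_sphere (n := n))

/-- `sphereOp` acts as -n(n-2)/4 on constants and as -n - n(n-2)/4 = -n(n+2)/4 on linear functions;
the factor -4(n-1)/(n-2) yields the two eigenvalues. -/
lemma yamabeOperator_roundMetric_affine (hn : 3 ≤ n) (c : ℝ)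
    (L : EuclideanSpace ℝ (Fin (n + 1)) →L[ℝ] ℝ) (x : Sph n) :
    yamabeOperator (roundMetric n) (fun x => c + L x) x =
      n * ((n : ℝ) - 1) * c + n * ((n : ℝ) - 1) * (n + 2) / (n - 2) * L x := by
  have hn' : (3 : ℝ) ≤ n := by exact_mod_cast hn
  have hn2 : (n : ℝ) - 2 ≠ 0 := by linarith
  rw [yamabeOperator_conformal (F := fun _ => 1) (E := fun z => c + L z) hn roundMetric_conformal
    contMDiff_const (fun _ => one_pos) (contMDiff_affine c L)
    (fun z _ => (contDiff_const.add L.contDiff).contDiffAt)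
    (fun x => by rw [Real.one_rpow, one_mul]), sphereOp_affine, Real.one_rpow]
  field_simp
  ring

/-- The constants and the coordinate functions on the sphere. -/
noncomputable def lowHarmonic : Fin (n + 2) → Sph n → ℝ :=
  Fin.cons (fun _ => 1) fun j x => (x : EuclideanSpace ℝ (Fin (n + 1))) j

/-- Evaluate a relation at the points e_j and -e_j. -/
lemma linearIndependent_lowHarmonic : LinearIndependent ℝ (lowHarmonic (n := n)) := by
  rw [Fintype.linearIndependent_iff]
  intro g hg
  have key : ∀ x : Sph n,
      g 0 + ∑ j : Fin (n + 1), g j.succ * (x : EuclideanSpace ℝ (Fin (n + 1))) j = 0 := by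
    intro x
    have := congrFun hg x
    rw [Fin.sum_univ_succ] at this
    simpa [lowHarmonic, Finset.sum_apply] using this
  have h1 : ∀ j, g 0 + g (Fin.succ j) = 0 := fun j => by
    simpa using key ⟨EuclideanSpace.single j 1, by simp⟩
  have h2 : ∀ j, g 0 - g (Fin.succ j) = 0 := fun j => by
    simpa [sub_eq_add_neg] using key ⟨-EuclideanSpace.single j 1, by simp⟩
  intro i
  refine Fin.cases ?_ (fun j => ?_) i
  · linarith [h1 0, h2 0]
  · linarith [h1 j, h2 j]

/-- Exhibiting n+2 independent eigenfunctions is enough for an upper bound; the rest of the spectrum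
plays no role. -/
theorem eigenvalue_roundMetric_le (hn : 3 ≤ n) :
    eigenvalue (n + 2) (roundMetric n) ≤ ((n * ((n : ℝ) - 1) * (n + 2) / (n - 2) : ℝ) : EReal) := by
  have hn' : (3 : ℝ) ≤ n := by exact_mod_cast hn
  have hn1 : (0 : ℝ) < (n : ℝ) - 1 := by linarith
  have hn2 : (0 : ℝ) < (n : ℝ) - 2 := by linarith
  refine sInf_le ⟨lowHarmonic, linearIndependent_lowHarmonic, fun i => ?_⟩
  refine Fin.cases ?_ (fun j => ?_) i
  · have h0 : lowHarmonic (n := n) 0 = fun x : Sph n => (1 : ℝ) +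
        (0 : EuclideanSpace ℝ (Fin (n + 1)) →L[ℝ] ℝ) x := by
      ext x; simp [lowHarmonic]
    rw [h0]
    refine ⟨contMDiff_affine 1 0, n * ((n : ℝ) - 1), EReal.coe_le_coe_iff.2 ?_, fun x => ?_⟩
    · rw [le_div_iff₀ hn2]
      exact mul_le_mul_of_nonneg_left (by linarith) (by positivity)
    · rw [yamabeOperator_roundMetric_affine hn]
      simp
  · have h0 : lowHarmonic (n := n) j.succ = fun x : Sph n => (0 : ℝ) +
        (EuclideanSpace.proj j : EuclideanSpace ℝ (Fin (n + 1)) →L[ℝ] ℝ) x := by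
      ext x; simp [lowHarmonic]
    rw [h0]
    refine ⟨contMDiff_affine 0 _, _, le_rfl, fun x => ?_⟩
    rw [yamabeOperator_roundMetric_affine hn]
    ring

theorem yamabeInvariant_roundMetric_le (hn : 3 ≤ n) :
    yamabeInvariant (n + 2) (roundMetric n) ≤ ((n * ((n : ℝ) - 1) * (n + 2) / (n - 2) *
      (∫ y : EuclideanSpace ℝ (Fin n), bubble y ^ n) ^ (2 / (n : ℝ)) : ℝ) : EReal) := by
  refine (iInf₂_le _ roundMetric_mem_conformalClass).trans ?_
  rw [vol_roundMetric (by omega), EReal.coe_mul]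
  exact mul_le_mul_of_nonneg_right (eigenvalue_roundMetric_le hn) (EReal.coe_nonneg.2
    (Real.rpow_pos_of_pos (integral_bubble_pow_pos (by omega)) _).le)

end Round

/-! ### The numerical inequality and the conclusion. -/

/-- With u = 2/x the logarithm of the left side is log((1+u)/(1-u)), about 2u, and that of the right
side is u log(x+2). So log(x+2) must exceed slightly more than 2, and x ≥ 7 gives log 9 ≈ 2.197. -/
lemma add_two_div_sub_two_lt_rpow {x : ℝ} (hx : 7 ≤ x) :
    (x + 2) / (x - 2) < (x + 2) ^ (2 / x) := by
  have hx2 : 0 < x - 2 := by linarith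
  have hx0 : 0 < x := by linarith
  rw [← Real.log_lt_log_iff (by positivity) (by positivity), Real.log_rpow (by positivity)]
  -- One term of the series with its remainder gives the bound u (2 + 8/(x² - 4)), at most u · 98/45
  -- when x ≥ 7.
  have h1 := Real.log_div_le_sum_range_add (x := 2 / x) (by positivity)
    (by rw [div_lt_one hx0]; linarith) 1
  have h2 : (1 + 2 / x) / (1 - 2 / x) = (x + 2) / (x - 2) := by
    have : 1 - 2 / x ≠ 0 := by
      rw [ne_eq, sub_eq_zero, eq_div_iff hx0.ne']; linarith
    field_simp
  rw [h2] at h1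
  have h3 : 2 * ((∑ i ∈ Finset.range 1, (2 / x) ^ (2 * i + 1) / (2 * (i : ℝ) + 1)) +
      (2 / x) ^ (2 * 1 + 1) / (1 - (2 / x) ^ 2)) ≤ 2 / x * (98 / 45) := by
    have h4 : 1 - (2 / x) ^ 2 = (x ^ 2 - 4) / x ^ 2 := by field_simp; ring
    have h5 : 0 < x ^ 2 - 4 := by nlinarith
    rw [h4]
    have h6 : 2 * ((∑ i ∈ Finset.range 1, (2 / x) ^ (2 * i + 1) / (2 * (i : ℝ) + 1)) +
      (2 / x) ^ (2 * 1 + 1) / ((x ^ 2 - 4) / x ^ 2)) = 2 / x * (2 + 8 / (x ^ 2 - 4)) := by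
      simp
      field_simp
      ring
    rw [h6]
    refine mul_le_mul_of_nonneg_left ?_ (by positivity)
    have : 8 / (x ^ 2 - 4) ≤ 8 / 45 := div_le_div_of_nonneg_left (by norm_num) (by norm_num)
      (by nlinarith)
    linarith
  have h7 : 98 / 45 < Real.log (x + 2) := by
    refine lt_of_lt_of_le ?_ (Real.log_le_log (by norm_num : (0 : ℝ) < 9) (by linarith))
    rw [Real.lt_log_iff_exp_lt (by norm_num)]
    -- Clearing the denominator turns exp(98/45) < 9 into e^98 < 9^45, checked with a decimal bound
    -- for e.
    refine lt_of_pow_lt_pow_left₀ 45 (by norm_num) ?_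
    rw [← Real.exp_nat_mul]
    have h8 : ((45 : ℕ) : ℝ) * (98 / 45) = (98 : ℕ) * 1 := by norm_num
    rw [h8, Real.exp_nat_mul]
    refine (pow_lt_pow_left₀ Real.exp_one_lt_d9 (Real.exp_pos _).le (by norm_num)).trans ?_
    norm_num
  have h9 : 2 / x * (98 / 45) < 2 / x * Real.log (x + 2) :=
    mul_lt_mul_of_pos_left h7 (by positivity)
  linarith

end Yamabe

theorem mainTheorem11 (n : ℕ) (hn : 7 ≤ n) :
    Yamabe.yamabeInvariant (n + 2) (Yamabe.roundMetric n) <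
      ((((n : ℝ) + 2) ^ (2 / (n : ℝ)) : ℝ) : EReal) *
        Yamabe.yamabeInvariant 1 (Yamabe.roundMetric n) := by
  have hn' : (7 : ℝ) ≤ n := by exact_mod_cast hn
  have hn1 : (0 : ℝ) < (n : ℝ) - 1 := by linarith
  have hn2 : (0 : ℝ) < (n : ℝ) - 2 := by linarith
  have hV := Real.rpow_pos_of_pos (Yamabe.integral_bubble_pow_pos (n := n) (by omega)) (2 / (n : ℝ))
  have hpow : (0 : ℝ) ≤ ((n : ℝ) + 2) ^ (2 / (n : ℝ)) := by positivity
  -- Multiplication by a nonnegative real is monotone on `EReal`, so the lower bound for μ_1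
  -- suffices; its exact value is not needed.
  refine (Yamabe.yamabeInvariant_roundMetric_le (by omega)).trans_lt (lt_of_lt_of_le ?_
    (mul_le_mul_of_nonneg_left (Yamabe.le_yamabeInvariant_one (by omega)) (EReal.coe_nonneg.2 hpow)))
  rw [← EReal.coe_mul, EReal.coe_lt_coe_iff, mul_div_assoc]
  have h1 := Yamabe.add_two_div_sub_two_lt_rpow hn'
  have h2 := mul_lt_mul_of_pos_right h1 (mul_pos (mul_pos (by linarith : (0 : ℝ) < n) hn1) hV)
  linarith
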